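/- **Setting.** Let $\pi:\mathbb R^3\to\mathbb R^2$ forget the last coordinate. For $d\in\mathbb N$ and finitely supported sequences $\alpha=(\alpha_w)_{w\ge1}$, $\beta=(\beta_w)_{w\ge1}$ of natural numbers with $d-\sum_w w\alpha_w+\sum_w w\beta_w=0$ let $\Delta^3_d(\alpha,\beta)$ be the labeled multiset of $d$ copies of each of $(1,1,1),(-1,0,0),(0,-1,0)$, $\alpha_w$ copies of $(0,0,-w)$ and $\beta_w$ copies of $(0,0,w)$ ($w\ge 1$). For a finite label set $\Lambda$ and direction vectors $v:\Lambda\to\mathbb Z^m$, the moduli space of rational tropical stable maps to $\mathbb R^m$ (metric trees $\Gamma$ with ends labeled by $\Lambda$ and all vertices of valence $\geq 3$, with a balanced integral affine map $h:\Gamma\to\mathbb R^m$ for which the end $k$ has direction $v_k$; it is contracted if $v_k=0$) is identified, through $h$ of a fixed contracted end, with the tropical fan $\mathcal M_{0,\Lambda}\times\mathbb R^m$, all of whose weights are one. Let $\mathrm{ev}_k$ be the evaluation at the end $k$, $\partial\mathrm{ev}_k=\pi\circ\mathrm{ev}_k$, and let $\mathrm{ft}_\lambda$ be the forgetful map to $\mathcal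 M_{0,4}$ for a four-element set $\lambda$ of labels. Products are tropical intersection products. A multi line in $\mathbb R^2$ is a translate of the tropical curve with the three rays $(1,1),(-1,0),(0,-1)$ of equal weight $\omega\ge1$. Conditions are in *general position* if the sum of their codimensions is the dimension of the moduli space and their intersection product is a nonzero zero-dimensional cycle that lies inside top-dimensional cells of the product of the cross-ratio conditions alone. **Conditions.** Let $n\ge 1$ and let there be given, in general position with respect to $\Delta^3_d(\alpha,\beta)$ and $n$ contracted ends: points $p_1,\dots,p_n\in\mathbb R^3$ for the contracted ends (pulled back along $\mathrm{ev}_i$), points $P_f\in\mathbb R^2$ for $f\in\eta$ and multi lines $L_k\subset\mathbb R^2$ for $k\in\kappa$ (pulled back along $\partial\mathrm{ev}$), where $\eta,\kappa$ are disjoint sets of labels of vertical ends (direction parallel to $(0,0,1)$), and degenerated cross-ratios $\lambda_1,\dots,\lambda_l$ (pull-backs $\mathrm{ft}_{\lambda_j}^*(0)$) whose entries are labels of contracted or vertical ends. **Floor diagrams.** A cross-ratio floor diagram $\mathcal F$ satisfying these conditions is a tree on vertices $v_1<\dots<v_n$ with a partition of the ends of $\Delta^3_d(\alpha,\beta)$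 into sets $\delta_{v_1},\dots,\delta_{v_n}$, edge weights $\omega(e)\in\mathbb N_{>0}$, and natural numbers (flows) on the half-edges, such that the following holds. Let $s_i$ be the number of ends of direction $(1,1,1)$ in $\delta_{v_i}$. 1. For all $i$: $s_i$ plus the sum of the third coordinates of the vertical ends in $\delta_{v_i}$, plus $\sum\omega(e)$ over the edges from $v_i$ to greater vertices, minus $\sum\omega(e)$ over the edges from $v_i$ to smaller vertices, is $0$. 2. Each $\lambda_j$ is satisfied at some vertex $v$. This means: attach $v_i$ to an entry that is the label of the $i$-th contracted end or of an end in $\delta_{v_i}$; for each splitting of the four entries into two pairs the two paths joining the vertices of the pairs meet exactly in $v$. Let $\lambda_{v}$ be the set of $\lambda_j$ satisfied at $v$. 3. The two flows on each edge add up to $2$, and the incoming flows at $v_i$ add up to $0$ if $s_i=0$ and otherwise to $$A(v_i)=3s_i+\#\{\text{vertical ends in }\delta_{v_i}\}+\operatorname{val}(v_i)-2-\#\lambda_{v_i}-2\,\#(\delta_{v_i}\cap\eta)-\#(\delta_{v_i}\cap\kappa).$$ An edge is a $1/1$ edge if both its flows are $1$ and a $2/0$ edge if its flows are $2$ and $0$.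 **Local data at $v_i$.** Cutting an edge at $v_i$ yields an end of direction $(0,0,\omega(e))$ if the edge leads to a greater vertex and $(0,0,-\omega(e))$ otherwise. Let $\Delta^3_{s_i}(\alpha^i,\beta^i)$ be the degree formed by the vertical ends in $\delta_{v_i}$, the ends from cut edges, and $s_i$ copies of each of $(1,1,1),(-1,0,0),(0,-1,0)$. Let $\eta_i$ consist of $\delta_{v_i}\cap\eta$ and the cut $2/0$ edges whose flow incoming at $v_i$ is $2$, and $\kappa_i$ of $\delta_{v_i}\cap\kappa$ and the cut $1/1$ edges. For the cut edges choose arbitrary points $P_f\in\mathbb R^2$ ($f\in\eta_i$), respectively multi lines $L_k$ of weight $1$ ($k\in\kappa_i$). For $\lambda_j\in\lambda_{v_i}$ let $\lambda_j^{\to}$ arise by replacing each entry belonging to another vertex $v_k$ by the cut edge at $v_i$ on the path to $v_k$. The multiplicity of $v_i$ is $$\operatorname{mult}(v_i)=\deg\Bigl(\prod_{k\in\kappa_i}\partial\mathrm{ev}_k^*(L_k)\cdot\prod_{f\in\eta_i}\partial\mathrm{ev}_f^*(P_f)\cdot\prod_{\lambda_j\in\lambda_{v_i}}\mathrm{ft}_{\lambda_j^{\to}}^*(0)\cdot\mathrm{ev}_i^*(p_i)\cdot\mathcal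 M_{0,1}\bigl(\mathbb R^3,\Delta^3_{s_i}(\alpha^i,\beta^i)\bigr)\Bigr).$$ **Proposition.** For every vertex $v_i$ of a cross-ratio floor diagram satisfying conditions in general position, and for all choices of the $P_f$, $L_k$ at cut edges: (a) $\operatorname{mult}(v_i)$ equals the degree of $$\prod_{k\in\kappa_i}\mathrm{ev}_k^*(L_k)\cdot\prod_{f\in\eta_i}\mathrm{ev}_f^*(P_f)\cdot\prod_{\lambda_j\in\lambda_{v_i}}\mathrm{ft}_{\lambda_j^{\to}}^*(0)\cdot\mathrm{ev}_i^*(\pi(p_i))\cdot\mathcal M_{0,1+|\alpha^i|+|\beta^i|}\bigl(\mathbb R^2,\pi(\Delta^3_{s_i}(\alpha^i,\beta^i))\bigr),$$ where the vertical ends become contracted ends under $\pi$. If the local conditions at $v_i$ are in general position in $\mathbb R^3$, then the projected ones are in general position in $\mathbb R^2$; in particular this product is then zero-dimensional. (b) $C\mapsto\pi\circ C$ induces a bijection between the isomorphism classes of stable maps to $\mathbb R^3$ that occur with nonzero multiplicity in the product defining $\operatorname{mult}(v_i)$ and the isomorphism classes of stable maps to $\mathbb R^2$ that occur with nonzero multiplicity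 in the product in (a), and it preserves multiplicities. -/

import Mathlib

/-! ### Tropical intersection products

A weighted polyhedral complex in a real vector space `V` with lattice `Λ` is given by its set of
cells `𝒞 : Set (Set V)` and a weight function `ω : Set V → ℝ` on cells. Weights are integers,
regarded as real numbers. -/

/-- A rational function that is the maximum of finitely many (in all uses below, affine)
functions `term 0, …, term k`. -/
structure MaxFun (V : Type) where
  k : ℕ
  term : Fin (k + 1) → V → ℝ

namespace MaxFun

variable {V : Type}

/-- The value `max_j term j x`. -/
noncomputable def eval (f : MaxFun V) (x : V) : ℝ :=
  Finset.univ.sup' ⟨0, Finset.mem_univ 0⟩ fun j => f.term j x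

end MaxFun

section Intersection

variable {V : Type} [AddCommGroup V] [Module ℝ V]

/-- Dimension of a polyhedron. -/
noncomputable def polyDim (σ : Set V) : ℕ := Module.finrank ℝ (vectorSpan ℝ σ)

/-- The coarsest subdivision of a complex `S` on whose cells every function of the list `fs` is
affine: the cell of `σ ∈ S` and `x ∈ σ` consists of all `y ∈ σ` at which every term that is
maximal at `x` is maximal as well. -/
def subdivide (S : Set (Set V)) (fs : List (MaxFun V)) : Set (Set V) :=
  {C | ∃ σ ∈ S, ∃ x ∈ σ,
    C = {y | y ∈ σ ∧ ∀ f ∈ fs, ∀ j, f.term j x = f.eval x → f.term j y = f.eval y}}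

/-- The cells of `𝒞` that have `τ` as a face of codimension one. -/
def cofaces (𝒞 : Set (Set V)) (τ : Set V) : Set (Set V) :=
  {σ | σ ∈ 𝒞 ∧ τ ⊆ σ ∧ polyDim σ = polyDim τ + 1}

/-- `u` represents the primitive normal vector of `σ` relative to its facet `τ`: it lies in
`Λ_σ = Λ ∩ span σ`, generates `Λ_σ / Λ_τ`, and points from `τ` into `σ`. -/
def IsNormalVector (Λ : AddSubgroup V) (τ σ : Set V) (u : V) : Prop :=
  u ∈ Λ ∧ u ∈ vectorSpan ℝ σ ∧
  (∀ w ∈ Λ, w ∈ vectorSpan ℝ σ → ∃ a : ℤ, w - a • u ∈ vectorSpan ℝ τ) ∧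
  ∃ x ∈ τ, ∃ ε : ℝ, 0 < ε ∧ x + ε • u ∈ σ

open Classical in
/-- A representative of the normal vector of `σ` relative to `τ`. -/
noncomputable def normalVector (Λ : AddSubgroup V) (τ σ : Set V) : V :=
  if h : ∃ u, IsNormalVector Λ τ σ u then h.choose else 0

open Classical in
/-- The linear part of a function `φ` that is affine on `σ`
(only its values on `vectorSpan ℝ σ` matter). -/
noncomputable def linearPart (φ : V → ℝ) (σ : Set V) : V →ₗ[ℝ] ℝ :=
  if h : ∃ ℓ : V →ₗ[ℝ] ℝ, ∀ x ∈ σ, ∀ y ∈ σ, φ y - φ x = ℓ (y - x) then h.choose else 0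

open Classical in
/-- Weight of the divisor `φ · (𝒞, ω)` at the cell `τ`:
`∑_σ φ_σ(ω(σ) u_{σ/τ}) - φ_τ(∑_σ ω(σ) u_{σ/τ})`, the sums running over the cells `σ` with facet
`τ`. For balanced weights the second argument lies in the span of `τ`, as it has to in order that
`φ_τ` can be applied to it. -/
noncomputable def divisorWeight (Λ : AddSubgroup V) (𝒞 : Set (Set V)) (ω : Set V → ℝ)
    (φ : V → ℝ) (τ : Set V) : ℝ :=
  if (∑ᶠ σ ∈ cofaces 𝒞 τ, ω σ • normalVector Λ τ σ) ∈ vectorSpan ℝ τ then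
    (∑ᶠ σ ∈ cofaces 𝒞 τ, ω σ * linearPart φ σ (normalVector Λ τ σ))
      - linearPart φ τ (∑ᶠ σ ∈ cofaces 𝒞 τ, ω σ • normalVector Λ τ σ)
  else 0

open Classical in
/-- Weights on the cells of `subdivide S all` of the cycle obtained from the complex `S`
of pure dimension `D` with all weights one by intersecting successively with the functions of the
list `fs` (the head of the list first). Here `fs` consists of functions from the list `all`. -/
noncomputable def productWeight (Λ : AddSubgroup V) (S : Set (Set V)) (D : ℕ)
    (all fs : List (MaxFun V)) : Set V → ℝ :=
  fs.foldl (fun ω f => divisorWeight Λ (subdivide S all) ω f.eval)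
    (fun σ => if polyDim σ = D then 1 else 0)

open Classical in
/-- The multiplicity of the point `x` in the zero-dimensional intersection product of the
functions `fs` with `S`. -/
noncomputable def pointMult (Λ : AddSubgroup V) (S : Set (Set V)) (D : ℕ)
    (fs : List (MaxFun V)) (x : V) : ℝ :=
  if ({x} : Set V) ∈ subdivide S fs then productWeight Λ S D fs fs {x} else 0

/-- The degree of the zero-dimensional intersection product of the functions `fs` with `S`. -/
noncomputable def productDegree (Λ : AddSubgroup V) (S : Set (Set V)) (D : ℕ)
    (fs : List (MaxFun V)) : ℝ :=
  ∑ᶠ x : V, pointMult Λ S D fs x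

end Intersection

/-! ### Abstract rational tropical curves and their moduli space -/

section Trees

variable {L : Type} [Fintype L]

/-- Combinatorial type of a rational tropical curve whose ends are labeled by `L`: a tree with
vertices of valence at least three; the end labeled by `i` is attached to the vertex `leg i`. -/
structure MarkedTree (L : Type) [Fintype L] where
  nv : ℕ
  G : SimpleGraph (Fin nv)
  isTree : G.IsTree
  leg : L → Fin nv
  stable : ∀ a, 3 ≤ (G.neighborSet a).ncard + {i | leg i = a}.ncard

/-- An `L`-marked abstract rational tropical curve: its bounded edges have positive lengths. -/
structure TropCurve (L : Type) [Fintype L] extends MarkedTree L where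
  len : Sym2 (Fin nv) → ℝ
  len_pos : ∀ e ∈ G.edgeSet, 0 < len e

/-- The vector space in which the moduli space of `L`-marked curves is embedded by means of
tropical double ratios: there is one coordinate for each quadruple `q` of labels, namely (for
pairwise distinct `q 0, …, q 3`) the signed length of the intersection of the path from `q 0` to
`q 1` with the path from `q 2` to `q 3`; the coordinates of other quadruples vanish. -/
abbrev RatioSpace (L : Type) : Type := (Fin 4 → L) → ℝ

namespace MarkedTree

open Classical in
/-- `1` if the end `i` lies on a fixed side of the bounded edge `e` and `0` otherwise. -/
noncomputable def side (T : MarkedTree L) (e : Sym2 (Fin T.nv)) (i : L) : ℝ :=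
  if (T.G.deleteEdges {e}).Reachable (T.leg i) (Quot.out e).1 then 1 else 0

open Classical in
/-- The double ratios of the curve whose only bounded edge has length one and separates the ends
in the same way as `e` does. -/
noncomputable def splitVector (T : MarkedTree L) (e : Sym2 (Fin T.nv)) : RatioSpace L :=
  fun q => if Function.Injective q then
    (T.side e (q 1) - T.side e (q 0)) * (T.side e (q 3) - T.side e (q 2)) else 0

open Classical in
/-- The point of the moduli space given by the lengths `len` of the bounded edges. -/
noncomputable def modulus (T : MarkedTree L) (len : Sym2 (Fin T.nv) → ℝ) : RatioSpace L :=
  ∑ e : Sym2 (Fin T.nv) with e ∈ T.G.edgeSet, len e • T.splitVector e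

/-- The cone of all curves of combinatorial type `T` (and their degenerations). -/
def cone (T : MarkedTree L) : Set (RatioSpace L) :=
  {x | ∃ len : Sym2 (Fin T.nv) → ℝ, (∀ e, 0 ≤ len e) ∧ x = T.modulus len}

end MarkedTree

/-- The fan `M_{0,L} × ℝ^m`, which is the moduli space of rational tropical stable maps to `ℝ^m`
with ends labeled by `L`; a stable map is recorded by its underlying curve and by the image
of a fixed contracted end. -/
def moduliFan (L : Type) [Fintype L] (m : ℕ) : Set (Set (RatioSpace L × (Fin m → ℝ))) :=
  {C | ∃ T : MarkedTree L, C = T.cone ×ˢ Set.univ}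

/-- The dimension of `moduliFan L m`. -/
def moduliDim (L : Type) [Fintype L] (m : ℕ) : ℕ := Fintype.card L - 3 + m

/-- The lattice: in the first factor it is spanned by the curves with only one bounded edge,
of length one; in the second factor it is `ℤ^m`. -/
def moduliLattice (L : Type) [Fintype L] (m : ℕ) : AddSubgroup (RatioSpace L × (Fin m → ℝ)) :=
  (AddSubgroup.closure {x | ∃ T : MarkedTree L, ∃ e ∈ T.G.edgeSet, x = T.splitVector e}).prod
    (AddMonoidHom.range
      ((Int.castAddHom ℝ).compLeft (Fin m)))

/-- Evaluation at the end `k` of stable maps with direction vectors `v` of the ends, where `b`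
is the label of the contracted end by whose image a stable map is recorded. If
the `j`-th coordinate of the direction `v k` vanishes, then the `j`-th coordinate of the result is
that of the image of the end `k`. (For every auxiliary label `r` other than `b` and `k` the inner
sum is the displacement from the end `b` to the end `k`, so their mean is taken.) -/
noncomputable def evalEnd {m : ℕ} (v : L → Fin m → ℤ) (b k : L)
    (x : RatioSpace L × (Fin m → ℝ)) : Fin m → ℝ :=
  fun j => x.2 j + (∑ r : L, ∑ i : L, x.1 ![b, k, r, i] * (v i j : ℝ)) / ((Fintype.card L : ℝ) - 2)

/-! ### Rational tropical stable maps -/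

open Classical in
/-- A rational tropical stable map to `ℝ^m` whose end labeled by `i` has direction `v i`
(the end is contracted if `v i = 0`). The map is affine on bounded edges with integral
direction vectors, and is balanced at every vertex. -/
structure StableMap {m : ℕ} (v : L → Fin m → ℤ) extends TropCurve L where
  pos : Fin nv → Fin m → ℝ
  edgeDir : Fin nv → Fin nv → Fin m → ℤ
  affine : ∀ a c, G.Adj a c → ∀ j, pos c j - pos a j = len s(a, c) * (edgeDir a c j : ℝ)
  balanced : ∀ a, (∑ c with G.Adj a c, edgeDir a c) + (∑ i with leg i = a, v i) = 0

/-- The projection that forgets the last coordinate. -/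
def dropLast {R : Type} {m : ℕ} (x : Fin (m + 1) → R) : Fin m → R := fun j => x j.castSucc

namespace StableMap

variable {m : ℕ}

/-- Isomorphism of stable maps. -/
def Iso {v : L → Fin m → ℤ} (C C' : StableMap v) : Prop :=
  ∃ φ : C.G ≃g C'.G, (∀ i, φ (C.leg i) = C'.leg i) ∧
    (∀ e ∈ C.G.edgeSet, C'.len (e.map φ) = C.len e) ∧ ∀ a, C'.pos (φ a) = C.pos a

/-- The point of the moduli space that corresponds to a stable map; `b` is the label of a
contracted end. -/
noncomputable def point {v : L → Fin m → ℤ} (C : StableMap v) (b : L) :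
    RatioSpace L × (Fin m → ℝ) :=
  (C.modulus C.len, C.pos (C.leg b))

/-- The composition of a stable map with the projection that forgets the last coordinate. -/
def proj {v : L → Fin (m + 1) → ℤ} (C : StableMap v) :
    StableMap (fun i => dropLast (v i)) where
  toTropCurve := C.toTropCurve
  pos := fun a => dropLast (C.pos a)
  edgeDir := fun a c => dropLast (C.edgeDir a c)
  affine := fun a c h j => C.affine a c h j.castSucc
  balanced := by
    intro a
    funext j
    have h := congrFun (C.balanced a) j.castSucc
    simpa [dropLast, Finset.sum_apply] using h

end StableMap

end Trees

/-! ### Incidence conditions -/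

/-- A tropical multi line in `ℝ²`: its three ends have the primitive directions `(1,1)`, `(-1,0)`,
`(0,-1)` and, by balancing, the same weight. -/
structure MultiLine where
  vertex : Fin 2 → ℝ
  weight : ℕ
  weight_pos : 0 < weight

/-- A collection of conditions on the ends of a stable map to `ℝ^m`: points of `ℝ^m` for some
contracted ends, degenerated cross-ratios, and points and multi lines in `ℝ²` for some ends. -/
structure Incidence (L : Type) (m : ℕ) where
  points : List (L × (Fin m → ℝ))
  crossRatios : List (Fin 4 → L)
  tangentPoints : List (L × (Fin 2 → ℝ))
  tangentLines : List (L × MultiLine)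

section Pullback

variable {V : Type}

/-- Functions `max(ev_j - a_j, 0)` that cut out the pull-back of the point `a` along `ev`. -/
noncomputable def pullPoint {m : ℕ} (ev : V → Fin m → ℝ) (a : Fin m → ℝ) : List (MaxFun V) :=
  List.ofFn fun j => ⟨1, ![fun x => ev x j - a j, fun _ => 0]⟩

/-- The function `ω · max(ev_0 - a_0, ev_1 - a_1, 0)` that cuts out the pull-back along `ev` of the
multi line of weight `ω` with vertex `a`. -/
noncomputable def pullLine (ev : V → Fin 2 → ℝ) (M : MultiLine) : MaxFun V :=
  ⟨2, ![fun x => M.weight * (ev x 0 - M.vertex 0), fun x => M.weight * (ev x 1 - M.vertex 1),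
    fun _ => 0]⟩

variable {L : Type} {m : ℕ}

/-- The function that cuts out `ft_q^*(0)`. On `M_{0,4}` the double ratio is the projection
to `ℝ` which contracts the ray `(q₀q₁|q₂q₃)` and is `±` the length on the two other rays, and
`max(·, 0)` cuts out the origin with weight one. -/
noncomputable def pullCrossRatio (q : Fin 4 → L) : MaxFun (RatioSpace L × (Fin m → ℝ)) :=
  ⟨1, ![fun x => x.1 q, fun _ => 0]⟩

/-- The list of functions that cut out given conditions, where `ev k` is the evaluation at the
end `k` and `dev k` is the evaluation for the conditions in `ℝ²`. -/
noncomputable def conditionFuns (ev : L → RatioSpace L × (Fin m → ℝ) → Fin m → ℝ)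
    (dev : L → RatioSpace L × (Fin m → ℝ) → Fin 2 → ℝ) (I : Incidence L m) :
    List (MaxFun (RatioSpace L × (Fin m → ℝ))) :=
  I.points.flatMap (fun c => pullPoint (ev c.1) c.2) ++ I.crossRatios.map pullCrossRatio ++
    I.tangentPoints.flatMap (fun c => pullPoint (dev c.1) c.2) ++
    I.tangentLines.map (fun c => pullLine (dev c.1) c.2)

variable [Fintype L]

/-- Conditions on space curves: the tangency conditions are pulled back along
`∂ev_k = π ∘ ev_k`. -/
noncomputable def spaceFuns (v : L → Fin 3 → ℤ) (b : L) (I : Incidence L 3) :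
    List (MaxFun (RatioSpace L × (Fin 3 → ℝ))) :=
  conditionFuns (evalEnd v b) (fun k x => dropLast (evalEnd v b k x)) I

/-- Conditions on plane curves: all conditions are pulled back along `ev_k`. -/
noncomputable def planeFuns (v : L → Fin 2 → ℤ) (b : L) (I : Incidence L 2) :
    List (MaxFun (RatioSpace L × (Fin 2 → ℝ))) :=
  conditionFuns (evalEnd v b) (evalEnd v b) I

/-- Multiplicity of a point in an intersection product in the moduli space of stable maps. -/
noncomputable def moduliMult (fs : List (MaxFun (RatioSpace L × (Fin m → ℝ)))) :
    RatioSpace L × (Fin m → ℝ) → ℝ :=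
  pointMult (moduliLattice L m) (moduliFan L m) (moduliDim L m) fs

/-- Degree of an intersection product in the moduli space of stable maps. -/
noncomputable def moduliDegree (fs : List (MaxFun (RatioSpace L × (Fin m → ℝ)))) : ℝ :=
  productDegree (moduliLattice L m) (moduliFan L m) (moduliDim L m) fs

/-- General position: the number of functions `fs` that cut out the conditions is the dimension of
the moduli space, and their intersection product is a nonzero
cycle that lies inside top-dimensional cells of the product `X` of the functions `crs` alone,
which cut out the cross-ratio conditions. -/
def GeneralPosition (crs fs : List (MaxFun (RatioSpace L × (Fin m → ℝ)))) : Prop :=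
  Fintype.card L + m = fs.length + 3 ∧ (∃ x, moduliMult fs x ≠ 0) ∧
  ∀ x, moduliMult fs x ≠ 0 → ∃ σ ∈ subdivide (moduliFan L m) crs,
    productWeight (moduliLattice L m) (moduliFan L m) (moduliDim L m) crs crs σ ≠ 0 ∧ x ∈ σ ∧
    ∀ τ ∈ subdivide (moduliFan L m) crs, x ∈ τ → σ ⊆ τ

/-- General position of conditions on space curves. -/
def SpaceGeneral (v : L → Fin 3 → ℤ) (b : L) (I : Incidence L 3) : Prop :=
  GeneralPosition (I.crossRatios.map pullCrossRatio) (spaceFuns v b I)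

/-- General position of conditions on plane curves. -/
def PlaneGeneral (v : L → Fin 2 → ℤ) (b : L) (I : Incidence L 2) : Prop :=
  GeneralPosition (I.crossRatios.map pullCrossRatio) (planeFuns v b I)

end Pullback

/-- The conditions on plane curves that are obtained from conditions on space curves by projecting
the points. -/
def Incidence.plane {L : Type} (I : Incidence L 3) : Incidence L 2 where
  points := I.points.map fun c => (c.1, dropLast c.2)
  crossRatios := I.crossRatios
  tangentPoints := I.tangentPoints
  tangentLines := I.tangentLines

/-! ### Degrees and conditions for space curves -/

/-- The multiset `Δ³_d(α, β)`. -/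
noncomputable def spaceDegree (d : ℕ) (α β : ℕ+ →₀ ℕ) : Multiset (Fin 3 → ℤ) :=
  Multiset.replicate d ![1, 1, 1] + Multiset.replicate d ![-1, 0, 0] +
    Multiset.replicate d ![0, -1, 0] +
    (α.sum fun w c => Multiset.replicate c ![0, 0, -((w : ℕ) : ℤ)]) +
    (β.sum fun w c => Multiset.replicate c ![0, 0, ((w : ℕ) : ℤ)])

/-- A degree `Δ³_d(α, β)` whose entries are labeled by `E`. -/
structure LabeledDegree (E : Type) [Fintype E] where
  d : ℕ
  α : ℕ+ →₀ ℕ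
  β : ℕ+ →₀ ℕ
  sum_zero : (d : ℤ) - (α.sum fun w c => ((w : ℕ) : ℤ) * (c : ℤ)) +
    (β.sum fun w c => ((w : ℕ) : ℤ) * (c : ℤ)) = 0
  dir : E → Fin 3 → ℤ
  dir_eq : Finset.univ.val.map dir = spaceDegree d α β

namespace LabeledDegree

variable {E : Type} [Fintype E] (D : LabeledDegree E)

/-- The end `e` is one of the ends `α`, of primitive direction `(0,0,-1)`. -/
def IsAlpha (e : E) : Prop := D.dir e 0 = 0 ∧ D.dir e 1 = 0 ∧ D.dir e 2 < 0

/-- The end `e` is one of the ends `β`, of primitive direction `(0,0,1)`. -/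
def IsBeta (e : E) : Prop := D.dir e 0 = 0 ∧ D.dir e 1 = 0 ∧ 0 < D.dir e 2

/-- The end `e` is of primitive direction `(0,0,±1)`. -/
def IsVertical (e : E) : Prop := D.IsAlpha e ∨ D.IsBeta e

/-- The end `e` is of direction `(1,1,1)`. -/
def IsDiagonal (e : E) : Prop := D.dir e = ![1, 1, 1]

end LabeledDegree

/-- Conditions on stable maps of degree `D` with contracted ends labeled by `Fin n`: points `p`,
codimension two tangency conditions `line e` for `e ∈ κ`, codimension one tangency conditions
`pt e` for `e ∈ η`, and degenerated cross-ratios `cr j`, given by an enumeration of the four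
labels. (The values of `line` and `pt` at other ends are not used.) -/
structure Conditions {E : Type} [Fintype E] (D : LabeledDegree E) (n l : ℕ) where
  p : Fin n → Fin 3 → ℝ
  κ : Finset E
  η : Finset E
  disj : Disjoint κ η
  κ_vertical : ∀ e ∈ κ, D.IsVertical e
  η_vertical : ∀ e ∈ η, D.IsVertical e
  line : E → MultiLine
  pt : E → Fin 2 → ℝ
  cr : Fin l → Fin 4 → Fin n ⊕ E
  cr_injective : ∀ j, Function.Injective (cr j)
  cr_vertical : ∀ j t e, cr j t = Sum.inr e → D.IsVertical e

namespace Conditions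

variable {E : Type} [Fintype E] {D : LabeledDegree E} {n l : ℕ} (S : Conditions D n l)

/-- Directions of the ends: those labeled by `Fin n` are contracted. -/
def endDir (_ : Conditions D n l) : Fin n ⊕ E → Fin 3 → ℤ := Sum.elim (fun _ => 0) D.dir

/-- The conditions as a list. -/
noncomputable def incidence : Incidence (Fin n ⊕ E) 3 where
  points := List.ofFn fun i => (Sum.inl i, S.p i)
  crossRatios := List.ofFn S.cr
  tangentPoints := S.η.toList.map fun e => (Sum.inr e, S.pt e)
  tangentLines := S.κ.toList.map fun e => (Sum.inr e, S.line e)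

/-- The conditions are in general position. -/
def InGeneralPosition [NeZero n] : Prop := SpaceGeneral S.endDir (Sum.inl 0) S.incidence

end Conditions

/-! ### Cross-ratio floor diagrams -/

section PathCriterion

variable {n : ℕ}

/-- The vertex `x` lies on the path from `a` to `c`. -/
def OnPath (G : SimpleGraph (Fin n)) (a c x : Fin n) : Prop :=
  ∃ w : G.Walk a c, w.IsPath ∧ x ∈ w.support

/-- The path criterion at the vertex `x` for four (not necessarily distinct) vertices. -/
def PathCriterion (G : SimpleGraph (Fin n)) (ε : Fin 4 → Fin n) (x : Fin n) : Prop :=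
  ∀ s : Equiv.Perm (Fin 4),
    {y | OnPath G (ε (s 0)) (ε (s 1)) y ∧ OnPath G (ε (s 2)) (ε (s 3)) y} = {x}

end PathCriterion

section Floor

variable {E : Type} [Fintype E] {D : LabeledDegree E} {n l : ℕ}

/-- The vertex `v_i` of a floor diagram that is associated to a label, if `home e` is the vertex
to which the end `e` belongs. -/
def labelVertex (home : E → Fin n) : Fin n ⊕ E → Fin n := Sum.elim id home

open Classical in
/-- The number `A(v_i)`. -/
noncomputable def floorLeak (S : Conditions D n l) (G : SimpleGraph (Fin n)) (home : E → Fin n)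
    (i : Fin n) : ℤ :=
  3 * ((Finset.univ.filter fun e => home e = i ∧ D.IsDiagonal e).card : ℤ)
    + ((Finset.univ.filter fun e => home e = i ∧ D.IsAlpha e).card : ℤ)
    + ((Finset.univ.filter fun e => home e = i ∧ D.IsBeta e).card : ℤ)
    + ((Finset.univ.filter fun k => G.Adj i k).card : ℤ) - 2
    - ((Finset.univ.filter fun j => PathCriterion G (fun t => labelVertex home (S.cr j t)) i).card : ℤ)
    - 2 * ((Finset.univ.filter fun e => home e = i ∧ e ∈ S.η).card : ℤ)
    - ((Finset.univ.filter fun e => home e = i ∧ e ∈ S.κ).card : ℤ)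

open Classical in
/-- A cross-ratio floor diagram that satisfies the conditions `S`: a tree on the ordered vertices
`v_0 < … < v_{n-1}`. The end `e` belongs to `δ_{v_i}` if `home e = i`, and `flow a c` is the flow
on the half-edge of the edge between `a` and `c` that is incoming at `c`. -/
structure FloorDiagram (S : Conditions D n l) where
  G : SimpleGraph (Fin n)
  isTree : G.IsTree
  home : E → Fin n
  weight : Sym2 (Fin n) → ℕ
  weight_pos : ∀ e ∈ G.edgeSet, 0 < weight e
  balanced : ∀ i, ((Finset.univ.filter fun e => home e = i ∧ D.IsDiagonal e).card : ℤ)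
    + (∑ e with home e = i ∧ D.IsVertical e, D.dir e 2)
    + (∑ k with G.Adj i k ∧ i < k, (weight s(i, k) : ℤ))
    - (∑ k with G.Adj i k ∧ k < i, (weight s(i, k) : ℤ)) = 0
  crossRatio : ∀ j, ∃ i, PathCriterion G (fun t => labelVertex home (S.cr j t)) i
  flow : Fin n → Fin n → ℕ
  flow_edge : ∀ a c, G.Adj a c → flow a c + flow c a = 2
  flow_vertex : ∀ i, ((∑ k with G.Adj i k, flow k i : ℕ) : ℤ) =
    if ∃ e, home e = i ∧ D.IsDiagonal e then floorLeak S G home i else 0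

namespace FloorDiagram

variable {S : Conditions D n l} (F : FloorDiagram S)

open Classical in
/-- The number of ends of direction `(1,1,1)` in `δ_{v_i}`. -/
noncomputable def size (i : Fin n) : ℕ :=
  (Finset.univ.filter fun e => F.home e = i ∧ D.IsDiagonal e).card

/-- The labels of the ends of stable maps to `ℝ³` that are counted by the multiplicity of `v_i`:
the contracted end `x_i`, the ends of direction parallel to `(0,0,1)` in `δ_{v_i}`, the ends that
arise from cutting the edges at `v_i`, and `size` many ends of each of
the directions `(1,1,1)`, `(-1,0,0)`, `(0,-1,0)`. -/
inductive LocalLabel (F : FloorDiagram S) (i : Fin n) : Type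
  | point : LocalLabel F i
  | vert (e : E) (h : F.home e = i ∧ D.IsVertical e) : LocalLabel F i
  | cut (k : Fin n) (h : F.G.Adj i k) : LocalLabel F i
  | std (a : Fin (F.size i)) (c : Fin 3) : LocalLabel F i

noncomputable instance (i : Fin n) : Fintype (F.LocalLabel i) :=
  Fintype.ofInjective
    (fun x : F.LocalLabel i => match x with
      | .point => (Sum.inl () : Unit ⊕ E ⊕ Fin n ⊕ (Fin (F.size i) × Fin 3))
      | .vert e _ => Sum.inr (Sum.inl e)
      | .cut k _ => Sum.inr (Sum.inr (Sum.inl k))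
      | .std a c => Sum.inr (Sum.inr (Sum.inr (a, c))))
    (by
      intro x y h
      cases x <;> cases y <;> simp_all)

variable (i : Fin n)

open Classical in
/-- Directions of the local ends: the degree `Δ³_{size}(α^i, β^i)`. An edge from `v_i`
to a greater (smaller) vertex is cut to an end of `β^i` (of `α^i`) of the same weight. -/
noncomputable def localDir : F.LocalLabel i → Fin 3 → ℤ
  | .point => 0
  | .vert e _ => D.dir e
  | .cut k _ => if i < k then ![0, 0, (F.weight s(i, k) : ℤ)] else ![0, 0, -(F.weight s(i, k) : ℤ)]
  | .std _ c => (![![1, 1, 1], ![-1, 0, 0], ![0, -1, 0]] : Fin 3 → Fin 3 → ℤ) c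

/-- Labels in `η_i`: the ends with a codimension one tangency condition, and the
`2/0` edges whose half-edge incoming at `v_i` has flow two. -/
def IsEta : F.LocalLabel i → Prop
  | .vert e _ => e ∈ S.η
  | .cut k _ => F.flow k i = 2
  | _ => False

/-- Labels in `κ_i`: the ends with a codimension two tangency condition, and the `1/1` edges. -/
def IsKappa : F.LocalLabel i → Prop
  | .vert e _ => e ∈ S.κ
  | .cut k _ => F.flow k i = 1
  | _ => False

/-- The points of the codimension one tangency conditions; `P k` is the point for the end that
arises from cutting the edge between `v_i` and `v_k`. -/
def localPoint (P : Fin n → Fin 2 → ℝ) : F.LocalLabel i → Fin 2 → ℝ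
  | .vert e _ => S.pt e
  | .cut k _ => P k
  | _ => 0

/-- The multi lines of the codimension two tangency conditions; for the end that arises from
cutting the edge between `v_i` and `v_k` this is the line of weight one with vertex `Q k`. -/
def localLine (Q : Fin n → Fin 2 → ℝ) : F.LocalLabel i → MultiLine
  | .vert e _ => S.line e
  | .cut k _ => ⟨Q k, 1, Nat.one_pos⟩
  | _ => ⟨0, 1, Nat.one_pos⟩

/-- The local label of the first edge of the path from `v_i` to another vertex `v_k`. -/
noncomputable def toward (k : Fin n) (h : k ≠ i) : F.LocalLabel i :=
  .cut (F.isTree.existsUnique_path i k).choose.snd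
    ((F.isTree.existsUnique_path i k).choose.adj_snd (SimpleGraph.Walk.not_nil_of_ne h.symm))

open Classical in
/-- Adapted cross-ratio entries: a label belonging to another vertex is replaced by the
end that arises from cutting the edge at `v_i` through which the path to that vertex passes. -/
noncomputable def adapt (x : Fin n ⊕ E) (hx : ∀ e, x = Sum.inr e → D.IsVertical e) :
    F.LocalLabel i :=
  match x, hx with
  | Sum.inl k, _ => if h : k = i then .point else F.toward i k h
  | Sum.inr e, hx => if h : F.home e = i then .vert e ⟨h, hx e rfl⟩ else F.toward i (F.home e) h

open Classical in
/-- The cross-ratios that are satisfied at `v_i`. -/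
noncomputable def localRatios : Finset (Fin l) :=
  Finset.univ.filter fun j => PathCriterion F.G (fun t => labelVertex F.home (S.cr j t)) i

open Classical in
/-- The conditions that enter into the multiplicity of the vertex `v_i`. -/
noncomputable def localIncidence (P Q : Fin n → Fin 2 → ℝ) : Incidence (F.LocalLabel i) 3 where
  points := [(.point, S.p i)]
  crossRatios := (F.localRatios i).toList.map fun j t => F.adapt i (S.cr j t) (S.cr_vertical j t)
  tangentPoints := (Finset.univ.filter (F.IsEta i)).toList.map fun x => (x, F.localPoint i P x)
  tangentLines := (Finset.univ.filter (F.IsKappa i)).toList.map fun x => (x, F.localLine i Q x)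

/-- Directions of the ends of the projected degree. -/
noncomputable def planeDir (x : F.LocalLabel i) : Fin 2 → ℤ := dropLast (F.localDir i x)

/-- The multiplicity of the vertex `v_i`, for positions `P k` of the codimension one and vertices
`Q k` of the codimension two tangency conditions at the ends that arise from cutting edges. -/
noncomputable def vertexMult (P Q : Fin n → Fin 2 → ℝ) : ℝ :=
  moduliDegree (spaceFuns (F.localDir i) .point (F.localIncidence i P Q))

/-- The multiplicity of a stable map to `ℝ³` in the count `vertexMult`
(zero if the map does not contribute). -/
noncomputable def spaceMult (P Q : Fin n → Fin 2 → ℝ) (C : StableMap (F.localDir i)) : ℝ :=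
  moduliMult (spaceFuns (F.localDir i) .point (F.localIncidence i P Q)) (C.point .point)

/-- The degree of the intersection product of the projected conditions in the moduli space of plane
tropical stable maps of the projected degree. -/
noncomputable def planeDegree (P Q : Fin n → Fin 2 → ℝ) : ℝ :=
  moduliDegree (planeFuns (F.planeDir i) .point (F.localIncidence i P Q).plane)

/-- The multiplicity of a stable map to `ℝ²` in that intersection product. -/
noncomputable def planeMult (P Q : Fin n → Fin 2 → ℝ) (C : StableMap (F.planeDir i)) : ℝ :=
  moduliMult (planeFuns (F.planeDir i) .point (F.localIncidence i P Q).plane) (C.point .point)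

/-- The plane stable map obtained by projecting a stable map to `ℝ³`. -/
noncomputable def project {i : Fin n} (C : StableMap (F.localDir i)) : StableMap (F.planeDir i) :=
  C.proj

end FloorDiagram

end Floor

/-! ### Complexes with convex cells that meet along faces -/

namespace MaxFun

variable {V W : Type}

/-! Recording a stable map to ℝ³ by the image of its fixed contracted end identifies the moduli
space with (moduli space of plane maps) × ℝ, where the last factor is the height of that end
(`spaceEquiv`). Fan and lattice respect this splitting. Every condition except one is pulled back
from the first factor: cross-ratios see only the abstract curve, tangency conditions are pulled back
along π ∘ ev, and so are the first two coordinates of the point condition. The remaining function is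
`max(t - c, 0)`, with t the height and c the height of the point. Hence the product in space is the
plane product placed at height c, with the same multiplicities (`pointMult_level`,
`moduliMult_spaceFuns`). Equality of degrees and the descent of general position follow.

The product formula is proved one divisor at a time on the subdivided complex. Before the level
function is used, the cells over both half-lines carry the plane weights; the level function moves
these weights to height c; afterwards only the slice at height c matters. Normal vectors are chosen
representatives, so the divisors of the two complexes can be compared only once normal vectors are
known to be unique modulo the span of the facet. This requires cells to be convex and to meet along
faces (`IsFaceComplex.sub_mem_of_isNormalVector`).

For the moduli fan the face property is tree combinatorics (`mem_cone_of_combo_mem_cone`): an edge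
of positive length of a curve is visible in the signs of the double ratios, so its split occurs in
every tree whose cone contains the curve.

For the bijection of stable maps, the height function on the vertices is handled separately. Two
lifts of a plane map differ by a function to which the maximum principle applies, so the height of
one end determines the lift (`iso_of_proj_iso`). Conversely, the vertical directions of the ends at
a floor have sum zero, hence integral slopes satisfying balancing exist on the edges, and on a tree
they integrate to heights (`exists_proj_iso`). -/

lemma term_le_eval (f : MaxFun V) (j : Fin (f.k + 1)) (x : V) : f.term j x ≤ f.eval x :=
  Finset.le_sup' (fun j => f.term j x) (Finset.mem_univ j)

lemma exists_term_eq_eval (f : MaxFun V) (x : V) : ∃ j, f.term j x = f.eval x := by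
  obtain ⟨j, -, hj⟩ := Finset.exists_mem_eq_sup' ⟨0, Finset.mem_univ 0⟩ fun j => f.term j x
  exact ⟨j, hj.symm⟩

lemma eval_le (f : MaxFun V) {x : V} {a : ℝ} (h : ∀ j, f.term j x ≤ a) : f.eval x ≤ a :=
  Finset.sup'_le _ _ fun j _ => h j

/-- The pull-back of a maximum of functions. -/
def pull (π : W → V) (f : MaxFun V) : MaxFun W := ⟨f.k, fun j w => f.term j (π w)⟩

end MaxFun

section Subdivide

variable {V : Type}

lemma nonempty_of_mem_subdivide {S : Set (Set V)} {fs : List (MaxFun V)} {C : Set V}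
    (hC : C ∈ subdivide S fs) : C.Nonempty := by
  obtain ⟨σ, hσ, x, hx, rfl⟩ := hC
  exact ⟨x, hx, fun f _ j h => h⟩

end Subdivide

/-! ### Affine functions, faces of convex cells, and uniqueness of normal vectors -/

section Affine

variable {V W : Type} [AddCommGroup V] [Module ℝ V] [AddCommGroup W] [Module ℝ W]

/-- A function of the form `linear + constant`. -/
def IsAffineFun (φ : V → ℝ) : Prop := ∃ (ℓ : V →ₗ[ℝ] ℝ) (c : ℝ), ∀ x, φ x = ℓ x + c

/-- All terms of `f` are affine. -/
def MaxFun.IsAffine (f : MaxFun V) : Prop := ∀ j, IsAffineFun (f.term j)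

namespace IsAffineFun

lemma of_linear (ℓ : V →ₗ[ℝ] ℝ) : IsAffineFun (fun x => ℓ x) := ⟨ℓ, 0, fun x => by simp⟩

lemma const (c : ℝ) : IsAffineFun (fun _ : V => c) := ⟨0, c, fun x => by simp⟩

lemma add {φ ψ : V → ℝ} (h : IsAffineFun φ) (h' : IsAffineFun ψ) :
    IsAffineFun (fun x => φ x + ψ x) := by
  obtain ⟨ℓ, c, h⟩ := h
  obtain ⟨ℓ', c', h'⟩ := h'
  exact ⟨ℓ + ℓ', c + c', fun x => by simp [h, h']; ring⟩

lemma const_mul {φ : V → ℝ} (a : ℝ) (h : IsAffineFun φ) : IsAffineFun (fun x => a * φ x) := by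
  obtain ⟨ℓ, c, h⟩ := h
  exact ⟨a • ℓ, a * c, fun x => by simp [h]; ring⟩

lemma sub_const {φ : V → ℝ} (h : IsAffineFun φ) (a : ℝ) : IsAffineFun (fun x => φ x - a) := by
  simpa [sub_eq_add_neg] using h.add (const (-a))

lemma combo {φ : V → ℝ} (h : IsAffineFun φ) {a b : ℝ} (hab : a + b = 1) (x y : V) :
    φ (a • x + b • y) = a * φ x + b * φ y := by
  obtain ⟨ℓ, c, h⟩ := h
  simp only [h, map_add, map_smul, smul_eq_mul]
  linear_combination (-c) * hab

end IsAffineFun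

/-- The cells of `S` are convex and the intersection of any two of them is an extreme subset
of each. -/
def IsFaceComplex (S : Set (Set V)) : Prop :=
  (∀ σ ∈ S, Convex ℝ σ) ∧ ∀ σ ∈ S, ∀ σ' ∈ S, ∀ y ∈ σ', ∀ z ∈ σ', ∀ a b : ℝ, 0 < a → 0 < b →
    a + b = 1 → a • y + b • z ∈ σ → y ∈ σ

/-- A term that is maximal at the point defining the cell is maximal on the whole cell, so it
represents the function there. -/
lemma exists_affineFun_of_mem_subdivide {S : Set (Set V)} {fs : List (MaxFun V)}
    (hfs : ∀ f ∈ fs, f.IsAffine) {C : Set V} (hC : C ∈ subdivide S fs) {f : MaxFun V}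
    (hf : f ∈ fs) : ∃ φ, IsAffineFun φ ∧ ∀ y ∈ C, f.eval y = φ y := by
  obtain ⟨σ, hσ, x, hx, rfl⟩ := hC
  obtain ⟨j, hj⟩ := f.exists_term_eq_eval x
  exact ⟨f.term j, hfs f hf j, fun y hy => (hy.2 f hf j hj).symm⟩

/-- Convexity: a term maximal at both end points of a segment dominates every other affine term in
between. Extremality: on a segment inside a cell the maximum is affine, so a term that never exceeds
it and equals it at an interior point equals it at the end points. -/
lemma IsFaceComplex.subdivide {S : Set (Set V)} (hS : IsFaceComplex S) {fs : List (MaxFun V)}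
    (hfs : ∀ f ∈ fs, f.IsAffine) : IsFaceComplex (subdivide S fs) := by
  constructor
  · rintro _ ⟨σ, hσ, x, hx, rfl⟩ y hy z hz a b ha hb hab
    refine ⟨hS.1 σ hσ hy.1 hz.1 ha hb hab, fun f hf j hj => le_antisymm (f.term_le_eval _ _) ?_⟩
    refine f.eval_le fun i => ?_
    rw [(hfs f hf i).combo hab, (hfs f hf j).combo hab, hy.2 f hf j hj, hz.2 f hf j hj]
    exact add_le_add (mul_le_mul_of_nonneg_left (f.term_le_eval _ _) ha)
      (mul_le_mul_of_nonneg_left (f.term_le_eval _ _) hb)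
  · rintro C ⟨σ, hσ, x, hx, rfl⟩ C' hC' y hy z hz a b ha hb hab hw
    have hC'' := hC'
    obtain ⟨σ', hσ', x', hx', rfl⟩ := hC'
    refine ⟨hS.2 σ hσ σ' hσ' y hy.1 z hz.1 a b ha hb hab hw.1, fun f hf j hj => ?_⟩
    have h1 := hw.2 f hf j hj
    obtain ⟨i, hi⟩ := f.exists_term_eq_eval x'
    have hwσ : f.term i (a • y + b • z) = a * f.eval y + b * f.eval z := by
      rw [(hfs f hf i).combo hab, hy.2 f hf i hi, hz.2 f hf i hi]
    have h3 := f.term_le_eval i (a • y + b • z)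
    rw [hwσ, ← h1, (hfs f hf j).combo hab] at h3
    have h4 := f.term_le_eval j y
    have h5 := f.term_le_eval j z
    nlinarith

/-- For convex `C` the positive multiples of differences already form a subspace: a sum of two of
them is `r + q` times the difference of two convex combinations. -/
lemma mem_vectorSpan_convex {C : Set V} (hC : Convex ℝ C) (hne : C.Nonempty) {s : V}
    (hs : s ∈ vectorSpan ℝ C) : ∃ c ∈ C, ∃ c' ∈ C, ∃ r : ℝ, 0 < r ∧ s = r • (c - c') := by
  obtain ⟨c₀, hc₀⟩ := hne
  refine Submodule.span_induction
    (p := fun s _ => ∃ c ∈ C, ∃ c' ∈ C, ∃ r : ℝ, 0 < r ∧ s = r • (c - c')) ?_ ?_ ?_ ?_ hs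
  · rintro _ ⟨c, hc, c', hc', rfl⟩
    exact ⟨c, hc, c', hc', 1, one_pos, by simp⟩
  · exact ⟨c₀, hc₀, c₀, hc₀, 1, one_pos, by simp⟩
  · rintro x y - - ⟨c, hc, c', hc', r, hr, rfl⟩ ⟨d, hd, d', hd', q, hq, rfl⟩
    have hrq : 0 < r + q := by positivity
    refine ⟨(r / (r + q)) • c + (q / (r + q)) • d, hC hc hd (by positivity) (by positivity)
      (by field_simp), (r / (r + q)) • c' + (q / (r + q)) • d', hC hc' hd' (by positivity)
      (by positivity) (by field_simp), r + q, hrq, ?_⟩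
    have h1 : (r + q) * (r / (r + q)) = r := by field_simp
    have h2 : (r + q) * (q / (r + q)) = q := by field_simp
    simp only [smul_sub, smul_add, smul_smul, h1, h2]
    abel
  · rintro a x - ⟨c, hc, c', hc', r, hr, rfl⟩
    rcases lt_trichotomy a 0 with ha | rfl | ha
    · refine ⟨c', hc', c, hc, -a * r, mul_pos (by linarith) hr, ?_⟩
      module
    · exact ⟨c₀, hc₀, c₀, hc₀, 1, one_pos, by simp⟩
    · exact ⟨c, hc, c', hc', a * r, mul_pos ha hr, by rw [smul_smul]⟩

/-- Write the given vector of the span as `r • (c₁ - c₂)`. Moving `c₂` to the other side exhibits a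
point of `C` as a convex combination, with positive weight at `y`, of `y` and a point of `C'`;
extremality of `C` then gives `y ∈ C`. -/
lemma IsFaceComplex.mem_of_combo_sub_mem {S : Set (Set V)} (hS : IsFaceComplex S) {C C' : Set V}
    (hC : C ∈ S) (hC' : C' ∈ S) (hCC' : C ⊆ C') {y z c : V} (hy : y ∈ C') (hz : z ∈ C')
    (hc : c ∈ C) {a b : ℝ} (ha : 0 < a) (hb : 0 ≤ b)
    (h : a • y + b • z - (a + b) • c ∈ vectorSpan ℝ C) : y ∈ C := by
  obtain ⟨c₁, hc₁, c₂, hc₂, r, hr, hs⟩ := mem_vectorSpan_convex (hS.1 C hC) ⟨c, hc⟩ h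
  have hbr : 0 < b + r := by positivity
  have habr : 0 < a + b + r := by positivity
  have hz' : (b / (b + r)) • z + (r / (b + r)) • c₂ ∈ C' :=
    hS.1 C' hC' hz (hCC' hc₂) (by positivity) (by positivity) (by field_simp)
  refine hS.2 C hC C' hC' y hy _ hz' (a / (a + b + r)) ((b + r) / (a + b + r)) (by positivity)
    (by positivity) (by field_simp; ring) ?_
  have key : (a / (a + b + r)) • y + ((b + r) / (a + b + r)) • ((b / (b + r)) • z +
      (r / (b + r)) • c₂) = ((a + b) / (a + b + r)) • c + (r / (a + b + r)) • c₁ := by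
    have h1 : a • y + b • z + r • c₂ = (a + b) • c + r • c₁ := by
      rw [smul_sub] at hs
      have : a • y + b • z = r • c₁ - r • c₂ + (a + b) • c := by rw [← hs]; abel
      rw [this]; abel
    have e1 : ((b + r) / (a + b + r)) * (b / (b + r)) = b / (a + b + r) := by field_simp
    have e2 : ((b + r) / (a + b + r)) * (r / (b + r)) = r / (a + b + r) := by field_simp
    have h2 := congrArg (fun v => (a + b + r)⁻¹ • v) h1
    simp only [smul_add, smul_smul] at h2
    simp only [smul_add, smul_smul, e1, e2]
    simp only [div_eq_inv_mul]
    rw [← add_assoc]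
    convert h2 using 2
  rw [key]
  exact hS.1 C hC hc hc₁ (by positivity) (by positivity) (by field_simp)

/-- Equal dimension forces equal spans, so each `y - c` lies in the span of the smaller cell and the
preceding lemma applies with `b = 0`. -/
lemma IsFaceComplex.eq_of_subset_of_polyDim_eq [FiniteDimensional ℝ V] {S : Set (Set V)}
    (hS : IsFaceComplex S) {C C' : Set V} (hC : C ∈ S) (hC' : C' ∈ S) (hne : C.Nonempty)
    (hCC' : C ⊆ C') (hdim : polyDim C = polyDim C') : C = C' := by
  refine hCC'.antisymm fun y hy => ?_
  obtain ⟨c, hc⟩ := hne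
  have hspan : vectorSpan ℝ C = vectorSpan ℝ C' :=
    Submodule.eq_of_le_of_finrank_eq (vectorSpan_mono ℝ hCC') hdim
  refine hS.mem_of_combo_sub_mem hC hC' hCC' hy hy hc one_pos le_rfl ?_
  rw [hspan]
  simpa using vsub_mem_vectorSpan ℝ hy (hCC' hc)

/-- Normal vectors are unique modulo the span of the facet. -/
lemma IsFaceComplex.sub_mem_of_isNormalVector {S : Set (Set V)} (hS : IsFaceComplex S)
    {Λ : AddSubgroup V} {C C' : Set V} (hC : C ∈ S) (hC' : C' ∈ S) (hCC' : C ⊆ C') {u u' : V}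
    (hu : IsNormalVector Λ C C' u) (hu' : IsNormalVector Λ C C' u') :
    u - u' ∈ vectorSpan ℝ C := by
  obtain ⟨hΛ, hsp, hgen, x, hx, ε, hε, hxε⟩ := hu
  obtain ⟨hΛ', hsp', hgen', x', hx', ε', hε', hxε'⟩ := hu'
  obtain ⟨a, ha⟩ := hgen u' hΛ' hsp'
  obtain ⟨b, hb⟩ := hgen' u hΛ hsp
  set T := vectorSpan ℝ C
  by_cases hT : u ∈ T
  · have : u' ∈ T := by
      have := T.add_mem ha (T.smul_of_tower_mem a hT)
      simpa using this
    exact T.sub_mem hT this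
  -- Modulo the span `T`, each of `u`, `u'` is an integral multiple of the other; since `u ∉ T`, the
  -- two factors are inverse integers, hence both 1 or both -1.
  have hab : (1 - (b * a : ℤ) : ℝ) • u ∈ T := by
    have h1 := T.add_mem hb (T.smul_of_tower_mem b ha)
    have h2 : u - b • u' + b • (u' - a • u) = (1 - (b * a : ℤ) : ℝ) • u := by
      rw [sub_smul, one_smul, Int.cast_smul_eq_zsmul, smul_sub, smul_smul]
      abel
    rwa [h2] at h1
  have hab1 : b * a = 1 := by
    by_contra hne
    have h0 : (1 - (b * a : ℤ) : ℝ) ≠ 0 := by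
      intro h
      apply hne
      have : ((b * a : ℤ) : ℝ) = 1 := by linarith
      exact_mod_cast this
    exact hT ((T.smul_mem_iff h0).1 hab)
  rcases Int.mul_eq_one_iff_eq_one_or_neg_one.1 hab1 with ⟨-, rfl⟩ | ⟨-, rfl⟩
  · simpa using T.neg_mem ha
  -- Opposite directions cannot both point into `C'`: if `u' ≡ -u`, a positive combination of `x + ε
  -- • u` and `x' + ε' • u'` returns to `C` modulo its span. Hence `x + ε • u` lies in `C`, and `u`
  -- in its span.
  · exfalso
    apply hT
    have hs : u' + u ∈ T := by simpa using ha
    have hpos : 0 < ε + ε' := by positivity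
    have hc : (ε' / (ε' + ε)) • x + (ε / (ε' + ε)) • x' ∈ C :=
      hS.1 C hC hx hx' (by positivity) (by positivity) (by field_simp)
    have hy : x + ε • u ∈ C := by
      refine hS.mem_of_combo_sub_mem hC hC' hCC' hxε hxε' hc hε' hε.le ?_
      have e1 : (ε' + ε) * (ε' / (ε' + ε)) = ε' := by field_simp
      have e2 : (ε' + ε) * (ε / (ε' + ε)) = ε := by field_simp
      have : ε' • (x + ε • u) + ε • (x' + ε' • u') - (ε' + ε) •
          ((ε' / (ε' + ε)) • x + (ε / (ε' + ε)) • x') = (ε * ε') • (u' + u) := by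
        simp only [smul_add, smul_smul, e1, e2]
        rw [mul_comm ε' ε]
        abel
      rw [this]
      exact T.smul_mem _ hs
    have := vsub_mem_vectorSpan ℝ hy hx
    rw [vsub_eq_sub, add_sub_cancel_left] at this
    exact (T.smul_mem_iff hε.ne').1 this

/-- Differences of points of `σ` generate its span, so the choice in `linearPart` is irrelevant
there. -/
lemma linearPart_apply {φ : V → ℝ} {σ : Set V} {ℓ : V →ₗ[ℝ] ℝ}
    (h : ∀ x ∈ σ, ∀ y ∈ σ, φ y - φ x = ℓ (y - x)) {u : V} (hu : u ∈ vectorSpan ℝ σ) :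
    linearPart φ σ u = ℓ u := by
  have hex : ∃ ℓ : V →ₗ[ℝ] ℝ, ∀ x ∈ σ, ∀ y ∈ σ, φ y - φ x = ℓ (y - x) := ⟨ℓ, h⟩
  rw [linearPart, dif_pos hex]
  have hs := hex.choose_spec
  generalize hex.choose = ℓ' at hs
  refine Submodule.span_induction (p := fun u _ => ℓ' u = ℓ u) ?_ ?_ ?_ ?_ hu
  · rintro _ ⟨y, hy, x, hx, rfl⟩
    exact (hs x hx y hy).symm.trans (h x hx y hy)
  · simp
  · intro x y _ _ hx hy
    simp [hx, hy]
  · intro a x _ hx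
    simp [hx]

lemma isNormalVector_normalVector {Λ : AddSubgroup V} {τ σ : Set V}
    (h : ∃ u, IsNormalVector Λ τ σ u) : IsNormalVector Λ τ σ (normalVector Λ τ σ) := by
  rw [normalVector, dif_pos h]
  exact h.choose_spec

lemma normalVector_mem {Λ : AddSubgroup V} {τ σ : Set V} :
    normalVector Λ τ σ ∈ vectorSpan ℝ σ := by
  by_cases h : ∃ u, IsNormalVector Λ τ σ u
  · exact (isNormalVector_normalVector h).2.1
  · rw [normalVector, dif_neg h]
    exact Submodule.zero_mem _

end Affine

section SubdivideFinite

variable {V : Type}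

/-- A cell is determined by `σ` and by the set of pairs (function, term) that are maximal at its
defining point. -/
lemma finite_subdivide {S : Set (Set V)} (hS : S.Finite) (fs : List (MaxFun V)) :
    (subdivide S fs).Finite := by
  let I := Σ i : Fin fs.length, Fin ((fs.get i).k + 1)
  let F : Set V × Set I → Set V := fun p =>
    {y | y ∈ p.1 ∧ ∀ i : I, i ∈ p.2 → (fs.get i.1).term i.2 y = (fs.get i.1).eval y}
  refine ((hS.prod (Set.finite_univ (α := Set I))).image F).subset ?_
  rintro C ⟨σ, hσ, x, hx, rfl⟩
  refine ⟨(σ, {i | (fs.get i.1).term i.2 x = (fs.get i.1).eval x}), ⟨hσ, Set.mem_univ _⟩, ?_⟩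
  ext y
  simp only [F, Set.mem_ofPred_eq]
  refine and_congr_right fun _ => ⟨fun h f hf j hj => ?_, fun h i hi => h _ (List.get_mem _ _) _ hi⟩
  obtain ⟨i, rfl⟩ := List.mem_iff_get.1 hf
  exact h ⟨i, j⟩ hj

end SubdivideFinite

/-! ### Divisors on products with a line -/

section Divisor

variable {V : Type} [AddCommGroup V] [Module ℝ V]

lemma divisorWeight_eq_zero_of_weight_eq_zero (Λ : AddSubgroup V) {𝒞 : Set (Set V)}
    {ω : Set V → ℝ} (φ : V → ℝ) {τ : Set V} (h : ∀ σ ∈ cofaces 𝒞 τ, ω σ = 0) :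
    divisorWeight Λ 𝒞 ω φ τ = 0 := by
  have h1 : (∑ᶠ σ ∈ cofaces 𝒞 τ, ω σ • normalVector Λ τ σ) = 0 :=
    finsum_mem_eq_zero_of_forall_eq_zero fun σ hσ => by rw [h σ hσ, zero_smul]
  have h2 : (∑ᶠ σ ∈ cofaces 𝒞 τ, ω σ * linearPart φ σ (normalVector Λ τ σ)) = 0 :=
    finsum_mem_eq_zero_of_forall_eq_zero fun σ hσ => by rw [h σ hσ, zero_mul]
  rw [divisorWeight, h1, h2]
  simp

/-- With one linear part for the facet and all its cofaces, the two sums in the weight cancel by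
linearity; the unbalanced case is zero by definition. -/
lemma divisorWeight_eq_zero_of_linear (Λ : AddSubgroup V) {𝒞 : Set (Set V)} (hfin : 𝒞.Finite)
    {ω : Set V → ℝ} {φ : V → ℝ} {τ : Set V} {ℓ : V →ₗ[ℝ] ℝ}
    (hτ : ∀ x ∈ τ, ∀ y ∈ τ, φ y - φ x = ℓ (y - x))
    (h : ∀ σ ∈ cofaces 𝒞 τ, ∀ x ∈ σ, ∀ y ∈ σ, φ y - φ x = ℓ (y - x)) :
    divisorWeight Λ 𝒞 ω φ τ = 0 := by
  have hK : (cofaces 𝒞 τ).Finite := hfin.subset fun σ h => h.1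
  rw [divisorWeight]
  split_ifs with hT
  · rw [linearPart_apply hτ hT, finsum_mem_eq_finite_toFinset_sum _ hK,
      finsum_mem_eq_finite_toFinset_sum _ hK, map_sum, ← Finset.sum_sub_distrib]
    refine Finset.sum_eq_zero fun σ hσ => ?_
    rw [linearPart_apply (h σ (hK.mem_toFinset.1 hσ)) normalVector_mem, map_smul, smul_eq_mul,
      sub_self]
  · rfl

end Divisor

/-! ### Cells of a product with a line: spans and dimensions -/

section Lift

variable {V W : Type} [AddCommGroup V] [Module ℝ V] [AddCommGroup W] [Module ℝ W]
  (e : W ≃ₗ[ℝ] V × ℝ)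

/-- The product `C × J` in a space that is identified with `V × ℝ`. -/
def lift (C : Set V) (J : Set ℝ) : Set W := {w | (e w).1 ∈ C ∧ (e w).2 ∈ J}

/-- The closed half-line that starts at `c` and has direction `s = ±1`. -/
def half (c : ℝ) (s : ℤ) : Set ℝ := {t | 0 ≤ (s : ℝ) * (t - c)}

variable {e}

lemma symm_mem_lift {C : Set V} {J : Set ℝ} {x : V} {t : ℝ} (hx : x ∈ C) (ht : t ∈ J) :
    e.symm (x, t) ∈ lift e C J := by
  simp [lift, hx, ht]

lemma lift_subset_lift {C C' : Set V} {J J' : Set ℝ} (hC : C.Nonempty) (hJ : J.Nonempty) :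
    lift e C J ⊆ lift e C' J' ↔ C ⊆ C' ∧ J ⊆ J' := by
  constructor
  · intro h
    obtain ⟨x, hx⟩ := hC
    obtain ⟨t, ht⟩ := hJ
    refine ⟨fun y hy => ?_, fun q hq => ?_⟩
    · simpa using (h (symm_mem_lift hy ht)).1
    · simpa using (h (symm_mem_lift hx hq)).2
  · rintro ⟨h1, h2⟩ w hw
    exact ⟨h1 hw.1, h2 hw.2⟩

lemma lift_inj {C C' : Set V} {J J' : Set ℝ} (hC : C.Nonempty) (hJ : J.Nonempty)
    (hC' : C'.Nonempty) (hJ' : J'.Nonempty) : lift e C J = lift e C' J' ↔ C = C' ∧ J = J' := by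
  rw [Set.Subset.antisymm_iff, lift_subset_lift hC hJ, lift_subset_lift hC' hJ',
    Set.Subset.antisymm_iff, Set.Subset.antisymm_iff]
  tauto

lemma mem_vectorSpan_lift {C : Set V} {J : Set ℝ} (hC : C.Nonempty) (hJ : J.Nonempty) {w : W} :
    w ∈ vectorSpan ℝ (lift e C J) ↔
      (e w).1 ∈ vectorSpan ℝ C ∧ (e w).2 ∈ vectorSpan ℝ J := by
  constructor
  · intro h
    refine Submodule.span_induction
      (p := fun w _ => (e w).1 ∈ vectorSpan ℝ C ∧ (e w).2 ∈ vectorSpan ℝ J) ?_ ?_ ?_ ?_ h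
    · rintro _ ⟨y, hy, x, hx, rfl⟩
      simp only [vsub_eq_sub, map_sub, Prod.fst_sub, Prod.snd_sub]
      exact ⟨vsub_mem_vectorSpan ℝ hy.1 hx.1, vsub_mem_vectorSpan ℝ hy.2 hx.2⟩
    · simp
    · intro x y _ _ hx hy
      simpa using ⟨add_mem hx.1 hy.1, add_mem hx.2 hy.2⟩
    · intro a x _ hx
      rw [map_smul]
      exact ⟨Submodule.smul_mem _ a hx.1, Submodule.smul_mem _ a hx.2⟩
  · rintro ⟨h1, h2⟩
    obtain ⟨x, hx⟩ := hC
    obtain ⟨t, ht⟩ := hJ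
    have hw : w = e.symm ((e w).1, 0) + e.symm (0, (e w).2) := by
      rw [← map_add]; simp
    rw [hw]
    generalize (e w).1 = v at h1 ⊢
    generalize (e w).2 = s at h2 ⊢
    refine add_mem ?_ ?_
    · have : v ∈ (vectorSpan ℝ (lift e C J)).comap
          ((e.symm : V × ℝ →ₗ[ℝ] W) ∘ₗ LinearMap.inl ℝ V ℝ) := by
        refine (Submodule.span_le (p := (vectorSpan ℝ (lift e C J)).comap
          ((e.symm : V × ℝ →ₗ[ℝ] W) ∘ₗ LinearMap.inl ℝ V ℝ))).2 ?_ h1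
        rintro _ ⟨y, hy, z, hz, rfl⟩
        have := vsub_mem_vectorSpan ℝ (symm_mem_lift (e := e) hy ht) (symm_mem_lift hz ht)
        rw [vsub_eq_sub, ← map_sub] at this
        simpa using this
      simpa using this
    · have : s ∈ (vectorSpan ℝ (lift e C J)).comap
          ((e.symm : V × ℝ →ₗ[ℝ] W) ∘ₗ LinearMap.inr ℝ V ℝ) := by
        refine (Submodule.span_le (p := (vectorSpan ℝ (lift e C J)).comap
          ((e.symm : V × ℝ →ₗ[ℝ] W) ∘ₗ LinearMap.inr ℝ V ℝ))).2 ?_ h2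
        rintro _ ⟨y, hy, z, hz, rfl⟩
        have := vsub_mem_vectorSpan ℝ (symm_mem_lift (e := e) hx hy) (symm_mem_lift hx hz)
        rw [vsub_eq_sub, ← map_sub] at this
        simpa using this
      simpa using this

lemma polyDim_lift [FiniteDimensional ℝ V] {C : Set V} {J : Set ℝ} (hC : C.Nonempty)
    (hJ : J.Nonempty) : polyDim (lift e C J) = polyDim C + polyDim J := by
  let g : vectorSpan ℝ (lift e C J) ≃ₗ[ℝ] vectorSpan ℝ C × vectorSpan ℝ J :=
    { toFun := fun w => (⟨(e w).1, ((mem_vectorSpan_lift hC hJ).1 w.2).1⟩,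
        ⟨(e w).2, ((mem_vectorSpan_lift hC hJ).1 w.2).2⟩)
      map_add' := fun x y => by ext <;> simp
      map_smul' := fun a x => by ext <;> simp
      invFun := fun p => ⟨e.symm (p.1, p.2), (mem_vectorSpan_lift hC hJ).2 (by simp)⟩
      left_inv := fun x => by simp
      right_inv := fun p => by simp }
  rw [polyDim, g.finrank_eq, Module.finrank_prod]
  rfl

lemma polyDim_singleton (c : V) : polyDim ({c} : Set V) = 0 := by
  simp [polyDim]

lemma vectorSpan_eq_top_of_two {J : Set ℝ} {a b : ℝ} (ha : a ∈ J) (hb : b ∈ J) (hab : a ≠ b) :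
    vectorSpan ℝ J = ⊤ := by
  refine Submodule.eq_top_iff'.2 fun x => ?_
  have h := vsub_mem_vectorSpan ℝ ha hb
  have h0 : a - b ≠ 0 := sub_ne_zero.2 hab
  have := Submodule.smul_mem _ (x / (a - b)) h
  simpa [h0] using this

lemma mem_half (c : ℝ) (s : ℤ) : c ∈ half c s := by simp [half]

lemma add_mem_half (c : ℝ) (s : ℤ) : c + s ∈ half c s := by
  simpa [half] using mul_self_nonneg (s : ℝ)

lemma vectorSpan_half (c : ℝ) {s : ℤ} (hs : s ≠ 0) : vectorSpan ℝ (half c s) = ⊤ :=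
  vectorSpan_eq_top_of_two (mem_half c s) (add_mem_half c s) (by simpa using hs)

lemma polyDim_half (c : ℝ) {s : ℤ} (hs : s ≠ 0) : polyDim (half c s) = 1 := by
  rw [polyDim, vectorSpan_half c hs]; simp

lemma half_ne_half (c : ℝ) : half c 1 ≠ half c (-1) := by
  intro h
  have := add_mem_half c 1
  rw [h] at this
  norm_num [half] at this

lemma half_eq_of_subset {c : ℝ} {s s' : ℤ} (hs : s = 1 ∨ s = -1) (hs' : s' = 1 ∨ s' = -1)
    (h : half c s ⊆ half c s') : s' = s := by
  have := h (add_mem_half c s)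
  rcases hs with rfl | rfl <;> rcases hs' with rfl | rfl <;> norm_num [half] at this <;> rfl

lemma not_half_subset_singleton {c : ℝ} {s : ℤ} (hs : s ≠ 0) : ¬ half c s ⊆ {c} := fun h => by
  have := h (add_mem_half c s)
  simp [hs] at this

lemma polyDim_univ_real : polyDim (Set.univ : Set ℝ) = 1 := by
  rw [polyDim, vectorSpan_eq_top_of_two (Set.mem_univ 0) (Set.mem_univ 1) (by norm_num)]; simp

end Lift

/-! ### Normal vectors and divisors of product cells -/

section LiftDivisor

variable {V W : Type} [AddCommGroup V] [Module ℝ V] [AddCommGroup W] [Module ℝ W]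
  {e : W ≃ₗ[ℝ] V × ℝ} {Λ : AddSubgroup V} {Λ' : AddSubgroup W}

/-- `J` contains a segment that realizes any given vector of its span. -/
def IsSlidable (J : Set ℝ) : Prop := ∀ s ∈ vectorSpan ℝ J, ∃ t ∈ J, t + s ∈ J

lemma IsSlidable.nonempty {J : Set ℝ} (hJ : IsSlidable J) : J.Nonempty := by
  obtain ⟨t, ht, -⟩ := hJ 0 (Submodule.zero_mem _)
  exact ⟨t, ht⟩

lemma isSlidable_univ : IsSlidable Set.univ := fun _ _ => ⟨0, trivial, trivial⟩

lemma isSlidable_singleton (c : ℝ) : IsSlidable {c} := by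
  intro s hs
  have : s = 0 := by simpa using hs
  exact ⟨c, rfl, by simp [this]⟩

lemma isSlidable_half (c : ℝ) {s : ℤ} (hs : s = 1 ∨ s = -1) : IsSlidable (half c s) := by
  intro r _
  refine ⟨c + s * |r|, ?_, ?_⟩ <;> rcases hs with rfl | rfl <;> simp [half] <;>
    linarith [neg_abs_le r, le_abs_self r]

/-- The factor `J` is common to facet and cell, so it contributes only an arbitrary integral
component along its span; the generating property and the pointing direction live in `V`. -/
lemma isNormalVector_lift_iff (hΛ : ∀ w, w ∈ Λ' ↔ (e w).1 ∈ Λ ∧ ∃ n : ℤ, (e w).2 = n)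
    {C C' : Set V} (hC : C.Nonempty) (hCC' : C ⊆ C') {J : Set ℝ} (hJ : IsSlidable J) {u : W} :
    IsNormalVector Λ' (lift e C J) (lift e C' J) u ↔
      IsNormalVector Λ C C' (e u).1 ∧ (∃ n : ℤ, (e u).2 = n) ∧ (e u).2 ∈ vectorSpan ℝ J := by
  have hC' := hC.mono hCC'
  simp only [IsNormalVector, hΛ, mem_vectorSpan_lift hC hJ.nonempty,
    mem_vectorSpan_lift hC' hJ.nonempty]
  constructor
  · rintro ⟨⟨h1, h2⟩, ⟨h3, h4⟩, h5, x, hx, ε, hε, hxε⟩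
    refine ⟨⟨h1, h3, fun v hv hv' => ?_, (e x).1, hx.1, ε, hε, ?_⟩, h2, h4⟩
    · obtain ⟨a, ha, -⟩ := h5 (e.symm (v, 0)) (by simpa using ⟨hv, 0, by simp⟩) (by simpa using hv')
      exact ⟨a, by simpa using ha⟩
    · simpa using hxε.1
  · rintro ⟨⟨h1, h3, h5, x, hx, ε, hε, hxε⟩, h2, h4⟩
    refine ⟨⟨h1, h2⟩, ⟨h3, h4⟩, fun w hw hw' => ?_, ?_⟩
    · obtain ⟨a, ha⟩ := h5 _ hw.1 hw'.1
      refine ⟨a, by simpa using ha, ?_⟩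
      have := (vectorSpan ℝ J).sub_mem hw'.2 ((vectorSpan ℝ J).smul_of_tower_mem a h4)
      simpa using this
    -- The starting point over `x` must be chosen so that the ℝ-component of `ε • u` does not leave
    -- `J`.
    · obtain ⟨t, ht, hts⟩ := hJ _ ((vectorSpan ℝ J).smul_mem ε h4)
      exact ⟨e.symm (x, t), symm_mem_lift hx ht, ε, hε, by simpa [lift] using ⟨hxε, hts⟩⟩

/-- Both sides are arbitrary choices, so they can be compared only modulo the span of the facet. If
no normal vector exists, it is missing in both complexes and both default to zero. -/
lemma normalVector_lift (hΛ : ∀ w, w ∈ Λ' ↔ (e w).1 ∈ Λ ∧ ∃ n : ℤ, (e w).2 = n)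
    {𝒞 : Set (Set V)} (h𝒞 : IsFaceComplex 𝒞) {C C' : Set V} (hC𝒞 : C ∈ 𝒞) (hC'𝒞 : C' ∈ 𝒞)
    (hC : C.Nonempty) (hCC' : C ⊆ C') {J : Set ℝ} (hJ : IsSlidable J) :
    (e (normalVector Λ' (lift e C J) (lift e C' J))).1 - normalVector Λ C C' ∈ vectorSpan ℝ C ∧
      (e (normalVector Λ' (lift e C J) (lift e C' J))).2 ∈ vectorSpan ℝ J := by
  by_cases h : ∃ u, IsNormalVector Λ C C' u
  · have h' : ∃ u, IsNormalVector Λ' (lift e C J) (lift e C' J) u := by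
      obtain ⟨u, hu⟩ := h
      exact ⟨e.symm (u, 0), (isNormalVector_lift_iff hΛ hC hCC' hJ).2
        (by simpa using ⟨hu, 0, by simp⟩)⟩
    have h1 := (isNormalVector_lift_iff hΛ hC hCC' hJ).1 (isNormalVector_normalVector h')
    exact ⟨h𝒞.sub_mem_of_isNormalVector hC𝒞 hC'𝒞 hCC' h1.1 (isNormalVector_normalVector h), h1.2.2⟩
  · have h' : ¬ ∃ u, IsNormalVector Λ' (lift e C J) (lift e C' J) u := fun ⟨u, hu⟩ =>
      h ⟨_, ((isNormalVector_lift_iff hΛ hC hCC' hJ).1 hu).1⟩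
    rw [normalVector, normalVector, dif_neg h, dif_neg h']
    simp

/-- Over a single height, `lift e C J` may also have half-line cofaces. They are harmless as soon as
their weight vanishes, which is all that `h1` asks for. -/
lemma finsum_mem_cofaces_lift {M : Type} [AddCommMonoid M] {𝒞 : Set (Set V)} {𝒞' : Set (Set W)}
    {C : Set V} (hC : C.Nonempty) {J : Set ℝ} (hJ : J.Nonempty)
    {ω' : Set W → ℝ}
    (h1 : ∀ σ ∈ cofaces 𝒞' (lift e C J), ω' σ ≠ 0 → ∃ C' ∈ cofaces 𝒞 C, σ = lift e C' J)
    (h2 : ∀ C' ∈ cofaces 𝒞 C, lift e C' J ∈ cofaces 𝒞' (lift e C J))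
    (hK : (cofaces 𝒞 C).Finite) (g : Set W → M) (hg : ∀ σ, ω' σ = 0 → g σ = 0) :
    ∑ᶠ σ ∈ cofaces 𝒞' (lift e C J), g σ = ∑ C' ∈ hK.toFinset, g (lift e C' J) := by
  rw [finsum_mem_inter_support_eq' g _ ((fun C' => lift e C' J) '' cofaces 𝒞 C),
    finsum_mem_image, finsum_mem_eq_finite_toFinset_sum _ hK]
  · intro A hA B hB hAB
    exact ((lift_inj (hC.mono hA.2.1) hJ (hC.mono hB.2.1) hJ).1 hAB).1
  · intro σ hσ
    constructor
    · intro hσ'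
      obtain ⟨C', hC', rfl⟩ := h1 σ hσ' fun h0 => hσ (hg σ h0)
      exact ⟨C', hC', rfl⟩
    · rintro ⟨C', hC', rfl⟩
      exact h2 C' hC'

/-- Pulled back functions have the same divisors on `𝒞` and on the cells over `J`. -/
lemma divisorWeight_lift (hΛ : ∀ w, w ∈ Λ' ↔ (e w).1 ∈ Λ ∧ ∃ n : ℤ, (e w).2 = n)
    {𝒞 : Set (Set V)} {𝒞' : Set (Set W)} (h𝒞 : IsFaceComplex 𝒞) (hfin : 𝒞.Finite)
    {C : Set V} (hC𝒞 : C ∈ 𝒞) (hC : C.Nonempty) {J : Set ℝ} (hJ : IsSlidable J)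
    {ω : Set V → ℝ} {ω' : Set W → ℝ} {φ : V → ℝ}
    (hφ : ∀ C' ∈ 𝒞, ∃ ψ, IsAffineFun ψ ∧ ∀ y ∈ C', φ y = ψ y)
    (h1 : ∀ σ ∈ cofaces 𝒞' (lift e C J), ω' σ ≠ 0 → ∃ C' ∈ cofaces 𝒞 C, σ = lift e C' J)
    (h2 : ∀ C' ∈ cofaces 𝒞 C, lift e C' J ∈ cofaces 𝒞' (lift e C J))
    (h3 : ∀ C' ∈ cofaces 𝒞 C, ω' (lift e C' J) = ω C') :
    divisorWeight Λ' 𝒞' ω' (fun w => φ (e w).1) (lift e C J) = divisorWeight Λ 𝒞 ω φ C := by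
  have hK : (cofaces 𝒞 C).Finite := hfin.subset fun σ h => h.1
  have hmem : ∀ C' ∈ hK.toFinset, C' ∈ cofaces 𝒞 C := fun C' h => hK.mem_toFinset.1 h
  have hφ' : ∀ C' ∈ 𝒞, ∃ ℓ : V →ₗ[ℝ] ℝ, ∀ x ∈ C', ∀ y ∈ C', φ y - φ x = ℓ (y - x) := by
    intro C' hC'
    obtain ⟨ψ, ⟨ℓ, c, hψ⟩, h⟩ := hφ C' hC'
    exact ⟨ℓ, fun x hx y hy => by rw [h x hx, h y hy, hψ, hψ, map_sub]; ring⟩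
  choose! ℓ hℓ using hφ'
  set n : Set V → V := fun C' => normalVector Λ C C' with hn
  set n' : Set V → W := fun C' => normalVector Λ' (lift e C J) (lift e C' J) with hn'
  have hnn : ∀ C' ∈ cofaces 𝒞 C, (e (n' C')).1 - n C' ∈ vectorSpan ℝ C ∧
      (e (n' C')).2 ∈ vectorSpan ℝ J := fun C' hC' =>
    normalVector_lift hΛ h𝒞 hC𝒞 hC'.1 hC hC'.2.1 hJ
  have hlin : ∀ C' ∈ 𝒞, C'.Nonempty → ∀ u ∈ vectorSpan ℝ (lift e C' J),
      linearPart (fun w => φ (e w).1) (lift e C' J) u = ℓ C' (e u).1 := by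
    intro C' hC' hne u hu
    exact linearPart_apply (ℓ := ℓ C' ∘ₗ LinearMap.fst ℝ V ℝ ∘ₗ (e : W →ₗ[ℝ] V × ℝ))
      (fun x hx y hy => by simpa using hℓ C' hC' _ hx.1 _ hy.1) hu
  have s1 : ∑ᶠ σ ∈ cofaces 𝒞' (lift e C J), ω' σ • normalVector Λ' (lift e C J) σ =
      ∑ C' ∈ hK.toFinset, ω C' • n' C' := by
    rw [finsum_mem_cofaces_lift hC hJ.nonempty h1 h2 hK _ fun σ h => by rw [h, zero_smul]]
    exact Finset.sum_congr rfl fun C' hC' => by rw [h3 C' (hmem C' hC')]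
  have s2 : ∑ᶠ σ ∈ cofaces 𝒞' (lift e C J), ω' σ * linearPart (fun w => φ (e w).1) σ
      (normalVector Λ' (lift e C J) σ) = ∑ C' ∈ hK.toFinset, ω C' * ℓ C' (e (n' C')).1 := by
    rw [finsum_mem_cofaces_lift hC hJ.nonempty h1 h2 hK _ fun σ h => by rw [h, zero_mul]]
    refine Finset.sum_congr rfl fun C' hC' => ?_
    have hc := hmem C' hC'
    rw [h3 C' hc, hlin C' hc.1 (hC.mono hc.2.1) _ normalVector_mem]
  have s3 : ∑ᶠ σ ∈ cofaces 𝒞 C, ω σ • normalVector Λ C σ = ∑ C' ∈ hK.toFinset, ω C' • n C' :=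
    finsum_mem_eq_finite_toFinset_sum _ hK
  have s4 : ∑ᶠ σ ∈ cofaces 𝒞 C, ω σ * linearPart φ σ (normalVector Λ C σ) =
      ∑ C' ∈ hK.toFinset, ω C' * ℓ C' (n C') := by
    rw [finsum_mem_eq_finite_toFinset_sum _ hK]
    exact Finset.sum_congr rfl fun C' hC' => by
      rw [linearPart_apply (hℓ C' (hmem C' hC').1) normalVector_mem]
  have hdiff : (e (∑ C' ∈ hK.toFinset, ω C' • n' C')).1 - ∑ C' ∈ hK.toFinset, ω C' • n C' =
      ∑ C' ∈ hK.toFinset, ω C' • ((e (n' C')).1 - n C') := by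
    simp only [map_sum, Prod.fst_sum, map_smul, Prod.smul_fst, smul_sub, Finset.sum_sub_distrib]
  have hdiff_mem : ∑ C' ∈ hK.toFinset, ω C' • ((e (n' C')).1 - n C') ∈ vectorSpan ℝ C :=
    Submodule.sum_mem _ fun C' hC' => Submodule.smul_mem _ _ (hnn C' (hmem C' hC')).1
  -- The chosen normal vectors differ from the lifted ones by vectors of the span of the facet, so
  -- the balancing test in `divisorWeight` has the same outcome on both sides.
  have hiff : (∑ C' ∈ hK.toFinset, ω C' • n' C') ∈ vectorSpan ℝ (lift e C J) ↔
      (∑ C' ∈ hK.toFinset, ω C' • n C') ∈ vectorSpan ℝ C := by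
    rw [mem_vectorSpan_lift hC hJ.nonempty]
    have hsnd : (e (∑ C' ∈ hK.toFinset, ω C' • n' C')).2 ∈ vectorSpan ℝ J := by
      simp only [map_sum, Prod.snd_sum, map_smul, Prod.smul_snd]
      exact Submodule.sum_mem _ fun C' hC' => Submodule.smul_mem _ _ (hnn C' (hmem C' hC')).2
    rw [← hdiff] at hdiff_mem
    exact ⟨fun h => ((Submodule.sub_mem_iff_right _ h.1).1 hdiff_mem),
      fun h => ⟨(Submodule.sub_mem_iff_left _ h).1 hdiff_mem, hsnd⟩⟩
  rw [divisorWeight, divisorWeight, s1, s2, s3, s4]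
  by_cases hm : (∑ C' ∈ hK.toFinset, ω C' • n C') ∈ vectorSpan ℝ C
  · rw [if_pos hm, if_pos (hiff.2 hm), hlin C hC𝒞 hC _ (hiff.2 hm),
      linearPart_apply (hℓ C hC𝒞) hm]
    -- On the span of `C` the linear part of each coface agrees with that of `C`. Changing a normal
    -- vector by such a vector therefore changes the two terms of the divisor weight by the same
    -- amount.
    have hagree : ∀ C' ∈ cofaces 𝒞 C, ∀ u ∈ vectorSpan ℝ C, ℓ C' u = ℓ C u := by
      intro C' hC' u hu
      rw [← linearPart_apply (hℓ C hC𝒞) hu]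
      exact (linearPart_apply (fun x hx y hy => hℓ C' hC'.1 x (hC'.2.1 hx) y (hC'.2.1 hy)) hu).symm
    have h5 : ℓ C (e (∑ C' ∈ hK.toFinset, ω C' • n' C')).1 - ℓ C (∑ C' ∈ hK.toFinset, ω C' • n C')
        = ∑ C' ∈ hK.toFinset, ω C' * ℓ C' (e (n' C')).1 - ∑ C' ∈ hK.toFinset, ω C' * ℓ C' (n C') := by
      rw [← map_sub, hdiff, map_sum, ← Finset.sum_sub_distrib]
      refine Finset.sum_congr rfl fun C' hC' => ?_
      rw [map_smul, ← hagree C' (hmem C' hC') _ (hnn C' (hmem C' hC')).1, smul_eq_mul, map_sub]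
      ring
    linarith
  · rw [if_neg hm, if_neg fun h => hm (hiff.1 h)]

/-- The ℝ-component of a normal vector is an integer that generates ℤ, hence ±1, and pointing into
the half-line fixes its sign. The `V`-component is only known to be tangent to `C`. -/
lemma normalVector_half (hΛ : ∀ w, w ∈ Λ' ↔ (e w).1 ∈ Λ ∧ ∃ n : ℤ, (e w).2 = n)
    {C : Set V} (hC : C.Nonempty) (c : ℝ) {s : ℤ} (hs : s = 1 ∨ s = -1) :
    (e (normalVector Λ' (lift e C {c}) (lift e C (half c s)))).1 ∈ vectorSpan ℝ C ∧
      (e (normalVector Λ' (lift e C {c}) (lift e C (half c s)))).2 = s := by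
  have hs0 : s ≠ 0 := by rcases hs with rfl | rfl <;> norm_num
  have hss : s * s = 1 := by rcases hs with rfl | rfl <;> norm_num
  have hJ : (half c s).Nonempty := ⟨c, mem_half c s⟩
  have hJ0 : ({c} : Set ℝ).Nonempty := ⟨c, rfl⟩
  have hex : ∃ u, IsNormalVector Λ' (lift e C {c}) (lift e C (half c s)) u := by
    obtain ⟨x, hx⟩ := hC
    refine ⟨e.symm (0, (s : ℝ)), ?_, ?_, ?_, e.symm (x, c), symm_mem_lift hx rfl, 1, one_pos, ?_⟩
    · rw [hΛ]; simp
    · rw [mem_vectorSpan_lift ⟨x, hx⟩ hJ, vectorSpan_half c hs0]; simp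
    · intro w hw hw'
      rw [mem_vectorSpan_lift ⟨x, hx⟩ hJ] at hw'
      obtain ⟨-, m, hm⟩ := (hΛ w).1 hw
      refine ⟨m * s, (mem_vectorSpan_lift ⟨x, hx⟩ hJ0).2 ⟨by simpa using hw'.1, ?_⟩⟩
      have : (m : ℝ) - m * s * s = 0 := by
        have : ((s * s : ℤ) : ℝ) = 1 := by rw [hss]; simp
        push_cast at this
        rw [mul_assoc, this]; ring
      simpa [hm] using this
    · simpa [lift, hx] using add_mem_half c s
  obtain ⟨h1, h2, h3, x, hx, ε, hε, hxε⟩ := isNormalVector_normalVector hex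
  generalize normalVector Λ' (lift e C {c}) (lift e C (half c s)) = u at *
  rw [mem_vectorSpan_lift hC hJ] at h2
  refine ⟨h2.1, ?_⟩
  obtain ⟨-, q, hq⟩ := (hΛ u).1 h1
  obtain ⟨a, ha⟩ := h3 (e.symm (0, (s : ℝ))) ((hΛ _).2 (by simp))
    ((mem_vectorSpan_lift hC hJ).2 (by simp [vectorSpan_half c hs0]))
  rw [mem_vectorSpan_lift hC hJ0] at ha
  have ha2 := ha.2
  simp [hq] at ha2
  -- Testing the generating property on the lattice vector `(0, s)` shows that the integer `q`
  -- divides ±1.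
  have haq : s = a * q := by
    have : (s : ℝ) = a * q := by linarith
    exact_mod_cast this
  have hpos : 0 ≤ (s : ℝ) * q := by
    have h4 := hxε.2
    have h5 : (e x).2 = c := hx.2
    simp only [map_add, map_smul, Prod.snd_add, Prod.smul_snd, h5, hq, half, Set.mem_ofPred_eq,
      smul_eq_mul, add_sub_cancel_left] at h4
    have : 0 ≤ ε * ((s : ℝ) * q) := by linarith
    exact nonneg_of_mul_nonneg_right this hε
  have hpos' : 0 ≤ s * q := by exact_mod_cast hpos
  have hunit : IsUnit q := by
    refine IsUnit.of_mul_eq_one (a * s) ?_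
    calc q * (a * s) = (a * q) * s := by ring
      _ = 1 := by rw [← haq, hss]
  have : q = s := by
    rcases Int.isUnit_iff.1 hunit with rfl | rfl <;> rcases hs with rfl | rfl <;>
      first | rfl | norm_num at hpos'
  rw [hq, this]

/-- The divisor of `φ + k · max(t - c, 0)` along `C × {c}`. -/
lemma divisorWeight_lift_level (hΛ : ∀ w, w ∈ Λ' ↔ (e w).1 ∈ Λ ∧ ∃ n : ℤ, (e w).2 = n)
    {𝒞' : Set (Set W)} {C : Set V} (hC : C.Nonempty) {c : ℝ} {ω' : Set W → ℝ} {a : ℝ}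
    {φ ψ : V → ℝ} (hψ : IsAffineFun ψ) (hφ : ∀ y ∈ C, φ y = ψ y) (k : ℝ)
    (h1 : ∀ σ ∈ cofaces 𝒞' (lift e C {c}), ω' σ ≠ 0 →
      σ = lift e C (half c 1) ∨ σ = lift e C (half c (-1)))
    (h2 : ∀ s : ℤ, s = 1 ∨ s = -1 → lift e C (half c s) ∈ cofaces 𝒞' (lift e C {c}))
    (h3 : ∀ s : ℤ, s = 1 ∨ s = -1 → ω' (lift e C (half c s)) = a) :
    divisorWeight Λ' 𝒞' ω' (fun w => φ (e w).1 + k * max ((e w).2 - c) 0) (lift e C {c}) =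
      a * k := by
  obtain ⟨ℓ, d, hψ⟩ := hψ
  have hfs : ∀ {M : Type} [AddCommMonoid M] (g : Set W → M), (∀ σ, ω' σ = 0 → g σ = 0) →
      ∑ᶠ σ ∈ cofaces 𝒞' (lift e C {c}), g σ =
        g (lift e C (half c 1)) + g (lift e C (half c (-1))) := by
    intro M _ g hg
    rw [finsum_mem_inter_support_eq' g _ {lift e C (half c 1), lift e C (half c (-1))},
      finsum_mem_pair]
    · intro h
      exact half_ne_half c ((lift_inj hC ⟨c, mem_half c 1⟩ hC ⟨c, mem_half c (-1)⟩).1 h).2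
    · intro σ hσ
      constructor
      · exact fun hσ' => h1 σ hσ' fun h0 => hσ (hg σ h0)
      · rintro (rfl | rfl)
        · exact h2 1 (by simp)
        · exact h2 (-1) (by simp)
  set Φ : W → ℝ := fun w => φ (e w).1 + k * max ((e w).2 - c) 0 with hΦ
  have hp1 := normalVector_half (e := e) (Λ := Λ) (Λ' := Λ') hΛ hC c (s := 1) (by simp)
  have hp2 := normalVector_half (e := e) (Λ := Λ) (Λ' := Λ') hΛ hC c (s := -1) (by simp)
  rw [divisorWeight, hfs _ fun σ h => by rw [h, zero_smul], hfs _ fun σ h => by rw [h, zero_mul],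
    h3 1 (by simp), h3 (-1) (by simp)]
  have hm1 := normalVector_mem (Λ := Λ') (τ := lift e C {c}) (σ := lift e C (half c 1))
  have hm2 := normalVector_mem (Λ := Λ') (τ := lift e C {c}) (σ := lift e C (half c (-1)))
  generalize normalVector Λ' (lift e C {c}) (lift e C (half c 1)) = u₁ at *
  generalize normalVector Λ' (lift e C {c}) (lift e C (half c (-1))) = u₂ at *
  have l1 : linearPart Φ (lift e C (half c 1)) u₁ = ℓ (e u₁).1 + k := by
    rw [linearPart_apply (ℓ := ℓ ∘ₗ LinearMap.fst ℝ V ℝ ∘ₗ (e : W →ₗ[ℝ] V × ℝ) +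
      k • (LinearMap.snd ℝ V ℝ ∘ₗ (e : W →ₗ[ℝ] V × ℝ))) _ hm1]
    · simp [hp1.2]
    · intro x hx y hy
      have hx2 := hx.2
      have hy2 := hy.2
      simp only [half, Set.mem_ofPred_eq, Int.cast_one, one_mul] at hx2 hy2
      simp only [hΦ, hφ _ hx.1, hφ _ hy.1, hψ, max_eq_left hx2, max_eq_left hy2]
      simp
      ring
  have l2 : linearPart Φ (lift e C (half c (-1))) u₂ = ℓ (e u₂).1 := by
    rw [linearPart_apply (ℓ := ℓ ∘ₗ LinearMap.fst ℝ V ℝ ∘ₗ (e : W →ₗ[ℝ] V × ℝ)) _ hm2]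
    · simp
    · intro x hx y hy
      have hx2 := hx.2
      have hy2 := hy.2
      simp only [half, Set.mem_ofPred_eq, Int.cast_one, Int.cast_neg, neg_mul, one_mul] at hx2 hy2
      have hx3 : (e x).2 - c ≤ 0 := by linarith
      have hy3 : (e y).2 - c ≤ 0 := by linarith
      simp only [hΦ, hφ _ hx.1, hφ _ hy.1, hψ, max_eq_right hx3, max_eq_right hy3]
      simp
  -- The two half-lines carry the same weight and have opposite ℝ-components, so the weighted normal
  -- vectors balance along `C`. The remaining contribution `a * k` comes from the upper half-line
  -- alone.
  have hT : a • u₁ + a • u₂ ∈ vectorSpan ℝ (lift e C {c}) := by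
    rw [mem_vectorSpan_lift hC (Set.singleton_nonempty c)]
    simp only [map_add, map_smul, Prod.fst_add, Prod.snd_add, Prod.smul_fst, Prod.smul_snd,
      hp1.2, hp2.2]
    exact ⟨add_mem (Submodule.smul_mem _ _ hp1.1) (Submodule.smul_mem _ _ hp2.1), by simp⟩
  have l3 : linearPart Φ (lift e C {c}) (a • u₁ + a • u₂) = a * ℓ (e u₁).1 + a * ℓ (e u₂).1 := by
    rw [linearPart_apply (ℓ := ℓ ∘ₗ LinearMap.fst ℝ V ℝ ∘ₗ (e : W →ₗ[ℝ] V × ℝ)) _ hT]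
    · simp
    · intro x hx y hy
      have hx2 : (e x).2 = c := hx.2
      have hy2 : (e y).2 = c := hy.2
      simp only [hΦ, hφ _ hx.1, hφ _ hy.1, hψ, hx2, hy2]
      simp
  rw [if_pos hT, l1, l2, l3]
  ring

end LiftDivisor

/-! ### Intersection products on products with a line -/

section LiftProduct

variable {V W : Type} [AddCommGroup V] [Module ℝ V] [AddCommGroup W] [Module ℝ W]
  (e : W ≃ₗ[ℝ] V × ℝ)

/-- The pull-back of a function on `V` to a space that is identified with `V × ℝ`. -/
def basePull (f : MaxFun V) : MaxFun W := f.pull fun w => (e w).1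

/-- The function `max(t - c, 0)`, where `t` is the second component. -/
noncomputable def levelFun (c : ℝ) : MaxFun W := ⟨1, ![fun w => (e w).2 - c, fun _ => 0]⟩

/-- The complex of the products of the cells of `S` with `ℝ`. -/
def liftComplex (S : Set (Set V)) : Set (Set W) := {σ | ∃ C ∈ S, σ = lift e C Set.univ}

variable {e}

lemma eval_levelFun (c : ℝ) (w : W) : (levelFun e c).eval w = max ((e w).2 - c) 0 := by
  refine le_antisymm (MaxFun.eval_le _ fun j => ?_) (max_le ?_ ?_)
  · change Fin 2 at j
    fin_cases j
    · exact le_max_left _ _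
    · exact le_max_right _ _
  · exact (levelFun e c).term_le_eval (0 : Fin 2) w
  · exact (levelFun e c).term_le_eval (1 : Fin 2) w

/-- Pulled-back functions do not see the height. The two lists are compared only as sets, since the
subdivision ignores order and repetition. -/
lemma mem_subdivide_liftComplex {S : Set (Set V)} {fs : List (MaxFun V)} {fs' : List (MaxFun W)}
    (h : ∀ f, f ∈ fs' ↔ ∃ g ∈ fs, f = basePull e g) {σ : Set W} :
    σ ∈ subdivide (liftComplex e S) fs' ↔ ∃ C ∈ subdivide S fs, σ = lift e C Set.univ := by
  have key : ∀ (C : Set V) (w : W), {y | y ∈ lift e C Set.univ ∧ ∀ f ∈ fs', ∀ j,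
      f.term j w = f.eval w → f.term j y = f.eval y} = lift e {y | y ∈ C ∧ ∀ f ∈ fs, ∀ j,
      f.term j (e w).1 = f.eval (e w).1 → f.term j y = f.eval y} Set.univ := by
    intro C w
    ext y
    constructor
    · rintro ⟨hy, hy'⟩
      exact ⟨⟨hy.1, fun g hg j hj => hy' (basePull e g) ((h _).2 ⟨g, hg, rfl⟩) j hj⟩, trivial⟩
    · rintro ⟨⟨hy, hy'⟩, -⟩
      refine ⟨⟨hy, trivial⟩, fun f hf j hj => ?_⟩
      obtain ⟨g, hg, rfl⟩ := (h _).1 hf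
      exact hy' g hg j hj
  constructor
  · rintro ⟨_, ⟨C, hC, rfl⟩, w, hw, rfl⟩
    exact ⟨_, ⟨C, hC, (e w).1, hw.1, rfl⟩, key C w⟩
  · rintro ⟨_, ⟨C, hC, x, hx, rfl⟩, rfl⟩
    refine ⟨_, ⟨C, hC, rfl⟩, e.symm (x, 0), symm_mem_lift hx trivial, ?_⟩
    rw [key]
    simp

/-- The cells of the subdivision of `ℝ` at `c`. -/
def IsLevelCell (c : ℝ) (J : Set ℝ) : Prop := J = {c} ∨ ∃ s : ℤ, (s = 1 ∨ s = -1) ∧ J = half c s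

/-- The three shapes of cells correspond to `t₀ < c`, `t₀ = c` and `t₀ > c`. -/
lemma isLevelCell_iff {c : ℝ} {J : Set ℝ} : IsLevelCell c J ↔ ∃ t₀ : ℝ, J =
    {t | (t₀ - c = max (t₀ - c) 0 → t - c = max (t - c) 0) ∧
      (0 = max (t₀ - c) 0 → 0 = max (t - c) 0)} := by
  have h0 : {t : ℝ | (c - c = max (c - c) 0 → t - c = max (t - c) 0) ∧
      (0 = max (c - c) 0 → 0 = max (t - c) 0)} = {c} := by
    ext t
    simp only [sub_self, max_self, forall_const, Set.mem_ofPred_eq, Set.mem_singleton_iff]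
    constructor
    · rintro ⟨h1, h2⟩
      linarith
    · rintro rfl
      simp
  have h1 : ∀ t₀, c < t₀ → {t : ℝ | (t₀ - c = max (t₀ - c) 0 → t - c = max (t - c) 0) ∧
      (0 = max (t₀ - c) 0 → 0 = max (t - c) 0)} = half c 1 := by
    intro t₀ ht
    have h2 : max (t₀ - c) 0 = t₀ - c := max_eq_left (by linarith)
    have h3 : ¬ (0 = t₀ - c) := by intro h; linarith
    ext t
    simp [h2, h3, half]
  have h2 : ∀ t₀, t₀ < c → {t : ℝ | (t₀ - c = max (t₀ - c) 0 → t - c = max (t - c) 0) ∧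
      (0 = max (t₀ - c) 0 → 0 = max (t - c) 0)} = half c (-1) := by
    intro t₀ ht
    have h2 : max (t₀ - c) 0 = 0 := max_eq_right (by linarith)
    have h3 : ¬ (t₀ - c = 0) := by intro h; linarith
    ext t
    simp [h2, h3, half]
  constructor
  · rintro (rfl | ⟨s, rfl | rfl, rfl⟩)
    · exact ⟨c, h0.symm⟩
    · exact ⟨c + 1, (h1 _ (by linarith)).symm⟩
    · exact ⟨c - 1, (h2 _ (by linarith)).symm⟩
  · rintro ⟨t₀, rfl⟩
    rcases lt_trichotomy t₀ c with h | rfl | h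
    · exact Or.inr ⟨-1, Or.inr rfl, h2 _ h⟩
    · exact Or.inl h0
    · exact Or.inr ⟨1, Or.inl rfl, h1 _ h⟩

lemma mem_subdivide_liftComplex_level {S : Set (Set V)} {fs : List (MaxFun V)}
    {fs' : List (MaxFun W)} {c : ℝ}
    (h : ∀ f, f ∈ fs' ↔ f = levelFun e c ∨ ∃ g ∈ fs, f = basePull e g) {σ : Set W} :
    σ ∈ subdivide (liftComplex e S) fs' ↔
      ∃ C ∈ subdivide S fs, ∃ J, IsLevelCell c J ∧ σ = lift e C J := by
  have key : ∀ (C : Set V) (w : W), {y | y ∈ lift e C Set.univ ∧ ∀ f ∈ fs', ∀ j,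
      f.term j w = f.eval w → f.term j y = f.eval y} = lift e {y | y ∈ C ∧ ∀ f ∈ fs, ∀ j,
      f.term j (e w).1 = f.eval (e w).1 → f.term j y = f.eval y}
      {t | ((e w).2 - c = max ((e w).2 - c) 0 → t - c = max (t - c) 0) ∧
      (0 = max ((e w).2 - c) 0 → 0 = max (t - c) 0)} := by
    intro C w
    ext y
    constructor
    · rintro ⟨hy, hy'⟩
      refine ⟨⟨hy.1, fun g hg j hj =>
        hy' (basePull e g) ((h _).2 (Or.inr ⟨g, hg, rfl⟩)) j hj⟩, ?_⟩
      have h1 := hy' (levelFun e c) ((h _).2 (Or.inl rfl))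
      rw [eval_levelFun, eval_levelFun] at h1
      exact ⟨h1 (0 : Fin 2), h1 (1 : Fin 2)⟩
    · rintro ⟨⟨hy, hy'⟩, ht⟩
      refine ⟨⟨hy, trivial⟩, fun f hf => ?_⟩
      rcases (h _).1 hf with rfl | ⟨g, hg, rfl⟩
      · rw [eval_levelFun, eval_levelFun]
        intro j
        change Fin 2 at j
        fin_cases j
        · exact ht.1
        · exact ht.2
      · exact fun j hj => hy' g hg j hj
  constructor
  · rintro ⟨_, ⟨C, hC, rfl⟩, w, hw, rfl⟩
    exact ⟨_, ⟨C, hC, (e w).1, hw.1, rfl⟩, _, isLevelCell_iff.2 ⟨_, rfl⟩, key C w⟩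
  · rintro ⟨_, ⟨C, hC, x, hx, rfl⟩, J, hJ, rfl⟩
    obtain ⟨t₀, rfl⟩ := isLevelCell_iff.1 hJ
    refine ⟨_, ⟨C, hC, rfl⟩, e.symm (x, t₀), symm_mem_lift hx trivial, ?_⟩
    rw [key]
    simp

variable {Λ : AddSubgroup V} {Λ' : AddSubgroup W} [FiniteDimensional ℝ V]

/-- Induction on the functions still to be intersected, with arbitrary starting weights; the
subdivision by the full list stays fixed throughout. -/
lemma foldl_divisorWeight_liftComplex
    (hΛ : ∀ w, w ∈ Λ' ↔ (e w).1 ∈ Λ ∧ ∃ n : ℤ, (e w).2 = n)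
    {S : Set (Set V)} (hS : IsFaceComplex S) (hfin : S.Finite) {fs : List (MaxFun V)}
    (hfs : ∀ f ∈ fs, f.IsAffine) {fs' : List (MaxFun W)}
    (h : ∀ f, f ∈ fs' ↔ ∃ g ∈ fs, f = basePull e g)
    (gs : List (MaxFun V)) (hgs : ∀ g ∈ gs, g ∈ fs)
    (ω : Set V → ℝ) (ω' : Set W → ℝ)
    (hω : ∀ C ∈ subdivide S fs, ω' (lift e C Set.univ) = ω C) :
    ∀ C ∈ subdivide S fs,
      (gs.map (basePull e)).foldl (fun ω f =>
        divisorWeight Λ' (subdivide (liftComplex e S) fs') ω f.eval) ω' (lift e C Set.univ) =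
      gs.foldl (fun ω f => divisorWeight Λ (subdivide S fs) ω f.eval) ω C := by
  induction gs generalizing ω ω' with
  | nil => exact hω
  | cons g gs ih =>
    simp only [List.map_cons, List.foldl_cons]
    refine ih (fun g' hg' => hgs g' (List.mem_cons_of_mem _ hg')) _ _ fun C hC => ?_
    have hCne := nonempty_of_mem_subdivide hC
    refine divisorWeight_lift (φ := g.eval) hΛ (hS.subdivide hfs) (finite_subdivide hfin fs) hC
      hCne isSlidable_univ
      (fun C' hC' => exists_affineFun_of_mem_subdivide hfs hC' (hgs g List.mem_cons_self)) ?_ ?_ ?_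
    · rintro σ ⟨hσ, hsub, hdim⟩ -
      obtain ⟨C', hC', rfl⟩ := (mem_subdivide_liftComplex h).1 hσ
      have hne := nonempty_of_mem_subdivide hC'
      rw [polyDim_lift hne Set.univ_nonempty, polyDim_lift hCne Set.univ_nonempty] at hdim
      exact ⟨C', ⟨hC', ((lift_subset_lift hCne Set.univ_nonempty).1 hsub).1, by omega⟩, rfl⟩
    · rintro C' ⟨hC', hsub, hdim⟩
      have hne := nonempty_of_mem_subdivide hC'
      refine ⟨(mem_subdivide_liftComplex h).2 ⟨C', hC', rfl⟩,
        (lift_subset_lift hCne Set.univ_nonempty).2 ⟨hsub, subset_rfl⟩, ?_⟩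
      rw [polyDim_lift hne Set.univ_nonempty, polyDim_lift hCne Set.univ_nonempty]
      omega
    · exact fun C' hC' => hω C' hC'.1

/-- The case without a height condition: the product is a plane product times ℝ. It serves for the
cross-ratio conditions alone in general position. -/
lemma productWeight_liftComplex
    (hΛ : ∀ w, w ∈ Λ' ↔ (e w).1 ∈ Λ ∧ ∃ n : ℤ, (e w).2 = n)
    {S : Set (Set V)} (hS : IsFaceComplex S) (hfin : S.Finite) {fs : List (MaxFun V)}
    (hfs : ∀ f ∈ fs, f.IsAffine) {fs' : List (MaxFun W)}
    (h : ∀ f, f ∈ fs' ↔ ∃ g ∈ fs, f = basePull e g)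
    (D : ℕ) (gs : List (MaxFun V)) (hgs : ∀ g ∈ gs, g ∈ fs)
    {C : Set V} (hC : C ∈ subdivide S fs) :
    productWeight Λ' (liftComplex e S) (D + 1) fs' (gs.map (basePull e)) (lift e C Set.univ) =
      productWeight Λ S D fs gs C := by
  refine foldl_divisorWeight_liftComplex hΛ hS hfin hfs h gs hgs _ _ (fun C hC => ?_) C hC
  rw [polyDim_lift (nonempty_of_mem_subdivide hC) Set.univ_nonempty, polyDim_univ_real]
  simp

lemma IsLevelCell.nonempty {c : ℝ} {J : Set ℝ} (hJ : IsLevelCell c J) : J.Nonempty := by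
  rcases hJ with rfl | ⟨s, -, rfl⟩
  exacts [⟨c, rfl⟩, ⟨c, mem_half c s⟩]

lemma lift_mem_cofaces_level
    {S : Set (Set V)} {fs : List (MaxFun V)}
    {fs' : List (MaxFun W)} {c : ℝ}
    (h : ∀ f, f ∈ fs' ↔ f = levelFun e c ∨ ∃ g ∈ fs, f = basePull e g)
    {C C' : Set V} (hC : C ∈ subdivide S fs)
    (hC' : C' ∈ cofaces (subdivide S fs) C) {J : Set ℝ} (hJ : IsLevelCell c J) :
    lift e C' J ∈ cofaces (subdivide (liftComplex e S) fs') (lift e C J) := by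
  have hCne := nonempty_of_mem_subdivide hC
  refine ⟨(mem_subdivide_liftComplex_level h).2 ⟨C', hC'.1, J, hJ, rfl⟩,
    (lift_subset_lift hCne hJ.nonempty).2 ⟨hC'.2.1, subset_rfl⟩, ?_⟩
  rw [polyDim_lift (hCne.mono hC'.2.1) hJ.nonempty, polyDim_lift hCne hJ.nonempty, hC'.2.2]
  omega

lemma lift_half_mem_cofaces_level
    {S : Set (Set V)} {fs : List (MaxFun V)}
    {fs' : List (MaxFun W)} {c : ℝ}
    (h : ∀ f, f ∈ fs' ↔ f = levelFun e c ∨ ∃ g ∈ fs, f = basePull e g)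
    {C : Set V} (hC : C ∈ subdivide S fs) (s : ℤ)
    (hs : s = 1 ∨ s = -1) :
    lift e C (half c s) ∈ cofaces (subdivide (liftComplex e S) fs') (lift e C {c}) := by
  have hCne := nonempty_of_mem_subdivide hC
  have hs0 : s ≠ 0 := by rcases hs with rfl | rfl <;> norm_num
  refine ⟨(mem_subdivide_liftComplex_level h).2 ⟨C, hC, _, Or.inr ⟨s, hs, rfl⟩, rfl⟩,
    (lift_subset_lift hCne (Set.singleton_nonempty c)).2 ⟨subset_rfl, ?_⟩, ?_⟩
  · rintro _ rfl
    exact mem_half _ s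
  · rw [polyDim_lift hCne ⟨c, mem_half c s⟩, polyDim_lift hCne (Set.singleton_nonempty c),
      polyDim_half c hs0, polyDim_singleton]

lemma exists_of_mem_cofaces_half
    {S : Set (Set V)} {fs : List (MaxFun V)}
    {fs' : List (MaxFun W)} {c : ℝ}
    (h : ∀ f, f ∈ fs' ↔ f = levelFun e c ∨ ∃ g ∈ fs, f = basePull e g)
    {C : Set V} (hC : C ∈ subdivide S fs) {s : ℤ}
    (hs : s = 1 ∨ s = -1) {σ : Set W}
    (hσ : σ ∈ cofaces (subdivide (liftComplex e S) fs') (lift e C (half c s))) :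
    ∃ C' ∈ cofaces (subdivide S fs) C, σ = lift e C' (half c s) := by
  have hCne := nonempty_of_mem_subdivide hC
  have hs0 : s ≠ 0 := by rcases hs with rfl | rfl <;> norm_num
  have hJ : (half c s).Nonempty := ⟨c, mem_half c s⟩
  obtain ⟨hσ, hsub, hdim⟩ := hσ
  obtain ⟨C', hC', J, hJ', rfl⟩ := (mem_subdivide_liftComplex_level h).1 hσ
  have hsub' := (lift_subset_lift hCne hJ).1 hsub
  rcases hJ' with rfl | ⟨s', hs', rfl⟩
  · exact absurd hsub'.2 (not_half_subset_singleton hs0)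
  · obtain rfl := half_eq_of_subset hs hs' hsub'.2
    rw [polyDim_lift (nonempty_of_mem_subdivide hC') hJ, polyDim_lift hCne hJ] at hdim
    exact ⟨C', ⟨hC', hsub'.1, by omega⟩, rfl⟩

/-- The one extra dimension is gained either in `V` or in ℝ; in the second case the cells in `V`
have equal dimension, so by the face property they coincide. -/
lemma exists_of_mem_cofaces_singleton
    {S : Set (Set V)} (hS : IsFaceComplex S) {fs : List (MaxFun V)}
    (hfs : ∀ f ∈ fs, f.IsAffine) {fs' : List (MaxFun W)} {c : ℝ}
    (h : ∀ f, f ∈ fs' ↔ f = levelFun e c ∨ ∃ g ∈ fs, f = basePull e g)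
    {C : Set V} (hC : C ∈ subdivide S fs) {σ : Set W}
    (hσ : σ ∈ cofaces (subdivide (liftComplex e S) fs') (lift e C {c})) :
    (∃ C' ∈ cofaces (subdivide S fs) C, σ = lift e C' {c}) ∨
      ∃ s : ℤ, (s = 1 ∨ s = -1) ∧ σ = lift e C (half c s) := by
  have hCne := nonempty_of_mem_subdivide hC
  have hJ := Set.singleton_nonempty c
  obtain ⟨hσ, hsub, hdim⟩ := hσ
  obtain ⟨C', hC', J, hJ', rfl⟩ := (mem_subdivide_liftComplex_level h).1 hσ
  have hC'ne := nonempty_of_mem_subdivide hC'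
  have hsub' := (lift_subset_lift hCne hJ).1 hsub
  rw [polyDim_lift hC'ne hJ'.nonempty, polyDim_lift hCne hJ, polyDim_singleton] at hdim
  rcases hJ' with rfl | ⟨s, hs, rfl⟩
  · rw [polyDim_singleton] at hdim
    exact Or.inl ⟨C', ⟨hC', hsub'.1, by omega⟩, rfl⟩
  · have hs0 : s ≠ 0 := by rcases hs with rfl | rfl <;> norm_num
    rw [polyDim_half c hs0] at hdim
    have : C = C' := (hS.subdivide hfs).eq_of_subset_of_polyDim_eq hC hC' hCne hsub'.1 (by omega)
    exact Or.inr ⟨s, hs, by rw [this]⟩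

/-- The stage before the height condition. No weight appears on `C × {c}`, because a pulled-back
function does not bend in the height direction: this is `divisorWeight_lift_level` with slope change
zero. -/
lemma foldl_divisorWeight_above
    (hΛ : ∀ w, w ∈ Λ' ↔ (e w).1 ∈ Λ ∧ ∃ n : ℤ, (e w).2 = n)
    {S : Set (Set V)} (hS : IsFaceComplex S) (hfin : S.Finite) {fs : List (MaxFun V)}
    (hfs : ∀ f ∈ fs, f.IsAffine) {fs' : List (MaxFun W)} {c : ℝ}
    (h : ∀ f, f ∈ fs' ↔ f = levelFun e c ∨ ∃ g ∈ fs, f = basePull e g)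
    (gs : List (MaxFun V)) (hgs : ∀ g ∈ gs, g ∈ fs)
    (ω : Set V → ℝ) (ω' : Set W → ℝ)
    (hω : ∀ C ∈ subdivide S fs, (∀ s : ℤ, s = 1 ∨ s = -1 → ω' (lift e C (half c s)) = ω C) ∧
      ω' (lift e C {c}) = 0) :
    ∀ C ∈ subdivide S fs,
      (∀ s : ℤ, s = 1 ∨ s = -1 → (gs.map (basePull e)).foldl (fun ω f =>
        divisorWeight Λ' (subdivide (liftComplex e S) fs') ω f.eval) ω' (lift e C (half c s)) =
        gs.foldl (fun ω f => divisorWeight Λ (subdivide S fs) ω f.eval) ω C) ∧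
      (gs.map (basePull e)).foldl (fun ω f =>
        divisorWeight Λ' (subdivide (liftComplex e S) fs') ω f.eval) ω' (lift e C {c}) = 0 := by
  induction gs generalizing ω ω' with
  | nil => exact hω
  | cons g gs ih =>
    simp only [List.map_cons, List.foldl_cons]
    refine ih (fun g' hg' => hgs g' (List.mem_cons_of_mem _ hg')) _ _ fun C hC => ⟨?_, ?_⟩
    · intro s hs
      exact divisorWeight_lift (φ := g.eval) hΛ (hS.subdivide hfs) (finite_subdivide hfin fs) hC
        (nonempty_of_mem_subdivide hC) (isSlidable_half c hs)
        (fun C' hC' => exists_affineFun_of_mem_subdivide hfs hC' (hgs g List.mem_cons_self))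
        (fun σ hσ _ => exists_of_mem_cofaces_half h hC hs hσ)
        (fun C' hC' => lift_mem_cofaces_level h hC hC' (Or.inr ⟨s, hs, rfl⟩))
        (fun C' hC' => (hω C' hC'.1).1 s hs)
    · obtain ⟨ψ, hψ, hgψ⟩ := exists_affineFun_of_mem_subdivide hfs hC (hgs g List.mem_cons_self)
      have := divisorWeight_lift_level (a := ω C) (φ := g.eval)
        (𝒞' := subdivide (liftComplex e S) fs') hΛ
        (nonempty_of_mem_subdivide hC) hψ hgψ 0 (c := c) (ω' := ω') ?_
        (lift_half_mem_cofaces_level h hC) ((hω C hC).1)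
      · simp only [zero_mul, add_zero, mul_zero] at this
        exact this
      · intro σ hσ hne
        rcases exists_of_mem_cofaces_singleton hS hfs h hC hσ with ⟨C', hC', rfl⟩ | ⟨s, hs, rfl⟩
        · exact absurd (hω C' hC'.1).2 hne
        · rcases hs with rfl | rfl <;> simp

/-- The level function is linear along each half-line, so weights there disappear; at height `c` its
slope jumps by one, so the common weight of the two half-lines is transferred unchanged. -/
lemma divisorWeight_levelFun
    (hΛ : ∀ w, w ∈ Λ' ↔ (e w).1 ∈ Λ ∧ ∃ n : ℤ, (e w).2 = n)
    {S : Set (Set V)} (hS : IsFaceComplex S) (hfin : S.Finite) {fs : List (MaxFun V)}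
    (hfs : ∀ f ∈ fs, f.IsAffine) {fs' : List (MaxFun W)} {c : ℝ}
    (h : ∀ f, f ∈ fs' ↔ f = levelFun e c ∨ ∃ g ∈ fs, f = basePull e g)
    (ω : Set V → ℝ) (ω' : Set W → ℝ)
    (hω : ∀ C ∈ subdivide S fs, (∀ s : ℤ, s = 1 ∨ s = -1 → ω' (lift e C (half c s)) = ω C) ∧
      ω' (lift e C {c}) = 0) :
    ∀ C ∈ subdivide S fs,
      (∀ s : ℤ, s = 1 ∨ s = -1 → divisorWeight Λ' (subdivide (liftComplex e S) fs') ω'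
        (levelFun e c).eval (lift e C (half c s)) = 0) ∧
      divisorWeight Λ' (subdivide (liftComplex e S) fs') ω' (levelFun e c).eval (lift e C {c}) =
        ω C := by
  have heval : (levelFun e c).eval = fun w => max ((e w).2 - c) 0 := funext (eval_levelFun c)
  intro C hC
  refine ⟨fun s hs => ?_, ?_⟩
  · have hfin' : (subdivide (liftComplex e S) fs').Finite := by
      refine finite_subdivide ?_ fs'
      refine (hfin.image fun C => lift e C Set.univ).subset ?_
      rintro _ ⟨C, hC, rfl⟩
      exact ⟨C, hC, rfl⟩
    obtain ⟨ℓ, hℓ⟩ : ∃ ℓ : W →ₗ[ℝ] ℝ, ∀ C' : Set V, ∀ x ∈ lift e C' (half c s),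
        ∀ y ∈ lift e C' (half c s), max ((e y).2 - c) 0 - max ((e x).2 - c) 0 = ℓ (y - x) := by
      rcases hs with rfl | rfl
      · refine ⟨LinearMap.snd ℝ V ℝ ∘ₗ (e : W →ₗ[ℝ] V × ℝ), fun C' x hx y hy => ?_⟩
        have hx2 := hx.2
        have hy2 := hy.2
        simp only [half, Set.mem_ofPred_eq, Int.cast_one, one_mul] at hx2 hy2
        rw [max_eq_left hx2, max_eq_left hy2]
        simp
      · refine ⟨0, fun C' x hx y hy => ?_⟩
        have hx2 := hx.2
        have hy2 := hy.2
        simp only [half, Set.mem_ofPred_eq, Int.cast_one, Int.cast_neg, neg_mul, one_mul] at hx2 hy2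
        rw [max_eq_right (by linarith), max_eq_right (by linarith)]
        simp
    rw [heval]
    refine divisorWeight_eq_zero_of_linear Λ' hfin' (hℓ C) fun σ hσ => ?_
    obtain ⟨C', hC', rfl⟩ := exists_of_mem_cofaces_half h hC hs hσ
    exact hℓ C'
  · have := divisorWeight_lift_level (a := ω C) (φ := fun _ => 0) (ψ := fun _ => 0)
      (𝒞' := subdivide (liftComplex e S) fs') hΛ
      (nonempty_of_mem_subdivide hC) (.const 0) (fun _ _ => rfl) 1 (c := c) (ω' := ω') ?_
      (lift_half_mem_cofaces_level h hC) ((hω C hC).1)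
    · simpa [heval] using this
    · intro σ hσ hne
      rcases exists_of_mem_cofaces_singleton hS hfs h hC hσ with ⟨C', hC', rfl⟩ | ⟨s, hs, rfl⟩
      · exact absurd (hω C' hC'.1).2 hne
      · rcases hs with rfl | rfl <;> simp

/-- The stage after the height condition: all weight sits at height `c`, half-line cofaces
contribute nothing, and divisors are those of the plane complex. -/
lemma foldl_divisorWeight_level
    (hΛ : ∀ w, w ∈ Λ' ↔ (e w).1 ∈ Λ ∧ ∃ n : ℤ, (e w).2 = n)
    {S : Set (Set V)} (hS : IsFaceComplex S) (hfin : S.Finite) {fs : List (MaxFun V)}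
    (hfs : ∀ f ∈ fs, f.IsAffine) {fs' : List (MaxFun W)} {c : ℝ}
    (h : ∀ f, f ∈ fs' ↔ f = levelFun e c ∨ ∃ g ∈ fs, f = basePull e g)
    (gs : List (MaxFun V)) (hgs : ∀ g ∈ gs, g ∈ fs)
    (ω : Set V → ℝ) (ω' : Set W → ℝ)
    (hω : ∀ C ∈ subdivide S fs, (∀ s : ℤ, s = 1 ∨ s = -1 → ω' (lift e C (half c s)) = 0) ∧
      ω' (lift e C {c}) = ω C) :
    ∀ C ∈ subdivide S fs,
      (gs.map (basePull e)).foldl (fun ω f =>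
        divisorWeight Λ' (subdivide (liftComplex e S) fs') ω f.eval) ω' (lift e C {c}) =
        gs.foldl (fun ω f => divisorWeight Λ (subdivide S fs) ω f.eval) ω C := by
  induction gs generalizing ω ω' with
  | nil => exact fun C hC => (hω C hC).2
  | cons g gs ih =>
    simp only [List.map_cons, List.foldl_cons]
    refine ih (fun g' hg' => hgs g' (List.mem_cons_of_mem _ hg')) _ _ fun C hC => ⟨?_, ?_⟩
    · intro s hs
      refine divisorWeight_eq_zero_of_weight_eq_zero Λ' _ fun σ hσ => ?_
      obtain ⟨C', hC', rfl⟩ := exists_of_mem_cofaces_half h hC hs hσ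
      exact (hω C' hC'.1).1 s hs
    · refine divisorWeight_lift (φ := g.eval) hΛ (hS.subdivide hfs) (finite_subdivide hfin fs) hC
        (nonempty_of_mem_subdivide hC) (isSlidable_singleton c)
        (fun C' hC' => exists_affineFun_of_mem_subdivide hfs hC' (hgs g List.mem_cons_self))
        (fun σ hσ hne => ?_)
        (fun C' hC' => lift_mem_cofaces_level h hC hC' (Or.inl rfl))
        (fun C' hC' => (hω C' hC'.1).2)
      rcases exists_of_mem_cofaces_singleton hS hfs h hC hσ with ⟨C', hC', rfl⟩ | ⟨s, hs, rfl⟩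
      · exact ⟨C', hC', rfl⟩
      · exact absurd ((hω C hC).1 s hs) hne

lemma productWeight_level
    (hΛ : ∀ w, w ∈ Λ' ↔ (e w).1 ∈ Λ ∧ ∃ n : ℤ, (e w).2 = n)
    {S : Set (Set V)} (hS : IsFaceComplex S) (hfin : S.Finite) {fs : List (MaxFun V)}
    (hfs : ∀ f ∈ fs, f.IsAffine) {fs' : List (MaxFun W)} {c : ℝ}
    (h : ∀ f, f ∈ fs' ↔ f = levelFun e c ∨ ∃ g ∈ fs, f = basePull e g)
    {D : ℕ} (hD : ∀ C ∈ S, polyDim C ≤ D) (gs gs' : List (MaxFun V))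
    (hgs : ∀ g ∈ gs, g ∈ fs) (hgs' : ∀ g ∈ gs', g ∈ fs) {C : Set V} (hC : C ∈ subdivide S fs) :
    productWeight Λ' (liftComplex e S) (D + 1) fs'
        (gs.map (basePull e) ++ levelFun e c :: gs'.map (basePull e)) (lift e C {c}) =
      productWeight Λ S D fs (gs ++ gs') C := by
  rw [productWeight, productWeight, List.foldl_append, List.foldl_append, List.foldl_cons]
  refine foldl_divisorWeight_level hΛ hS hfin hfs h gs' hgs' _ _ ?_ C hC
  refine divisorWeight_levelFun hΛ hS hfin hfs h _ _ ?_
  refine foldl_divisorWeight_above hΛ hS hfin hfs h gs hgs _ _ fun C hC => ⟨fun s hs => ?_, ?_⟩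
  · have hs0 : s ≠ 0 := by rcases hs with rfl | rfl <;> norm_num
    rw [polyDim_lift (nonempty_of_mem_subdivide hC) ⟨c, mem_half c s⟩, polyDim_half c hs0]
    simp
  · rw [polyDim_lift (nonempty_of_mem_subdivide hC) (Set.singleton_nonempty c), polyDim_singleton]
    -- Initially only cells of dimension `D + 1` have weight, and a cell over the single height `c`
    -- is too small.
    have : polyDim C ≤ D := by
      obtain ⟨σ, hσ, x, hx, rfl⟩ := hC
      exact (Submodule.finrank_mono (vectorSpan_mono ℝ fun y hy => hy.1)).trans (hD σ hσ)
    rw [if_neg (by omega)]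

/-- The product formula for points: a point is the product of its two components, and the only
one-point cell of the subdivided line is `{c}`. -/
lemma pointMult_level (hΛ : ∀ w, w ∈ Λ' ↔ (e w).1 ∈ Λ ∧ ∃ n : ℤ, (e w).2 = n)
    {S : Set (Set V)} (hS : IsFaceComplex S) (hfin : S.Finite) {D : ℕ}
    (hD : ∀ C ∈ S, polyDim C ≤ D) (gs gs' : List (MaxFun V))
    (hgs : ∀ g ∈ gs, g.IsAffine) (hgs' : ∀ g ∈ gs', g.IsAffine) (c : ℝ) (w : W) [Decidable ((e w).2 = c)] :
    pointMult Λ' (liftComplex e S) (D + 1)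
        (gs.map (basePull e) ++ levelFun e c :: gs'.map (basePull e)) w =
      if (e w).2 = c then pointMult Λ S D (gs ++ gs') (e w).1 else 0 := by
  set fs' := gs.map (basePull e) ++ levelFun e c :: gs'.map (basePull e) with hfs'
  have h : ∀ f, f ∈ fs' ↔ f = levelFun e c ∨ ∃ g ∈ gs ++ gs', f = basePull e g := by
    intro f
    simp only [hfs', List.mem_append, List.mem_map, List.mem_cons, eq_comm (a := f)]
    constructor
    · rintro (⟨a, ha, rfl⟩ | h | ⟨a, ha, rfl⟩)
      exacts [Or.inr ⟨a, Or.inl ha, rfl⟩, Or.inl h, Or.inr ⟨a, Or.inr ha, rfl⟩]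
    · rintro (h | ⟨a, ha | ha, rfl⟩)
      exacts [Or.inr (Or.inl h), Or.inl ⟨a, ha, rfl⟩, Or.inr (Or.inr ⟨a, ha, rfl⟩)]
  have hfs : ∀ f ∈ gs ++ gs', f.IsAffine := by
    intro f hf
    rcases List.mem_append.1 hf with hf | hf
    exacts [hgs f hf, hgs' f hf]
  have hsing : ({w} : Set W) = lift e {(e w).1} {(e w).2} := by
    ext y
    simp only [lift, Set.mem_singleton_iff, Set.mem_ofPred_eq]
    rw [← Prod.ext_iff, e.injective.eq_iff]
  have hmem : ({w} : Set W) ∈ subdivide (liftComplex e S) fs' ↔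
      (e w).2 = c ∧ {(e w).1} ∈ subdivide S (gs ++ gs') := by
    rw [mem_subdivide_liftComplex_level h, hsing]
    constructor
    · rintro ⟨C, hC, J, hJ, heq⟩
      obtain ⟨rfl, rfl⟩ := (lift_inj (Set.singleton_nonempty _) (Set.singleton_nonempty _)
        (nonempty_of_mem_subdivide hC) hJ.nonempty).1 heq
      refine ⟨?_, hC⟩
      rcases hJ with hJ | ⟨s, hs, hJ⟩
      · simpa using hJ
      · have hs0 : s ≠ 0 := by rcases hs with rfl | rfl <;> norm_num
        have h1 := mem_half c s
        have h2 := add_mem_half c s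
        rw [← hJ, Set.mem_singleton_iff] at h1 h2
        rw [← h1] at h2
        simp [hs0] at h2
    · rintro ⟨hc, hC⟩
      exact ⟨_, hC, {c}, Or.inl rfl, by rw [hc]⟩
  rw [pointMult]
  by_cases hc : (e w).2 = c
  · rw [if_pos hc, pointMult]
    by_cases hC : {(e w).1} ∈ subdivide S (gs ++ gs')
    · rw [if_pos (hmem.2 ⟨hc, hC⟩), if_pos hC, hsing, hc]
      exact productWeight_level hΛ hS hfin hfs h hD gs gs'
        (fun g hg => List.mem_append_left _ hg) (fun g hg => List.mem_append_right _ hg) hC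
    · rw [if_neg fun hw => hC (hmem.1 hw).2, if_neg hC]
  · rw [if_neg hc, if_neg fun hw => hc (hmem.1 hw).1]

end LiftProduct

/-! ### The fan of tropical curves -/

/-! ### Splits of a connected graph by an edge -/

section NearSide

variable {X : Type} {G : SimpleGraph X}

/-- The vertex `x` is on the side of the first end point of `e`. -/
def NearSide (G : SimpleGraph X) (e : Sym2 X) (x : X) : Prop :=
  (G.deleteEdges {e}).Reachable x (Quot.out e).1

/-- Follow a walk to `u` until it first uses the removed edge; at that moment it stands at `u` or at
`v`. -/
lemma reachable_deleteEdges_or (hG : G.Connected) {u v : X} (x : X) :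
    (G.deleteEdges {s(u, v)}).Reachable x u ∨ (G.deleteEdges {s(u, v)}).Reachable x v := by
  obtain ⟨p⟩ := hG x u
  induction p with
  | nil => exact Or.inl (SimpleGraph.Reachable.refl _)
  | @cons x y z hxy p ih =>
    by_cases hs : s(x, y) = s(z, v)
    · rcases Sym2.eq_iff.1 hs with ⟨rfl, -⟩ | ⟨rfl, -⟩
      · exact Or.inl (SimpleGraph.Reachable.refl _)
      · exact Or.inr (SimpleGraph.Reachable.refl _)
    · have hadj : (G.deleteEdges {s(z, v)}).Adj x y := by
        rw [SimpleGraph.deleteEdges_adj]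
        exact ⟨hxy, by simpa using hs⟩
      exact ih.imp hadj.reachable.trans hadj.reachable.trans

lemma reachable_of_nearSide_iff (hG : G.Connected) {e : Sym2 X} {x y : X}
    (h : NearSide G e x ↔ NearSide G e y) : (G.deleteEdges {e}).Reachable x y := by
  have he : e = s((Quot.out e).1, (Quot.out e).2) := (Quot.out_eq e).symm
  by_cases hx : NearSide G e x
  · exact hx.trans (h.1 hx).symm
  · have hy := fun hy => hx (h.2 hy)
    have h1 := reachable_deleteEdges_or hG (u := (Quot.out e).1) (v := (Quot.out e).2) x
    have h2 := reachable_deleteEdges_or hG (u := (Quot.out e).1) (v := (Quot.out e).2) y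
    rw [← he] at h1 h2
    exact (h1.resolve_left hx).trans (h2.resolve_left hy).symm

lemma nearSide_iff_of_reachable {e : Sym2 X} {x y : X} (h : (G.deleteEdges {e}).Reachable x y) :
    NearSide G e x ↔ NearSide G e y :=
  ⟨h.symm.trans, h.trans⟩

/-- The splits of two edges are compatible: one of the two sides of `e` lies on one side of `f`. -/
lemma exists_nearSide_compatible (hG : G.Connected) (e : Sym2 X) {f : Sym2 X}
    (hf : f ∈ G.edgeSet) : ∃ β : Prop, ∀ p q, (NearSide G e p ↔ β) → (NearSide G e q ↔ β) →
      (NearSide G f p ↔ NearSide G f q) := by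
  by_cases hef : f = e
  · subst hef
    exact ⟨True, fun p q hp hq => hp.trans hq.symm⟩
  induction f using Sym2.ind with | _ x y =>
  have hxy : (G.deleteEdges {e}).Adj x y := by
    rw [SimpleGraph.deleteEdges_adj]
    exact ⟨hf, by simpa using hef⟩
  -- Take the side of `e` that does not contain `f`. Walks inside this side never meet `x` or `y`,
  -- so they avoid `f`.
  refine ⟨¬ NearSide G e x, fun p q hp hq => nearSide_iff_of_reachable ?_⟩
  obtain ⟨w⟩ := reachable_of_nearSide_iff hG (hp.trans hq.symm)
  induction w with
  | nil => exact SimpleGraph.Reachable.refl _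
  | @cons p r q hpr w ih =>
    have hr : NearSide G e r ↔ ¬ NearSide G e x :=
      (nearSide_iff_of_reachable hpr.reachable).symm.trans hp
    refine SimpleGraph.Reachable.trans ?_ (ih hr hq)
    have hG' := (SimpleGraph.deleteEdges_adj.1 hpr).1
    refine SimpleGraph.Adj.reachable (SimpleGraph.deleteEdges_adj.2 ⟨hG', ?_⟩)
    intro hs
    have hpx : p ≠ x := by rintro rfl; exact (iff_not_self hp).elim
    have hpy : p ≠ y := by
      rintro rfl
      exact iff_not_self ((nearSide_iff_of_reachable hxy.reachable).trans hp)
    rcases Sym2.eq_iff.1 (Set.mem_singleton_iff.1 hs) with ⟨h, -⟩ | ⟨h, -⟩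
    exacts [hpx h, hpy h]

end NearSide

/-! ### Recognizing a set from a separating chain -/

section Chain

/-- If a family of subsets is totally ordered by inclusion and separates each point of `A` from each
point outside of `A`, then `A` belongs to the family. -/
lemma exists_eq_of_chain {ι L : Type} [Finite ι] [Finite L] {F : Set ι} {U : ι → Set L}
    (hchain : ∀ f ∈ F, ∀ g ∈ F, U f ⊆ U g ∨ U g ⊆ U f) {A : Set L}
    (hA : A.Nonempty) (hA' : Aᶜ.Nonempty) (h : ∀ a ∈ A, ∀ b ∉ A, ∃ f ∈ F, a ∈ U f ∧ b ∉ U f) :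
    ∃ f ∈ F, U f = A := by
  have hcard : ∀ f ∈ F, ∀ g ∈ F, (U f).ncard ≤ (U g).ncard → U f ⊆ U g := by
    intro f hf g hg hfg
    rcases hchain f hf g hg with h | h
    · exact h
    · exact (Set.eq_of_subset_of_ncard_le h hfg (Set.toFinite _)).symm.subset
  -- For fixed `b`, the largest member of the chain avoiding `b` contains all the members that
  -- separate points of `A` from `b`, hence contains `A`.
  have h1 : ∀ b ∉ A, ∃ f ∈ F, A ⊆ U f ∧ b ∉ U f := by
    intro b hb
    obtain ⟨a, ha⟩ := hA
    obtain ⟨f₀, hf₀, -, hbf₀⟩ := h a ha b hb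
    obtain ⟨f, ⟨hf, hbf⟩, hmax⟩ := Set.exists_max_image {f | f ∈ F ∧ b ∉ U f}
      (fun f => (U f).ncard) (Set.toFinite _) ⟨f₀, hf₀, hbf₀⟩
    refine ⟨f, hf, fun c hc => ?_, hbf⟩
    obtain ⟨g, hg, hcg, hbg⟩ := h c hc b hb
    exact hcard g hg f hf (hmax g ⟨hg, hbg⟩) hcg
  obtain ⟨b, hb⟩ := hA'
  obtain ⟨f₀, hf₀, hAf₀, -⟩ := h1 b hb
  -- The smallest member containing `A` lies in every member just found, so it misses each point
  -- outside `A`.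
  obtain ⟨f, ⟨hf, hAf⟩, hmin⟩ := Set.exists_min_image {f | f ∈ F ∧ A ⊆ U f}
    (fun f => (U f).ncard) (Set.toFinite _) ⟨f₀, hf₀, hAf₀⟩
  refine ⟨f, hf, Set.Subset.antisymm (fun d hd => ?_) hAf⟩
  by_contra hdA
  obtain ⟨g, hg, hAg, hdg⟩ := h1 d hdA
  exact hdg (hcard f hf g hg (hmin g ⟨hg, hAg⟩) hd)

end Chain

lemma injective_vec {L : Type} {a b c d : L} (hab : a ≠ b) (hac : a ≠ c) (had : a ≠ d) (hbc : b ≠ c)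
    (hbd : b ≠ d) (hcd : c ≠ d) : Function.Injective ![a, b, c, d] := by
  intro i j hij
  fin_cases i <;> fin_cases j <;> simp_all

/-! ### Cones of trees in double ratio coordinates -/

namespace MarkedTree

variable {L : Type} [Fintype L]

lemma side_of_nearSide {T : MarkedTree L} {e : Sym2 (Fin T.nv)} {i : L}
    (h : NearSide T.G e (T.leg i)) : T.side e i = 1 := if_pos h

lemma side_of_not_nearSide {T : MarkedTree L} {e : Sym2 (Fin T.nv)} {i : L}
    (h : ¬ NearSide T.G e (T.leg i)) : T.side e i = 0 := if_neg h

lemma splitVector_apply (T : MarkedTree L) (e : Sym2 (Fin T.nv)) {q : Fin 4 → L}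
    (hq : Function.Injective q) : T.splitVector e q =
      (T.side e (q 1) - T.side e (q 0)) * (T.side e (q 3) - T.side e (q 2)) := if_pos hq

lemma splitVector_apply_of_not_injective (T : MarkedTree L) (e : Sym2 (Fin T.nv)) {q : Fin 4 → L}
    (hq : ¬ Function.Injective q) : T.splitVector e q = 0 := if_neg hq

lemma modulus_combo (T : MarkedTree L) (a b : ℝ) (l l' : Sym2 (Fin T.nv) → ℝ) :
    T.modulus (fun e => a * l e + b * l' e) = a • T.modulus l + b • T.modulus l' := by
  simp only [modulus, add_smul, mul_smul, Finset.sum_add_distrib, Finset.smul_sum]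

lemma modulus_apply_of_not_injective (T : MarkedTree L) (l : Sym2 (Fin T.nv) → ℝ) {q : Fin 4 → L}
    (hq : ¬ Function.Injective q) : T.modulus l q = 0 := by
  simp [modulus, splitVector_apply_of_not_injective T _ hq]

lemma smul_add_smul_mem_cone {T : MarkedTree L} {x y : RatioSpace L} (hx : x ∈ T.cone)
    (hy : y ∈ T.cone) {a b : ℝ} (ha : 0 ≤ a) (hb : 0 ≤ b) : a • x + b • y ∈ T.cone := by
  obtain ⟨l, hl, rfl⟩ := hx
  obtain ⟨l', hl', rfl⟩ := hy
  exact ⟨_, fun e => add_nonneg (mul_nonneg ha (hl e)) (mul_nonneg hb (hl' e)),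
    (T.modulus_combo a b l l').symm⟩

lemma zero_mem_cone (T : MarkedTree L) : (0 : RatioSpace L) ∈ T.cone :=
  ⟨0, fun _ => le_rfl, by simp [modulus]⟩

lemma splitVector_mem_cone (T : MarkedTree L) {e : Sym2 (Fin T.nv)} (he : e ∈ T.G.edgeSet) :
    T.splitVector e ∈ T.cone := by
  classical
  refine ⟨Pi.single e 1, fun f => ?_, ?_⟩
  · by_cases h : f = e
    · subst h; simp
    · simp [h]
  · rw [modulus, Finset.sum_eq_single e]
    · simp
    · intro f _ hf
      simp [hf]
    · intro h
      exact absurd (by simpa using he) h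

lemma sum_mem_cone (T : MarkedTree L) {ι : Type} (s : Finset ι) (f : ι → RatioSpace L)
    (h : ∀ i ∈ s, f i ∈ T.cone) : ∑ i ∈ s, f i ∈ T.cone := by
  classical
  induction s using Finset.induction_on with
  | empty => simpa using T.zero_mem_cone
  | insert i s hi ih =>
    rw [Finset.sum_insert hi]
    simpa using smul_add_smul_mem_cone (h i (by simp)) (ih fun j hj => h j (by simp [hj]))
      zero_le_one zero_le_one

/-- The edge `e` separates the ends `a, c` from the ends `b, d`. -/
def Separates (T : MarkedTree L) (e : Sym2 (Fin T.nv)) (a b c d : L) : Prop :=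
  (NearSide T.G e (T.leg a) ↔ NearSide T.G e (T.leg c)) ∧
  (NearSide T.G e (T.leg b) ↔ NearSide T.G e (T.leg d)) ∧
  ¬ (NearSide T.G e (T.leg a) ↔ NearSide T.G e (T.leg b))

lemma splitVector_eq_one {T : MarkedTree L} {e : Sym2 (Fin T.nv)} {a b c d : L}
    (hq : Function.Injective ![a, b, c, d]) (h : T.Separates e a b c d) :
    T.splitVector e ![a, b, c, d] = 1 := by
  rw [splitVector_apply _ _ hq]
  obtain ⟨h1, h2, h3⟩ := h
  by_cases ha : NearSide T.G e (T.leg a) <;> by_cases hb : NearSide T.G e (T.leg b)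
  · exact absurd (iff_of_true ha hb) h3
  · simp [side_of_nearSide ha, side_of_not_nearSide hb, side_of_nearSide (h1.1 ha),
      side_of_not_nearSide fun h => hb (h2.2 h)]
  · simp [side_of_not_nearSide ha, side_of_nearSide hb, side_of_nearSide (h2.1 hb),
      side_of_not_nearSide fun h => ha (h1.2 h)]
  · exact absurd (iff_of_false ha hb) h3

lemma separates_of_splitVector_pos {T : MarkedTree L} {e : Sym2 (Fin T.nv)} {a b c d : L}
    (h : 0 < T.splitVector e ![a, b, c, d]) : T.Separates e a b c d := by
  have hq : Function.Injective ![a, b, c, d] := by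
    by_contra hq
    rw [splitVector_apply_of_not_injective _ _ hq] at h
    exact lt_irrefl _ h
  rw [splitVector_apply _ _ hq] at h
  change 0 < (T.side e b - T.side e a) * (T.side e d - T.side e c) at h
  have key : ∀ i, (NearSide T.G e (T.leg i) ∧ T.side e i = 1) ∨
      (¬ NearSide T.G e (T.leg i) ∧ T.side e i = 0) := fun i => by
    by_cases hi : NearSide T.G e (T.leg i)
    · exact Or.inl ⟨hi, side_of_nearSide hi⟩
    · exact Or.inr ⟨hi, side_of_not_nearSide hi⟩
  unfold Separates
  rcases key a with ⟨ha, ha'⟩ | ⟨ha, ha'⟩ <;> rcases key b with ⟨hb, hb'⟩ | ⟨hb, hb'⟩ <;>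
    rcases key c with ⟨hc, hc'⟩ | ⟨hc, hc'⟩ <;> rcases key d with ⟨hd, hd'⟩ | ⟨hd, hd'⟩ <;>
    first
    | (exfalso; norm_num [ha', hb', hc', hd'] at h; done)
    | simp [ha, hb, hc, hd]

/-- A negative value would mean that `f` separates `a, d` from `b, c`. By compatibility `f` does not
divide one of the two sides of `e`, so it cannot separate both `a` from `c` and `b` from `d`. -/
lemma splitVector_nonneg_of_separates {T : MarkedTree L} {e f : Sym2 (Fin T.nv)} {a b c d : L}
    (he : T.Separates e a b c d) (hf : f ∈ T.G.edgeSet) :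
    0 ≤ T.splitVector f ![a, b, c, d] := by
  by_cases hq : Function.Injective ![a, b, c, d]
  swap
  · rw [splitVector_apply_of_not_injective _ _ hq]
  obtain ⟨β, hβ⟩ := exists_nearSide_compatible T.isTree.1 e hf
  obtain ⟨h1, h2, h3⟩ := he
  rw [splitVector_apply _ _ hq]
  change 0 ≤ (T.side f b - T.side f a) * (T.side f d - T.side f c)
  have hside : ∀ i j, (NearSide T.G f (T.leg i) ↔ NearSide T.G f (T.leg j)) →
      T.side f i = T.side f j := by
    intro i j hij
    by_cases hi : NearSide T.G f (T.leg i)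
    · rw [side_of_nearSide hi, side_of_nearSide (hij.1 hi)]
    · rw [side_of_not_nearSide hi, side_of_not_nearSide fun hj => hi (hij.2 hj)]
  have hb01 : ∀ i, T.side f i = 0 ∨ T.side f i = 1 := by
    intro i
    by_cases hi : NearSide T.G f (T.leg i)
    · exact Or.inr (side_of_nearSide hi)
    · exact Or.inl (side_of_not_nearSide hi)
  by_cases ha : NearSide T.G e (T.leg a) ↔ β
  · rw [← hside a c (hβ _ _ ha (h1.symm.trans ha))]
    rcases hb01 a with h | h <;> rcases hb01 b with h' | h' <;> rcases hb01 d with h'' | h'' <;>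
      norm_num [h, h', h'']
  · have hb : NearSide T.G e (T.leg b) ↔ β := by tauto
    rw [← hside b d (hβ _ _ hb (h2.symm.trans hb))]
    rcases hb01 a with h | h <;> rcases hb01 b with h' | h' <;> rcases hb01 c with h'' | h'' <;>
      norm_num [h, h', h'']

/-- In `T'` no edge contributes negatively to the coordinate `(a, b, c, d)`, so there is no
cancellation and the coordinate is positive. Some edge of `T` must then contribute positively. -/
lemma exists_separates_of_modulus_eq {T T' : MarkedTree L} {l : Sym2 (Fin T.nv) → ℝ}
    {l' : Sym2 (Fin T'.nv) → ℝ} (hl : ∀ e, 0 ≤ l e) (hl' : ∀ e, 0 ≤ l' e)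
    (heq : T'.modulus l' = T.modulus l) {e : Sym2 (Fin T'.nv)} (he : e ∈ T'.G.edgeSet)
    (hpos : 0 < l' e) {a b c d : L} (hq : Function.Injective ![a, b, c, d])
    (hs : T'.Separates e a b c d) : ∃ f ∈ T.G.edgeSet, T.Separates f a b c d := by
  classical
  have h1 : 0 < T'.modulus l' ![a, b, c, d] := by
    simp only [modulus, Finset.sum_apply, Pi.smul_apply, smul_eq_mul]
    refine Finset.sum_pos' (fun f hf => mul_nonneg (hl' f)
      (splitVector_nonneg_of_separates hs (by simpa using hf))) ⟨e, by simpa using he, ?_⟩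
    rw [splitVector_eq_one hq hs, mul_one]
    exact hpos
  rw [heq] at h1
  simp only [modulus, Finset.sum_apply, Pi.smul_apply, smul_eq_mul] at h1
  obtain ⟨f, hf, hf'⟩ := Finset.exists_lt_of_sum_lt (s := Finset.univ.filter (· ∈ T.G.edgeSet))
    (f := fun _ => (0 : ℝ)) (by simpa using h1)
  exact ⟨f, by simpa using hf, separates_of_splitVector_pos (pos_of_mul_pos_right hf' (hl f))⟩

/-- The proposition `β` absorbs the arbitrary choice of a side of each edge. Exchanging the sides
reverses the signs of both factors. -/
lemma splitVector_eq_of_forall_iff {T T' : MarkedTree L} {e : Sym2 (Fin T'.nv)}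
    {f : Sym2 (Fin T.nv)} {β : Prop} (h : ∀ i, (NearSide T.G f (T.leg i) ↔ β) ↔
      NearSide T'.G e (T'.leg i)) : T.splitVector f = T'.splitVector e := by
  funext q
  by_cases hq : Function.Injective q
  swap
  · rw [splitVector_apply_of_not_injective _ _ hq, splitVector_apply_of_not_injective _ _ hq]
  rw [splitVector_apply _ _ hq, splitVector_apply _ _ hq]
  by_cases hβ : β
  · have : ∀ i, T.side f i = T'.side e i := by
      intro i
      by_cases hi : NearSide T.G f (T.leg i)
      · rw [side_of_nearSide hi, side_of_nearSide ((h i).1 (iff_of_true hi hβ))]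
      · rw [side_of_not_nearSide hi, side_of_not_nearSide fun hj => hi (((h i).2 hj).2 hβ)]
    simp only [this]
  · have : ∀ i, T.side f i = 1 - T'.side e i := by
      intro i
      by_cases hi : NearSide T.G f (T.leg i)
      · rw [side_of_nearSide hi, side_of_not_nearSide fun hj => hβ (((h i).2 hj).1 hi)]
        norm_num
      · rw [side_of_not_nearSide hi, side_of_nearSide ((h i).1 (iff_of_false hi hβ))]
        norm_num
    simp only [this]
    ring

/-- Any two ends on one side of `e` and two on the other are separated by some edge of `T`, which
may depend on them. Among the edges of `T` separating `a₀` from `b₀`, the sides containing `a₀` form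
a chain, and by `exists_eq_of_chain` one of them is exactly the side `A` of `e`. -/
lemma splitVector_mem_cone_of_modulus_eq {T T' : MarkedTree L} {l : Sym2 (Fin T.nv) → ℝ}
    {l' : Sym2 (Fin T'.nv) → ℝ} (hl : ∀ e, 0 ≤ l e) (hl' : ∀ e, 0 ≤ l' e)
    (heq : T'.modulus l' = T.modulus l) {e : Sym2 (Fin T'.nv)} (he : e ∈ T'.G.edgeSet)
    (hpos : 0 < l' e) : T'.splitVector e ∈ T.cone := by
  set A : Set L := {i | NearSide T'.G e (T'.leg i)} with hA
  by_cases hex : ∃ a b c d, a ∈ A ∧ b ∉ A ∧ c ∈ A ∧ d ∉ A ∧ a ≠ c ∧ b ≠ d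
  · obtain ⟨a₀, b₀, c₀, d₀, ha₀, hb₀, hc₀, hd₀, hac, hbd⟩ := hex
    have hsep : ∀ a ∈ A, ∀ b ∉ A, ∀ c ∈ A, ∀ d ∉ A, a ≠ c → b ≠ d →
        ∃ f ∈ T.G.edgeSet, T.Separates f a b c d := by
      intro a ha b hb c hc d hd hac hbd
      have hne : ∀ {x y}, x ∈ A → y ∉ A → x ≠ y := fun hx hy h => hy (h ▸ hx)
      exact exists_separates_of_modulus_eq hl hl' heq he hpos
        (injective_vec (hne ha hb) hac (hne ha hd) (hne hc hb).symm hbd (hne hc hd))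
        ⟨iff_of_true ha hc, iff_of_false hb hd, fun h => hb (h.1 ha)⟩
    let U : Sym2 (Fin T.nv) → Set L := fun f =>
      {i | NearSide T.G f (T.leg i) ↔ NearSide T.G f (T.leg a₀)}
    have hchain : ∀ f ∈ {f | f ∈ T.G.edgeSet ∧ b₀ ∉ U f}, ∀ g ∈ {f | f ∈ T.G.edgeSet ∧ b₀ ∉ U f},
        U f ⊆ U g ∨ U g ⊆ U f := by
      rintro f ⟨hf, hbf⟩ g ⟨hg, hbg⟩
      obtain ⟨β, hβ⟩ := exists_nearSide_compatible T.isTree.1 f hg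
      by_cases hβa : NearSide T.G f (T.leg a₀) ↔ β
      · exact Or.inl fun i hi => hβ _ _ (Iff.trans hi hβa) hβa
      · refine Or.inr fun i hi => ?_
        by_contra hi'
        have hb : NearSide T.G f (T.leg b₀) ↔ β := by
          have : ¬ (NearSide T.G f (T.leg b₀) ↔ NearSide T.G f (T.leg a₀)) := hbf
          tauto
        have hi2 : NearSide T.G f (T.leg i) ↔ β := by
          have : ¬ (NearSide T.G f (T.leg i) ↔ NearSide T.G f (T.leg a₀)) := hi'
          tauto
        exact hbg (Iff.trans (hβ _ _ hb hi2) hi)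
    have hsepU : ∀ a ∈ A, ∀ b ∉ A, ∃ f ∈ {f | f ∈ T.G.edgeSet ∧ b₀ ∉ U f}, a ∈ U f ∧ b ∉ U f := by
      intro a ha b hb
      have hmem : ∃ f ∈ T.G.edgeSet, (NearSide T.G f (T.leg a) ↔ NearSide T.G f (T.leg a₀)) ∧
          ¬ (NearSide T.G f (T.leg b) ↔ NearSide T.G f (T.leg a₀)) ∧
          ¬ (NearSide T.G f (T.leg b₀) ↔ NearSide T.G f (T.leg a₀)) := by
        -- The extra label only serves to obtain four distinct ends: it is `a` itself unless `a =
        -- a₀`, when `c₀` takes its place. The same is done for `d`.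
        have hc : ∃ c ∈ A, a₀ ≠ c ∧ (a = a₀ ∨ a = c) := by
          by_cases h : a = a₀
          · exact ⟨c₀, hc₀, hac, Or.inl h⟩
          · exact ⟨a, ha, fun h' => h h'.symm, Or.inr rfl⟩
        have hd : ∃ d ∉ A, b₀ ≠ d ∧ (b = b₀ ∨ b = d) := by
          by_cases h : b = b₀
          · exact ⟨d₀, hd₀, hbd, Or.inl h⟩
          · exact ⟨b, hb, fun h' => h h'.symm, Or.inr rfl⟩
        obtain ⟨c, hc, hac', hc'⟩ := hc
        obtain ⟨d, hd, hbd', hd'⟩ := hd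
        obtain ⟨f, hf, h1, h2, h3⟩ := hsep a₀ ha₀ b₀ hb₀ c hc d hd hac' hbd'
        refine ⟨f, hf, ?_, ?_, fun h => h3 h.symm⟩
        · rcases hc' with rfl | rfl
          exacts [Iff.rfl, h1.symm]
        · rcases hd' with rfl | rfl
          exacts [fun h => h3 h.symm, fun h => h3 (h.symm.trans h2.symm)]
      obtain ⟨f, hf, h1, h2, h3⟩ := hmem
      exact ⟨f, ⟨hf, h3⟩, h1, h2⟩
    obtain ⟨f, ⟨hf, hf'⟩, hfU⟩ := exists_eq_of_chain hchain ⟨a₀, ha₀⟩ ⟨b₀, hb₀⟩ hsepU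
    rw [← splitVector_eq_of_forall_iff (T := T) (T' := T') (f := f) (e := e)
      (β := NearSide T.G f (T.leg a₀)) fun i => Set.ext_iff.1 hfU i]
    exact T.splitVector_mem_cone hf
  -- If one side of `e` has fewer than two ends, no injective quadruple is separated in pairs, so
  -- all coordinates vanish.
  · have h0 : T'.splitVector e = 0 := by
      funext q
      by_cases hq : Function.Injective q
      swap
      · exact splitVector_apply_of_not_injective _ _ hq
      rw [splitVector_apply _ _ hq, Pi.zero_apply]
      by_contra hne
      have hsub : ∀ i j, T'.side e j - T'.side e i ≠ 0 → (i ∈ A ∧ j ∉ A) ∨ (j ∈ A ∧ i ∉ A) := by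
        intro i j hij
        by_cases hi : NearSide T'.G e (T'.leg i) <;> by_cases hj : NearSide T'.G e (T'.leg j)
        · simp [side_of_nearSide hi, side_of_nearSide hj] at hij
        · exact Or.inl ⟨hi, hj⟩
        · exact Or.inr ⟨hj, hi⟩
        · simp [side_of_not_nearSide hi, side_of_not_nearSide hj] at hij
      have hne' : ∀ {i j : Fin 4}, i ≠ j → q i ≠ q j := fun h h' => h (hq h')
      rcases hsub _ _ (left_ne_zero_of_mul hne) with ⟨h1, h2⟩ | ⟨h1, h2⟩ <;>
        rcases hsub _ _ (right_ne_zero_of_mul hne) with ⟨h3, h4⟩ | ⟨h3, h4⟩ <;>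
        exact hex ⟨_, _, _, _, h1, h2, h3, h4, hne' (by decide), hne' (by decide)⟩
    rw [h0]
    exact T.zero_mem_cone

/-- Edges of positive length in `x` keep positive length in the combination, so their split vectors
lie in `T.cone`, and `x` is a nonnegative combination of these. -/
lemma mem_cone_of_combo_mem_cone {T T' : MarkedTree L} {x y : RatioSpace L} (hx : x ∈ T'.cone)
    (hy : y ∈ T'.cone) {a b : ℝ} (ha : 0 < a) (hb : 0 < b) (h : a • x + b • y ∈ T.cone) :
    x ∈ T.cone := by
  obtain ⟨l, hl, rfl⟩ := hx
  obtain ⟨l', hl', rfl⟩ := hy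
  obtain ⟨l'', hl'', heq⟩ := h
  rw [← modulus_combo] at heq
  refine T.sum_mem_cone _ _ fun e he => ?_
  rcases (hl e).eq_or_lt with h0 | h0
  · rw [← h0, zero_smul]
    exact T.zero_mem_cone
  · have := splitVector_mem_cone_of_modulus_eq hl''
      (fun e => add_nonneg (mul_nonneg ha.le (hl e)) (mul_nonneg hb.le (hl' e))) heq
      (by simpa using he)
      (add_pos_of_pos_of_nonneg (mul_pos ha h0) (mul_nonneg hb.le (hl' e)))
    simpa using smul_add_smul_mem_cone this T.zero_mem_cone h0.le zero_le_one

/-- The valences add up to `2 (nv - 1)` plus the number of ends, and each is at least three. -/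
lemma nv_add_two_le (T : MarkedTree L) : T.nv + 2 ≤ Fintype.card L := by
  classical
  have h1 : ∑ a, (T.G.neighborSet a).ncard = 2 * T.G.edgeFinset.card := by
    rw [← T.G.sum_degrees_eq_twice_card_edges]
    exact Finset.sum_congr rfl fun a _ => by
      rw [Set.ncard_eq_toFinset_card', SimpleGraph.degree, SimpleGraph.neighborFinset]
  have h2 : ∑ a, {i | T.leg i = a}.ncard = Fintype.card L := by
    rw [← Finset.card_univ, Finset.card_eq_sum_card_fiberwise (f := T.leg) (t := Finset.univ)
      (by simp)]
    exact Finset.sum_congr rfl fun a _ => by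
      rw [Set.ncard_eq_toFinset_card']
      congr 1
      ext i
      simp
  have h3 : T.G.edgeFinset.card + 1 = T.nv := by simpa using T.isTree.card_edgeFinset
  have h4 : ∑ _a : Fin T.nv, 3 ≤ ∑ a, ((T.G.neighborSet a).ncard + {i | T.leg i = a}.ncard) :=
    Finset.sum_le_sum fun a _ => T.stable a
  rw [Finset.sum_add_distrib, h1, h2] at h4
  simp at h4
  omega

/-- The cone is spanned by `nv - 1` split vectors. Only this upper bound is needed, so their linear
independence plays no role. -/
lemma polyDim_cone_prod_le (T : MarkedTree L) (m : ℕ) :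
    polyDim (T.cone ×ˢ (Set.univ : Set (Fin m → ℝ))) ≤ moduliDim L m := by
  classical
  let F := {e : Sym2 (Fin T.nv) // e ∈ T.G.edgeSet}
  let g : (F → ℝ) × (Fin m → ℝ) →ₗ[ℝ] RatioSpace L × (Fin m → ℝ) :=
    LinearMap.prodMap (Fintype.linearCombination ℝ fun e : F => T.splitVector e.1) LinearMap.id
  have hle : vectorSpan ℝ (T.cone ×ˢ (Set.univ : Set (Fin m → ℝ))) ≤ LinearMap.range g := by
    have hsub : ∀ x ∈ T.cone ×ˢ (Set.univ : Set (Fin m → ℝ)), x ∈ LinearMap.range g := by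
      rintro ⟨_, p⟩ ⟨⟨l, hl, rfl⟩, -⟩
      refine ⟨(fun e => l e.1, p), ?_⟩
      simp only [g, LinearMap.prodMap_apply, LinearMap.id_apply, Fintype.linearCombination_apply]
      refine Prod.ext ?_ rfl
      change ∑ e : F, l e.1 • T.splitVector e.1 = T.modulus l
      rw [modulus]
      exact (Finset.sum_subtype (p := fun e => e ∈ T.G.edgeSet)
        (Finset.univ.filter fun e => e ∈ T.G.edgeSet)
        (fun e => by simp only [Finset.mem_filter, Finset.mem_univ, true_and])
        fun e => l e • T.splitVector e).symm
    refine Submodule.span_le.2 ?_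
    rintro _ ⟨x, hx, y, hy, rfl⟩
    exact sub_mem (hsub x hx) (hsub y hy)
  have h1 : T.G.edgeFinset.card + 1 = T.nv := by simpa using T.isTree.card_edgeFinset
  have h2 := T.nv_add_two_le
  have h3 : Fintype.card F = T.G.edgeFinset.card := by
    rw [← SimpleGraph.card_edgeSet]
  refine (Submodule.finrank_mono hle).trans ((LinearMap.finrank_range_le g).trans ?_)
  rw [Module.finrank_prod, Module.finrank_fintype_fun_eq_card, Module.finrank_fintype_fun_eq_card,
    Fintype.card_fin, moduliDim, h3]
  omega

end MarkedTree

/-! ### The moduli fan as a finite face complex -/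

section ModuliFan

variable (L : Type) [Fintype L] (m : ℕ)

lemma isFaceComplex_moduliFan : IsFaceComplex (moduliFan L m) := by
  constructor
  · rintro _ ⟨T, rfl⟩ x hx y hy a b ha hb hab
    exact ⟨MarkedTree.smul_add_smul_mem_cone hx.1 hy.1 ha hb, trivial⟩
  · rintro _ ⟨T, rfl⟩ _ ⟨T', rfl⟩ y hy z hz a b ha hb - h
    exact ⟨MarkedTree.mem_cone_of_combo_mem_cone hy.1 hz.1 ha hb h.1, trivial⟩

instance finite_markedTree : Finite (MarkedTree L) := by
  let f : MarkedTree L → Σ n : Fin (Fintype.card L), SimpleGraph (Fin n) × (L → Fin n) := fun T =>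
    ⟨⟨T.nv, by have := T.nv_add_two_le; omega⟩, T.G, T.leg⟩
  refine Finite.of_injective f ?_
  rintro ⟨nv, G, h1, leg, h2⟩ ⟨nv', G', h1', leg', h2'⟩ h
  simp only [f, Sigma.mk.injEq, Fin.mk.injEq] at h
  obtain ⟨rfl, h⟩ := h
  simp at h
  obtain ⟨rfl, rfl⟩ := h
  rfl

lemma finite_moduliFan : (moduliFan L m).Finite :=
  (Set.finite_range fun T : MarkedTree L => T.cone ×ˢ (Set.univ : Set (Fin m → ℝ))).subset
    fun _ ⟨T, h⟩ => ⟨T, h.symm⟩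

lemma polyDim_le_of_mem_moduliFan {C : Set (RatioSpace L × (Fin m → ℝ))}
    (hC : C ∈ moduliFan L m) : polyDim C ≤ moduliDim L m := by
  obtain ⟨T, rfl⟩ := hC
  exact T.polyDim_cone_prod_le m

end ModuliFan

/-! ### Forgetting the last coordinate -/

lemma not_injective_vec {L : Type} {b r i : L} : ¬ Function.Injective ![b, b, r, i] := fun h =>
  absurd (@h 0 1 rfl) (by decide)

lemma isAffine_pullCrossRatio {L : Type} {m : ℕ} (q : Fin 4 → L) :
    (pullCrossRatio q : MaxFun (RatioSpace L × (Fin m → ℝ))).IsAffine := by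
  intro i
  change Fin 2 at i
  fin_cases i
  · exact .of_linear (LinearMap.proj q ∘ₗ LinearMap.fst ℝ (RatioSpace L) (Fin m → ℝ))
  · exact .const 0

/-! ### Splitting off the height from the moduli space -/

section SpacePlane

variable {L : Type} [Fintype L]

/-- The last coordinate of the displacement that is averaged in the evaluation at the end `b`. -/
noncomputable def heightCorrection (v : L → Fin 3 → ℤ) (b : L) : RatioSpace L →ₗ[ℝ] ℝ :=
  ((Fintype.card L : ℝ) - 2)⁻¹ •
    ∑ r : L, ∑ i : L, (v i 2 : ℝ) • LinearMap.proj ![b, b, r, i]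

lemma evalEnd_two (v : L → Fin 3 → ℤ) (b : L) (x : RatioSpace L × (Fin 3 → ℝ)) :
    evalEnd v b b x 2 = x.2 2 + heightCorrection v b x.1 := by
  simp only [evalEnd, heightCorrection, LinearMap.smul_apply, LinearMap.sum_apply,
    LinearMap.proj_apply, smul_eq_mul, div_eq_inv_mul]
  congr 2
  exact Finset.sum_congr rfl fun r _ => Finset.sum_congr rfl fun i _ => mul_comm _ _

/-- The averaged double ratios contain the label `b` twice, and such coordinates vanish on actual
curves, though not on the ambient vector space. -/
lemma heightCorrection_modulus (v : L → Fin 3 → ℤ) (b : L) (T : MarkedTree L)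
    (l : Sym2 (Fin T.nv) → ℝ) : heightCorrection v b (T.modulus l) = 0 := by
  simp [heightCorrection, T.modulus_apply_of_not_injective l not_injective_vec]

/-- The moduli space of maps to `ℝ³` as a product of the moduli space of maps to `ℝ²` with `ℝ`,
by means of the last coordinate of the image of the end `b`. -/
noncomputable def spaceEquiv (v : L → Fin 3 → ℤ) (b : L) :
    (RatioSpace L × (Fin 3 → ℝ)) ≃ₗ[ℝ] (RatioSpace L × (Fin 2 → ℝ)) × ℝ where
  -- The correction makes the ℝ-component equal to the third coordinate of `evalEnd` on the whole
  -- ambient space, so that the height condition is literally a `levelFun`.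
  toFun w := ((w.1, dropLast w.2), w.2 2 + heightCorrection v b w.1)
  map_add' x y := by
    ext
    · rfl
    · rfl
    · simp; ring
  map_smul' a x := by
    ext
    · rfl
    · rfl
    · simp; ring
  invFun p := (p.1.1, ![p.1.2 0, p.1.2 1, p.2 - heightCorrection v b p.1.1])
  left_inv w := by
    refine Prod.ext rfl (funext fun j => ?_)
    fin_cases j
    · rfl
    · rfl
    · simp
  right_inv p := by
    refine Prod.ext (Prod.ext rfl (funext fun j => ?_)) ?_
    · fin_cases j <;> rfl
    · simp

lemma spaceEquiv_fst (v : L → Fin 3 → ℤ) (b : L) (w : RatioSpace L × (Fin 3 → ℝ)) :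
    (spaceEquiv v b w).1 = (w.1, dropLast w.2) := rfl

lemma spaceEquiv_snd (v : L → Fin 3 → ℤ) (b : L) (w : RatioSpace L × (Fin 3 → ℝ)) :
    (spaceEquiv v b w).2 = w.2 2 + heightCorrection v b w.1 := rfl

lemma moduliFan_three (v : L → Fin 3 → ℤ) (b : L) :
    moduliFan L 3 = liftComplex (spaceEquiv v b) (moduliFan L 2) := by
  have key : ∀ T : MarkedTree L, (T.cone ×ˢ Set.univ : Set (RatioSpace L × (Fin 3 → ℝ))) =
      lift (spaceEquiv v b) (T.cone ×ˢ Set.univ) Set.univ := by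
    intro T
    ext w
    simp [lift, spaceEquiv_fst]
  ext σ
  constructor
  · rintro ⟨T, rfl⟩
    exact ⟨_, ⟨T, rfl⟩, key T⟩
  · rintro ⟨_, ⟨T, rfl⟩, rfl⟩
    exact ⟨T, (key T).symm⟩

/-- The correction vanishes on split vectors and hence on the lattice they generate, so the
ℝ-component of a lattice vector is its integral last coordinate. -/
lemma mem_moduliLattice_three (v : L → Fin 3 → ℤ) (b : L) (w : RatioSpace L × (Fin 3 → ℝ)) :
    w ∈ moduliLattice L 3 ↔ (spaceEquiv v b w).1 ∈ moduliLattice L 2 ∧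
      ∃ n : ℤ, (spaceEquiv v b w).2 = n := by
  rw [spaceEquiv_fst, spaceEquiv_snd, moduliLattice, moduliLattice, AddSubgroup.mem_prod,
    AddSubgroup.mem_prod]
  have h0 : ∀ x ∈ AddSubgroup.closure {x : RatioSpace L | ∃ T : MarkedTree L,
      ∃ e ∈ T.G.edgeSet, x = T.splitVector e}, heightCorrection v b x = 0 := by
    intro x hx
    induction hx using AddSubgroup.closure_induction with
    | mem x hx =>
      obtain ⟨T, e, -, rfl⟩ := hx
      simp [heightCorrection, T.splitVector_apply_of_not_injective e not_injective_vec]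
    | zero => simp
    | add x y _ _ hx hy => rw [map_add, hx, hy, add_zero]
    | neg x _ hx => rw [map_neg, hx, neg_zero]
  have hrange : ∀ {k : ℕ} (y : Fin k → ℝ), y ∈ AddMonoidHom.range
      ((Int.castAddHom ℝ).compLeft (Fin k)) ↔ ∃ z : Fin k → ℤ, ∀ j, y j = z j := by
    intro k y
    rw [AddMonoidHom.mem_range]
    exact exists_congr fun z => ⟨fun h j => by rw [← h]; rfl, fun h => funext fun j => (h j).symm⟩
  rw [hrange, hrange]
  constructor
  · rintro ⟨h1, z, hz⟩
    exact ⟨⟨h1, fun j => z j.castSucc, fun j => hz j.castSucc⟩, z 2, by rw [h0 _ h1, hz, add_zero]⟩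
  · rintro ⟨⟨h1, z, hz⟩, n, hn⟩
    dsimp only at h1 hz
    rw [h0 _ h1, add_zero] at hn
    refine ⟨h1, ![z 0, z 1, n], fun j => ?_⟩
    fin_cases j
    · exact hz 0
    · exact hz 1
    · exact hn

lemma moduliDim_three (L : Type) [Fintype L] : moduliDim L 3 = moduliDim L 2 + 1 := rfl

/-- The functions that cut out the image of the end `b`. -/
noncomputable def basePoint (v : L → Fin 2 → ℤ) (b : L) (p : Fin 2 → ℝ) :
    List (MaxFun (RatioSpace L × (Fin 2 → ℝ))) := pullPoint (evalEnd v b b) p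

/-- The functions that cut out all conditions but those on the images of ends in `ℝ³`. -/
noncomputable def otherFuns (v : L → Fin 2 → ℤ) (b : L) (I : Incidence L 3) :
    List (MaxFun (RatioSpace L × (Fin 2 → ℝ))) :=
  I.crossRatios.map pullCrossRatio ++
    I.tangentPoints.flatMap (fun c => pullPoint (evalEnd v b c.1) c.2) ++
    I.tangentLines.map (fun c => pullLine (evalEnd v b c.1) c.2)

lemma basePull_pullCrossRatio (v : L → Fin 3 → ℤ) (b : L) (q : Fin 4 → L) :
    basePull (spaceEquiv v b) (pullCrossRatio q) = pullCrossRatio q := by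
  simp only [basePull, MaxFun.pull, pullCrossRatio]
  congr 1
  funext j
  fin_cases j <;> rfl

lemma basePull_pullLine (v : L → Fin 3 → ℤ) (b k : L) (M : MultiLine) :
    basePull (spaceEquiv v b) (pullLine (evalEnd (fun i => dropLast (v i)) b k) M) =
      pullLine (fun x => dropLast (evalEnd v b k x)) M := by
  simp only [basePull, MaxFun.pull, pullLine]
  congr 1
  funext j
  fin_cases j <;> rfl

lemma map_basePull_pullPoint (v : L → Fin 3 → ℤ) (b k : L) (p : Fin 2 → ℝ) :
    (pullPoint (evalEnd (fun i => dropLast (v i)) b k) p).map (basePull (spaceEquiv v b)) =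
      pullPoint (fun x => dropLast (evalEnd v b k x)) p := by
  simp only [pullPoint, List.map_ofFn]
  congr 1
  funext j
  simp only [Function.comp_apply, basePull, MaxFun.pull]
  congr 1
  funext i
  fin_cases i <;> rfl

lemma pullPoint_three (v : L → Fin 3 → ℤ) (b : L) (p : Fin 3 → ℝ) :
    pullPoint (evalEnd v b b) p = (basePoint (fun i => dropLast (v i)) b (dropLast p)).map
      (basePull (spaceEquiv v b)) ++ [levelFun (spaceEquiv v b) (p 2)] := by
  rw [basePoint, map_basePull_pullPoint]
  have : levelFun (spaceEquiv v b) (p 2) =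
      (⟨1, ![fun x => evalEnd v b b x 2 - p 2, fun _ => 0]⟩ : MaxFun _) := by
    simp only [levelFun, evalEnd_two, spaceEquiv_snd]
  rw [this]
  rfl

lemma map_basePull_otherFuns (v : L → Fin 3 → ℤ) (b : L) (I : Incidence L 3) :
    (otherFuns (fun i => dropLast (v i)) b I).map (basePull (spaceEquiv v b)) =
      I.crossRatios.map pullCrossRatio ++
      I.tangentPoints.flatMap (fun c => pullPoint (fun x => dropLast (evalEnd v b c.1 x)) c.2) ++
      I.tangentLines.map (fun c => pullLine (fun x => dropLast (evalEnd v b c.1 x)) c.2) := by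
  simp only [otherFuns, List.map_append, List.map_map, List.map_flatMap, map_basePull_pullPoint]
  congr 1
  · congr 1
    exact List.map_congr_left fun q _ => basePull_pullCrossRatio v b q
  · exact List.map_congr_left fun c _ => basePull_pullLine v b c.1 c.2

/-- The two plane coordinates of the point condition precede the height function and all other
conditions follow it. This is the form in which `pointMult_level` applies. -/
lemma spaceFuns_eq (v : L → Fin 3 → ℤ) (b : L) (I : Incidence L 3) (p : Fin 3 → ℝ)
    (hI : I.points = [(b, p)]) :
    spaceFuns v b I = (basePoint (fun i => dropLast (v i)) b (dropLast p)).map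
      (basePull (spaceEquiv v b)) ++ levelFun (spaceEquiv v b) (p 2) ::
      (otherFuns (fun i => dropLast (v i)) b I).map (basePull (spaceEquiv v b)) := by
  rw [map_basePull_otherFuns]
  simp only [spaceFuns, conditionFuns, hI, List.flatMap_cons, List.flatMap_nil, List.append_nil,
    pullPoint_three, List.append_assoc, List.nil_append, List.cons_append]

lemma planeFuns_eq (v : L → Fin 2 → ℤ) (b : L) (I : Incidence L 3) (p : Fin 3 → ℝ)
    (hI : I.points = [(b, p)]) :
    planeFuns v b I.plane = basePoint v b (dropLast p) ++ otherFuns v b I := by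
  simp only [planeFuns, conditionFuns, Incidence.plane, hI, otherFuns, basePoint, List.map_cons,
    List.map_nil, List.flatMap_cons, List.flatMap_nil, List.append_nil, List.append_assoc]

lemma isAffineFun_evalEnd {m : ℕ} (v : L → Fin m → ℤ) (b k : L) (j : Fin m) :
    IsAffineFun fun x => evalEnd v b k x j := by
  let ℓ : RatioSpace L × (Fin m → ℝ) →ₗ[ℝ] ℝ := LinearMap.proj j ∘ₗ LinearMap.snd ℝ _ _ +
    ((Fintype.card L : ℝ) - 2)⁻¹ • ∑ r : L, ∑ i : L, (v i j : ℝ) •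
      (LinearMap.proj ![b, k, r, i] ∘ₗ LinearMap.fst ℝ (RatioSpace L) (Fin m → ℝ))
  convert IsAffineFun.of_linear ℓ using 2 with x
  simp only [ℓ, evalEnd, LinearMap.add_apply, LinearMap.smul_apply, LinearMap.sum_apply,
    LinearMap.comp_apply, LinearMap.proj_apply, LinearMap.fst_apply, LinearMap.snd_apply,
    smul_eq_mul, div_eq_inv_mul]
  congr 2
  exact Finset.sum_congr rfl fun r _ => Finset.sum_congr rfl fun i _ => mul_comm _ _

lemma isAffine_of_mem_pullPoint {m : ℕ} (v : L → Fin m → ℤ) (b k : L) (p : Fin m → ℝ)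
    {f : MaxFun (RatioSpace L × (Fin m → ℝ))} (hf : f ∈ pullPoint (evalEnd v b k) p) :
    f.IsAffine := by
  obtain ⟨j, rfl⟩ := (List.mem_ofFn' _ _).1 hf
  intro i
  change Fin 2 at i
  fin_cases i
  · exact (isAffineFun_evalEnd v b k j).sub_const _
  · exact .const 0

lemma isAffine_pullLine (v : L → Fin 2 → ℤ) (b k : L) (M : MultiLine) :
    (pullLine (evalEnd v b k) M).IsAffine := by
  intro i
  change Fin 3 at i
  fin_cases i
  · exact ((isAffineFun_evalEnd v b k 0).sub_const _).const_mul _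
  · exact ((isAffineFun_evalEnd v b k 1).sub_const _).const_mul _
  · exact .const 0

lemma isAffine_of_mem_otherFuns (v : L → Fin 2 → ℤ) (b : L) (I : Incidence L 3)
    {f : MaxFun (RatioSpace L × (Fin 2 → ℝ))} (hf : f ∈ otherFuns v b I) : f.IsAffine := by
  simp only [otherFuns, List.mem_append, List.mem_map, List.mem_flatMap] at hf
  rcases hf with (⟨q, -, rfl⟩ | ⟨c, -, hf⟩) | ⟨c, -, rfl⟩
  · exact isAffine_pullCrossRatio q
  · exact isAffine_of_mem_pullPoint v b c.1 c.2 hf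
  · exact isAffine_pullLine v b c.1 c.2

open Classical in
/-- Multiplicities in the product on the space of maps to `ℝ³` and in the projected product. -/
lemma moduliMult_spaceFuns (v : L → Fin 3 → ℤ) (b : L) (I : Incidence L 3) (p : Fin 3 → ℝ)
    (hI : I.points = [(b, p)]) (w : RatioSpace L × (Fin 3 → ℝ)) :
    moduliMult (spaceFuns v b I) w = if (spaceEquiv v b w).2 = p 2 then
      moduliMult (planeFuns (fun i => dropLast (v i)) b I.plane) (spaceEquiv v b w).1 else 0 := by
  rw [spaceFuns_eq v b I p hI, planeFuns_eq _ b I p hI, moduliMult, moduliMult, moduliDim_three,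
    moduliFan_three v b]
  exact pointMult_level (mem_moduliLattice_three v b) (isFaceComplex_moduliFan L 2)
    (finite_moduliFan L 2) (fun C hC => polyDim_le_of_mem_moduliFan L 2 hC) _ _
    (fun f hf => isAffine_of_mem_pullPoint _ _ _ _ hf)
    (fun f hf => isAffine_of_mem_otherFuns _ _ _ hf) _ _

lemma moduliMult_symm (v : L → Fin 3 → ℤ) (b : L) (I : Incidence L 3) (p : Fin 3 → ℝ)
    (hI : I.points = [(b, p)]) (x : RatioSpace L × (Fin 2 → ℝ)) :
    moduliMult (spaceFuns v b I) ((spaceEquiv v b).symm (x, p 2)) =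
      moduliMult (planeFuns (fun i => dropLast (v i)) b I.plane) x := by
  rw [moduliMult_spaceFuns v b I p hI, LinearEquiv.apply_symm_apply, if_pos rfl]

/-- The section at height `p 2` is injective, preserves multiplicities, and meets every point of
nonzero multiplicity. -/
lemma moduliDegree_spaceFuns (v : L → Fin 3 → ℤ) (b : L) (I : Incidence L 3) (p : Fin 3 → ℝ)
    (hI : I.points = [(b, p)]) : moduliDegree (spaceFuns v b I) =
      moduliDegree (planeFuns (fun i => dropLast (v i)) b I.plane) := by
  change ∑ᶠ w, moduliMult (spaceFuns v b I) w = ∑ᶠ x, moduliMult (planeFuns _ b I.plane) x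
  have hinj : Function.Injective fun x : RatioSpace L × (Fin 2 → ℝ) =>
      (spaceEquiv v b).symm (x, p 2) := fun x y h =>
    (Prod.ext_iff.1 ((spaceEquiv v b).symm.injective h)).1
  rw [← finsum_mem_univ, finsum_mem_inter_support_eq' _ Set.univ
    (Set.range fun x : RatioSpace L × (Fin 2 → ℝ) => (spaceEquiv v b).symm (x, p 2)),
    finsum_mem_range hinj]
  · exact finsum_congr fun x => moduliMult_symm v b I p hI x
  · intro w hw
    refine iff_of_true trivial ⟨(spaceEquiv v b w).1, ?_⟩
    have hw' : (spaceEquiv v b w).2 = p 2 := by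
      by_contra h
      exact hw (by rw [moduliMult_spaceFuns v b I p hI, if_neg h])
    simp only [← hw', Prod.mk.eta, LinearEquiv.symm_apply_apply]

/-- The number of functions and the dimension both drop by one with the height condition. The
cross-ratio product upstairs is the plane one times ℝ, so top-dimensional cells around a point and
its lift correspond. -/
lemma SpaceGeneral.plane {v : L → Fin 3 → ℤ} {b : L} {I : Incidence L 3} {p : Fin 3 → ℝ}
    (hI : I.points = [(b, p)]) (h : SpaceGeneral v b I) :
    PlaneGeneral (fun i => dropLast (v i)) b I.plane := by
  obtain ⟨hcard, ⟨w, hw⟩, hcell⟩ := h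
  set crs : List (MaxFun (RatioSpace L × (Fin 2 → ℝ))) := I.crossRatios.map pullCrossRatio with hcrs
  have hmap : (I.crossRatios.map pullCrossRatio : List (MaxFun (RatioSpace L × (Fin 3 → ℝ)))) =
      crs.map (basePull (spaceEquiv v b)) := by
    rw [hcrs, List.map_map]
    exact List.map_congr_left fun q _ => (basePull_pullCrossRatio v b q).symm
  have hmem : ∀ f, f ∈ crs.map (basePull (spaceEquiv v b)) ↔
      ∃ g ∈ crs, f = basePull (spaceEquiv v b) g := by
    intro f
    simp only [List.mem_map, eq_comm]
  have haff : ∀ f ∈ crs, f.IsAffine := by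
    intro f hf
    obtain ⟨q, -, rfl⟩ := List.mem_map.1 hf
    exact isAffine_pullCrossRatio q
  rw [hmap, moduliFan_three v b] at hcell
  refine ⟨?_, ⟨(spaceEquiv v b w).1, ?_⟩, fun x hx => ?_⟩
  · rw [spaceFuns_eq v b I p hI] at hcard
    rw [planeFuns_eq _ b I p hI]
    simp only [List.length_append, List.length_cons, List.length_map] at hcard ⊢
    omega
  · rw [moduliMult_spaceFuns v b I p hI] at hw
    exact (ite_ne_right_iff.1 hw).2
  · obtain ⟨σ, hσ, hσ0, hxσ, hmin⟩ := hcell ((spaceEquiv v b).symm (x, p 2))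
      (by rwa [moduliMult_symm v b I p hI])
    obtain ⟨C, hC, rfl⟩ := (mem_subdivide_liftComplex hmem).1 hσ
    refine ⟨C, hC, ?_, by simpa [lift] using hxσ, fun τ hτ hxτ => ?_⟩
    · rw [moduliDim_three, productWeight_liftComplex (mem_moduliLattice_three v b)
        (isFaceComplex_moduliFan L 2) (finite_moduliFan L 2) haff hmem _ crs (fun _ h => h) hC] at hσ0
      exact hσ0
    · exact ((lift_subset_lift (nonempty_of_mem_subdivide hC) Set.univ_nonempty).1
        (hmin _ ((mem_subdivide_liftComplex hmem).2 ⟨τ, hτ, rfl⟩) (symm_mem_lift hxτ trivial))).1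

end SpacePlane

/-! ### Lifting plane stable maps to space -/

/-! ### Flows, potentials and a maximum principle on graphs -/

section Graph

/-- On a connected graph every function with sum zero is the divergence of an integral flow. -/
lemma exists_flow {X : Type} [Fintype X] [DecidableEq X] {G : SimpleGraph X}
    [DecidableRel G.Adj] (hG : G.Connected) (d : X → ℤ) (hd : ∑ x, d x = 0) :
    ∃ f : X → X → ℤ, (∀ a c, f a c = -f c a) ∧ ∀ a, ∑ c with G.Adj a c, f a c = d a := by
  -- The divergences form a subgroup. It contains the difference of the indicators of adjacent
  -- vertices, hence of any two vertices by telescoping along a walk.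
  let H : AddSubgroup (X → ℤ) :=
    { carrier := {d | ∃ f : X → X → ℤ, (∀ a c, f a c = -f c a) ∧
        ∀ a, ∑ c with G.Adj a c, f a c = d a}
      zero_mem' := ⟨0, by simp, by simp⟩
      add_mem' := by
        rintro d d' ⟨f, hf, hf'⟩ ⟨g, hg, hg'⟩
        refine ⟨fun a c => f a c + g a c, fun a c => ?_, fun a => ?_⟩
        · change f a c + g a c = -(f c a + g c a)
          rw [hf a c, hg a c]; ring
        · rw [Finset.sum_add_distrib, hf', hg', Pi.add_apply]
      neg_mem' := by
        rintro d ⟨f, hf, hf'⟩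
        refine ⟨fun a c => -f a c, fun a c => congrArg Neg.neg (hf a c), fun a => ?_⟩
        rw [Finset.sum_neg_distrib, hf', Pi.neg_apply] }
  have hadj : ∀ x y, G.Adj x y → (Pi.single x 1 - Pi.single y 1 : X → ℤ) ∈ H := by
    intro x y hxy
    refine ⟨fun a c => (if a = x ∧ c = y then 1 else 0) - (if a = y ∧ c = x then 1 else 0),
      fun a c => ?_, fun a => ?_⟩
    · simp only [and_comm (a := c = x), and_comm (a := c = y)]
      ring
    · rw [Finset.sum_sub_distrib, Pi.sub_apply]
      congr 1
      · by_cases ha : a = x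
        · subst ha
          simp [hxy]
        · simp [ha]
      · by_cases ha : a = y
        · subst ha
          simp [hxy.symm]
        · simp [ha]
  have hwalk : ∀ x y, (Pi.single x 1 - Pi.single y 1 : X → ℤ) ∈ H := by
    intro x y
    obtain ⟨w⟩ := hG x y
    induction w with
    | nil => rw [sub_self]; exact H.zero_mem
    | @cons x z y h _ ih =>
      have := H.add_mem (hadj x z h) ih
      simpa using this
  obtain ⟨r⟩ := hG.nonempty
  -- Since `d` has sum zero, subtracting the indicator of the root in each summand changes nothing
  -- in total.
  have hsum : d = ∑ x, d x • (Pi.single x 1 - Pi.single r 1 : X → ℤ) := by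
    simp only [smul_sub, Finset.sum_sub_distrib, ← Finset.sum_smul, hd, zero_smul, sub_zero]
    funext y
    simp [Finset.sum_apply, Pi.single_apply]
  have : d ∈ H := by
    rw [hsum]
    exact H.sum_mem fun x _ => H.zsmul_mem (hwalk x r) _
  exact this

/-- On a tree every antisymmetric function on the oriented edges is a gradient. -/
lemma exists_potential {X : Type} {G : SimpleGraph X} (hG : G.IsTree) (h : X → X → ℝ) (hh : ∀ a c, h a c = -h c a)
    (r : X) (t : ℝ) : ∃ g : X → ℝ, g r = t ∧ ∀ a c, G.Adj a c → g c - g a = h a c := by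
  classical
  let S : ∀ {x y : X}, G.Walk x y → ℝ := fun w => (w.darts.map fun e => h e.fst e.snd).sum
  choose P hP hP' using hG.existsUnique_path
  have hPr : P r r = SimpleGraph.Walk.nil := (hP' r r _ SimpleGraph.Walk.IsPath.nil).symm
  have key : ∀ a c (hac : G.Adj a c), a ∉ (P c r).support → S (P a r) = h a c + S (P c r) := by
    intro a c hac ha
    have : SimpleGraph.Walk.cons hac (P c r) = P a r :=
      hP' a r _ ((hP c r).cons ha)
    rw [← this]
    simp [S]
  refine ⟨fun x => t - S (P x r), by simp [hPr, S], fun a c hac => ?_⟩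
  -- Of two adjacent vertices, one has a path to the root that is the edge followed by the path of
  -- the other; otherwise the path from `c` through `a` would visit `c` twice.
  by_cases ha : a ∈ (P c r).support
  · have hc : c ∉ (P a r).support := by
      intro hc
      have h1 := hP' c a _ ((hP c r).takeUntil ha)
      have h2 := hP' c a _ (SimpleGraph.Walk.IsPath.of_adj hac.symm)
      have h3 := hP' a r _ ((hP c r).dropUntil ha)
      have h4 := (P c r).take_spec ha
      rw [h1.trans h2.symm, h3] at h4
      have h5 := hP c r
      rw [← h4] at h5
      simp at h5
      exact h5.2 hc
    have := key c a hac.symm hc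
    simp only [this, hh a c]
    ring
  · simp only [key a c hac ha]
    ring

/-- Maximum principle: a function on a connected graph whose differences along edges have the same
signs as a divergence-free function is constant. -/
lemma eq_of_harmonic {X : Type} [Fintype X] {G : SimpleGraph X} [DecidableRel G.Adj]
    (hG : G.Connected) (g : X → ℝ) (k δ : X → X → ℝ)
    (hk : ∀ a c, G.Adj a c → 0 < k a c) (hg : ∀ a c, G.Adj a c → g c - g a = k a c * δ a c)
    (hδ : ∀ a, ∑ c with G.Adj a c, δ a c = 0) (x y : X) : g x = g y := by
  have := hG.nonempty
  obtain ⟨m, hm⟩ := Finite.exists_max g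
  have hstep : ∀ a c, G.Adj a c → g a = g m → g c = g m := by
    intro a c hac ha
    -- At a maximum no difference is positive, so all terms of the vanishing sum are zero and the
    -- neighbors are maxima too.
    have hle : ∀ c ∈ Finset.univ.filter (G.Adj a), δ a c ≤ 0 := by
      intro c hc
      have hac : G.Adj a c := by simpa using hc
      have h1 := hg a c hac
      have h2 := hm c
      by_contra! hpos
      have := mul_pos (hk a c hac) hpos
      linarith
    have := (Finset.sum_eq_zero_iff_of_nonpos hle).1 (hδ a) c (by simpa using hac)
    have h1 := hg a c hac
    rw [this, mul_zero] at h1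
    linarith
  have hall : ∀ z, g z = g m := by
    intro z
    obtain ⟨w⟩ := hG m z
    have : ∀ {u v : X}, G.Walk u v → g u = g m → g v = g m := by
      intro u v w
      induction w with
      | nil => exact id
      | cons h _ ih => exact fun hu => ih (hstep _ _ h hu)
    exact this w rfl
  rw [hall x, hall y]

end Graph

/-! ### Stable maps and their projections -/

section Lifting

variable {L : Type} [Fintype L]

namespace StableMap

lemma spaceEquiv_point {v : L → Fin 3 → ℤ} (C : StableMap v) (b : L) :
    spaceEquiv v b (C.point b) = (C.proj.point b, C.pos (C.leg b) 2) := by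
  refine Prod.ext rfl ?_
  rw [spaceEquiv_snd, point, heightCorrection_modulus, add_zero]

lemma Iso.proj {m : ℕ} {v : L → Fin (m + 1) → ℤ} {C C' : StableMap v} (h : C.Iso C') :
    C.proj.Iso C'.proj := by
  obtain ⟨φ, h1, h2, h3⟩ := h
  exact ⟨φ, h1, h2, fun a => congrArg dropLast (h3 a)⟩

/-- A stable map is determined by its projection and the height of one end. -/
lemma iso_of_proj_iso {m : ℕ} {v : L → Fin (m + 1) → ℤ} {C C' : StableMap v} {b : L}
    (h : C.proj.Iso C'.proj)
    (hb : C'.pos (C'.leg b) (Fin.last m) = C.pos (C.leg b) (Fin.last m)) : C.Iso C' := by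
  classical
  obtain ⟨φ, h1, h2, h3⟩ := h
  change C.G ≃g C'.G at φ
  change ∀ i, φ (C.leg i) = C'.leg i at h1
  change ∀ e ∈ C.G.edgeSet, C'.len (e.map φ) = C.len e at h2
  change ∀ a, dropLast (C'.pos (φ a)) = dropLast (C.pos a) at h3
  refine ⟨φ, h1, h2, fun a => funext fun j => ?_⟩
  refine Fin.lastCases ?_ (fun j => congrFun (h3 a) j) j
  -- Both maps are balanced with the same directions of the ends, so the difference `δ` of their
  -- vertical slopes is divergence-free. As edge lengths are positive, the height difference `g`
  -- satisfies the maximum principle.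
  let g : Fin C.nv → ℝ := fun a => C'.pos (φ a) (Fin.last m) - C.pos a (Fin.last m)
  let δ : Fin C.nv → Fin C.nv → ℝ := fun a c =>
    (C'.edgeDir (φ a) (φ c) (Fin.last m) : ℝ) - C.edgeDir a c (Fin.last m)
  have hconst := eq_of_harmonic C.isTree.1 g (fun a c => C.len s(a, c)) δ
    (fun a c hac => C.len_pos _ hac) ?_ ?_ a (C.leg b)
  · have h0 : g (C.leg b) = 0 := by simp only [g, h1, hb, sub_self]
    rw [h0] at hconst
    exact sub_eq_zero.1 hconst
  · intro a c hac
    have e1 := C.affine a c hac (Fin.last m)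
    have e2 := C'.affine (φ a) (φ c) (φ.map_adj_iff.2 hac) (Fin.last m)
    have e3 : C'.len s(φ a, φ c) = C.len s(a, c) := h2 s(a, c) hac
    rw [e3] at e2
    simp only [g, δ]
    linear_combination e2 - e1
  · intro a
    have e1 := congrFun (C.balanced a) (Fin.last m)
    have e2 := congrFun (C'.balanced (φ a)) (Fin.last m)
    simp only [Pi.add_apply, Finset.sum_apply, Pi.zero_apply] at e1 e2
    have e3 : (Finset.univ.filter fun i => C'.leg i = φ a) =
        Finset.univ.filter fun i => C.leg i = a := by
      ext i
      simp [← h1]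
    have e4 : ∑ c with C'.G.Adj (φ a) c, C'.edgeDir (φ a) c (Fin.last m) =
        ∑ c with C.G.Adj a c, C'.edgeDir (φ a) (φ c) (Fin.last m) := by
      simp only [Finset.sum_filter]
      rw [← Equiv.sum_comp φ.toEquiv]
      refine Finset.sum_congr rfl fun c _ => ?_
      have : C'.G.Adj (φ a) (φ.toEquiv c) ↔ C.G.Adj a c := φ.map_adj_iff
      simp only [this]
      rfl
    rw [e3, e4] at e2
    simp only [δ, Finset.sum_sub_distrib]
    have e5 : ∑ c with C.G.Adj a c, C'.edgeDir (φ a) (φ c) (Fin.last m) =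
      ∑ c with C.G.Adj a c, C.edgeDir a c (Fin.last m) := by linarith
    have := congrArg (Int.cast : ℤ → ℝ) e5
    push_cast at this
    rw [this, sub_self]

/-- Every stable map to `ℝ^m` lifts to `ℝ^(m+1)` if the last coordinates of the directions of the
ends have sum zero. -/
lemma exists_proj_iso {m : ℕ} {v : L → Fin (m + 1) → ℤ} (hv : ∑ i, v i (Fin.last m) = 0)
    (B : StableMap fun i => dropLast (v i)) (b : L) (t : ℝ) :
    ∃ C : StableMap v, C.proj.Iso B ∧ C.proj.point b = B.point b ∧
      C.pos (C.leg b) (Fin.last m) = t := by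
  classical
  -- Balancing in the last coordinate prescribes the divergence of the vertical slopes; slope times
  -- edge length is then integrated to a height, normalized at the end `b`.
  obtain ⟨f, hf, hf'⟩ := exists_flow B.isTree.1
    (fun a => -∑ i with B.leg i = a, v i (Fin.last m)) (by
      rw [Finset.sum_neg_distrib, Finset.sum_fiberwise, hv, neg_zero])
  obtain ⟨g, hg, hg'⟩ := exists_potential B.isTree (fun a c => B.len s(a, c) * f a c)
    (fun a c => by rw [hf a c, Sym2.eq_swap]; push_cast; ring) (B.leg b) t
  let C : StableMap v :=
    { toTropCurve := B.toTropCurve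
      pos := fun a => Fin.snoc (α := fun _ => ℝ) (B.pos a) (g a)
      edgeDir := fun a c => Fin.snoc (α := fun _ => ℤ) (B.edgeDir a c) (f a c)
      affine := by
        intro a c hac j
        refine Fin.lastCases ?_ (fun j => ?_) j
        · simpa using hg' a c hac
        · simpa using B.affine a c hac j
      balanced := by
        intro a
        funext j
        simp only [Pi.add_apply, Finset.sum_apply, Pi.zero_apply]
        refine Fin.lastCases ?_ (fun j => ?_) j
        · simp only [Fin.snoc_last]
          have := hf' a
          simp only [Finset.sum_filter] at this ⊢
          linarith
        · simp only [Fin.snoc_castSucc]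
          have := congrFun (B.balanced a) j
          simp only [Pi.add_apply, Finset.sum_apply, Pi.zero_apply] at this
          exact this }
  have hpos : ∀ a, dropLast (C.pos a) = B.pos a := fun a => funext fun j => by
    simp [C, dropLast]
  refine ⟨C, ⟨SimpleGraph.Iso.refl, fun i => rfl, fun e _ => ?_, fun a => (hpos a).symm⟩, ?_, ?_⟩
  · change B.len (e.map id) = B.len e
    rw [Sym2.map_id]
    rfl
  · exact Prod.ext rfl (hpos _)
  · change Fin.snoc (α := fun _ => ℝ) (B.pos (B.leg b)) (g (B.leg b)) (Fin.last m) = t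
    rw [Fin.snoc_last, hg]

end StableMap

end Lifting

/-! ### Vertical balance at a floor and conclusion -/

namespace FloorDiagram

variable {E : Type} [Fintype E] {D : LabeledDegree E} {n l : ℕ} {S : Conditions D n l}
  (F : FloorDiagram S) (i : Fin n)

/-- The local labels as a disjoint union. -/
def localLabelEquiv : F.LocalLabel i ≃ Unit ⊕ {e // F.home e = i ∧ D.IsVertical e} ⊕
    {k // F.G.Adj i k} ⊕ (Fin (F.size i) × Fin 3) where
  toFun
    | .point => Sum.inl ()
    | .vert e h => Sum.inr (Sum.inl ⟨e, h⟩)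
    | .cut k h => Sum.inr (Sum.inr (Sum.inl ⟨k, h⟩))
    | .std a c => Sum.inr (Sum.inr (Sum.inr (a, c)))
  invFun
    | Sum.inl () => .point
    | Sum.inr (Sum.inl e) => .vert e.1 e.2
    | Sum.inr (Sum.inr (Sum.inl k)) => .cut k.1 k.2
    | Sum.inr (Sum.inr (Sum.inr p)) => .std p.1 p.2
  left_inv x := by cases x <;> rfl
  right_inv x := by rcases x with _ | _ | _ | _ <;> rfl

/-- This is the balancing condition of the floor diagram at `v_i`; each triple of standard ends
contributes one, through its end of direction `(1,1,1)`. It is the condition under which plane maps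
lift. -/
lemma sum_localDir_two : ∑ x, F.localDir i x 2 = 0 := by
  classical
  rw [← Equiv.sum_comp (F.localLabelEquiv i).symm, Fintype.sum_sum_type, Fintype.sum_sum_type,
    Fintype.sum_sum_type]
  have h1 : ∑ x : Unit, F.localDir i ((F.localLabelEquiv i).symm (Sum.inl x)) 2 = 0 := by
    simp [localLabelEquiv, localDir]
  have h2 : ∑ x : {e // F.home e = i ∧ D.IsVertical e},
      F.localDir i ((F.localLabelEquiv i).symm (Sum.inr (Sum.inl x))) 2 =
      ∑ e with F.home e = i ∧ D.IsVertical e, D.dir e 2 :=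
    (Finset.sum_subtype (p := fun e => F.home e = i ∧ D.IsVertical e)
      (Finset.univ.filter fun e => F.home e = i ∧ D.IsVertical e)
      (fun e => by simp only [Finset.mem_filter, Finset.mem_univ, true_and])
      fun e => D.dir e 2).symm
  have h3 : ∑ x : {k // F.G.Adj i k},
      F.localDir i ((F.localLabelEquiv i).symm (Sum.inr (Sum.inr (Sum.inl x)))) 2 =
      (∑ k with F.G.Adj i k ∧ i < k, (F.weight s(i, k) : ℤ)) -
        ∑ k with F.G.Adj i k ∧ k < i, (F.weight s(i, k) : ℤ) := by
    trans ∑ k with F.G.Adj i k,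
      if i < k then (F.weight s(i, k) : ℤ) else -(F.weight s(i, k) : ℤ)
    · rw [Finset.sum_subtype (p := fun k => F.G.Adj i k)
        (Finset.univ.filter fun k => F.G.Adj i k)
        (fun k => by simp only [Finset.mem_filter, Finset.mem_univ, true_and])]
      refine Finset.sum_congr rfl fun k _ => ?_
      change (if i < k.1 then _ else _ : Fin 3 → ℤ) 2 = _
      split_ifs <;> rfl
    · simp only [Finset.sum_filter]
      rw [← Finset.sum_sub_distrib]
      refine Finset.sum_congr rfl fun k _ => ?_
      by_cases hk : F.G.Adj i k
      · rcases lt_or_gt_of_ne hk.ne with h | h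
        · simp [hk, h, h.not_gt]
        · simp [hk, h, h.not_gt]
      · simp [hk]
  have h4 : ∑ x : Fin (F.size i) × Fin 3,
      F.localDir i ((F.localLabelEquiv i).symm (Sum.inr (Sum.inr (Sum.inr x)))) 2 =
      (Finset.univ.filter fun e => F.home e = i ∧ D.IsDiagonal e).card := by
    rw [Fintype.sum_prod_type]
    change ∑ _x : Fin (F.size i), ∑ c : Fin 3,
      (![![1, 1, 1], ![-1, 0, 0], ![0, -1, 0]] : Fin 3 → Fin 3 → ℤ) c 2 = _
    simp only [Fin.sum_univ_three, Matrix.cons_val, add_zero, Finset.sum_const, Finset.card_univ,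
      Fintype.card_fin, nsmul_eq_mul, mul_one]
    rfl
  rw [h1, h2, h3, h4]
  have := F.balanced i
  linarith

end FloorDiagram

theorem mainTheorem10 {E : Type} [Fintype E] {n l : ℕ} [NeZero n] (D : LabeledDegree E)
    (S : Conditions D n l) (hS : S.InGeneralPosition) (F : FloorDiagram S) (i : Fin n)
    (P Q : Fin n → Fin 2 → ℝ) :
    (SpaceGeneral (F.localDir i) .point (F.localIncidence i P Q) →
      PlaneGeneral (F.planeDir i) .point (F.localIncidence i P Q).plane) ∧
    F.vertexMult i P Q = F.planeDegree i P Q ∧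
    (∀ C : StableMap (F.localDir i), F.spaceMult i P Q C ≠ 0 →
      F.planeMult i P Q (F.project C) = F.spaceMult i P Q C) ∧
    (∀ C C' : StableMap (F.localDir i), F.spaceMult i P Q C ≠ 0 → F.spaceMult i P Q C' ≠ 0 →
      ((F.project C).Iso (F.project C') ↔ C.Iso C')) ∧
    (∀ B : StableMap (F.planeDir i), F.planeMult i P Q B ≠ 0 →
      ∃ C : StableMap (F.localDir i), F.spaceMult i P Q C ≠ 0 ∧ (F.project C).Iso B) := by
  classical
  have hI : (F.localIncidence i P Q).points = [(.point, S.p i)] := rfl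
  -- At actual stable maps the height correction vanishes, so the ℝ-component of the moduli point is
  -- the true height of the contracted end.
  have hmult : ∀ C : StableMap (F.localDir i), F.spaceMult i P Q C =
      if C.pos (C.leg .point) 2 = S.p i 2 then F.planeMult i P Q (F.project C) else 0 := by
    intro C
    rw [FloorDiagram.spaceMult, moduliMult_spaceFuns _ _ _ _ hI, C.spaceEquiv_point]
    rfl
  have hheight : ∀ C : StableMap (F.localDir i), F.spaceMult i P Q C ≠ 0 →
      C.pos (C.leg .point) 2 = S.p i 2 := by
    intro C hC
    rw [hmult] at hC
    exact (ite_ne_right_iff.1 hC).1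
  refine ⟨fun h => h.plane hI, moduliDegree_spaceFuns _ _ _ _ hI, fun C hC => ?_,
    fun C C' hC hC' => ⟨fun h => ?_, fun h => h.proj⟩, fun B hB => ?_⟩
  · rw [hmult, if_pos (hheight C hC)]
  · exact StableMap.iso_of_proj_iso (b := .point) h ((hheight C' hC').trans (hheight C hC).symm)
  -- The lift is placed at the height of the point condition. Since its projection has the same
  -- moduli point as `B`, not merely an isomorphic curve, the multiplicities agree directly.
  · obtain ⟨C, hCB, hpt, ht⟩ := StableMap.exists_proj_iso (m := 2) (F.sum_localDir_two i) B .point (S.p i 2)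
    refine ⟨C, ?_, hCB⟩
    change C.pos (C.leg .point) 2 = S.p i 2 at ht
    rw [hmult, if_pos ht]
    change moduliMult _ (C.proj.point .point) ≠ 0
    rw [hpt]
    exact hB
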